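/- **Setting.** Let $d\in\{2,3\}$, $D=\mathbb T^d=[-\pi,\pi]^d$ with opposite faces identified, $T>0$, $L^2_x=L^2(D;\mathbb R^d)$ with its Borel $\sigma$-algebra, and $\mathcal P(L^2_x)$ the set of Borel probability measures on $L^2_x$. Consider the incompressible Euler equations $\partial_t u+u\cdot\nabla u+\nabla p=0$, $\operatorname{div}u=0$ on $[0,T)\times D$. *Test fields* are the $\phi\in C_c^\infty([0,T)\times D;\mathbb R^d)$ with $\operatorname{div}\phi=0$. **The set $\mathcal G$.** Let $\mathcal C$ be the set of $\bar v\in C^1(D;\mathbb R^d)$ that are the initial value of a classical ($C^1$ on $[0,T)\times D$, periodic pressure) solution $v$ with $C(\bar v):=\sup_{t\in[0,T)}\|\nabla v(t)\|_{L^\infty}<\infty$, where $|\nabla v|$ is the Euclidean operator norm. Put $$\mathcal G=\bigcap_{n\ge1}\mathcal G_n,\qquad \mathcal G_n=\Big\{\bar u\in L^2_x\ \Big|\ \exists\,\bar v\in\mathcal C:\ \|\bar u-\bar v\|_{L^2_x}<\tfrac1n e^{-C(\bar v)T}\Big\}.$$ **Time-parametrized measures.** A map $[0,T)\ni t\mapsto\mu_t\in\mathcal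 P(L^2_x)$ is *weak-$*$ measurable* if $t\mapsto\int F\,d\mu_t$ is measurable for every bounded continuous $F:L^2_x\to\mathbb R$; it belongs to $L^1_t(\mathcal P)$ if moreover $\int_0^T\int\|u\|_{L^2_x}\,d\mu_t(u)\,dt<\infty$. It is *time-regular* if there are $L,C>0$ and, for a.e. $(s,t)\in[0,T)^2$, a transport plan $\pi_{s,t}\in\mathcal P(L^2_x\times L^2_x)$ from $\mu_s$ to $\mu_t$ with $\int\|u-v\|_{H^{-L}}\,d\pi_{s,t}(u,v)\le C|t-s|$, where $\|u\|_{H^{-L}}^2=\sum_{k\in\mathbb Z^d}(1+|k|^2)^{-L}|\widehat u(k)|^2$. **Correlation measures.** The correlation measure associated with $\mu\in\mathcal P(L^2_x)$ (with finite second moment) is the a.e. uniquely determined hierarchy $\boldsymbol\nu=(\nu^1,\nu^2,\dots)$ of measurable maps $\nu^k:D^k\to\mathcal P((\mathbb R^d)^k)$ which is $L^2$-bounded ($\int_D\langle\nu^1_x,|\xi|^2\rangle dx<\infty$), symmetric (for every permutation $\sigma$ of $\{1,\dots,k\}$ and a.e. $x$, $\nu^k_{(x_{\sigma_1},\dots,x_{\sigma_k})}$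 is the image of $\nu^k_x$ under $\xi\mapsto(\xi_{\sigma_1},\dots,\xi_{\sigma_k})$), consistent (for a.e. $x$, the marginal of $\nu^{k+1}_{x_1,\dots,x_{k+1}}$ on the first $k$ components is $\nu^k_{x_1,\dots,x_k}$), diagonally continuous ($\lim_{r\to0}\int_D\frac1{|B_r(x)|}\int_{B_r(x)}\langle\nu^2_{x,y},|\xi_1-\xi_2|^2\rangle\,dy\,dx=0$), and satisfies $\int_{D^k}\int g(x,\xi)\,d\nu^k_x(\xi)\,dx=\int_{L^2_x}\int_{D^k}g(x,u(x_1),\dots,u(x_k))\,dx\,d\mu(u)$ for all $k\ge1$ and $g\in C_0(D^k\times(\mathbb R^d)^k)$. **Statistical solutions.** A time-regular $\mu_t\in L^1_t(\mathcal P)$ is a *statistical solution* with initial data $\bar\mu\in\mathcal P(L^2_x)$ if, with $\boldsymbol\nu_t,\bar{\boldsymbol\nu}$ the correlation measures associated with $\mu_t$ (for a.e. $t$) and $\bar\mu$: 1. for all $k\ge1$ and all test fields $\phi_1,\dots,\phi_k$, with $\phi(t,x)=\phi_1(t,x_1)\otimes\dots\otimes\phi_k(t,x_k)$, $$\int_0^T\!\!\int_{D^k}\Big(\langle\nu^k_{t,x},\xi_1\otimes\dots\otimes\xi_k\rangle:\partial_t\phi+\sum_{i=1}^k\Big\langle\nu^k_{t,x},\prod_{j\ne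 i}(\xi_j\cdot\phi_j)\,\big((\xi_i\cdot\nabla_{x_i})\phi_i\big)\cdot\xi_i\Big\rangle\Big)dx\,dt+\int_{D^k}\langle\bar\nu^k_x,\xi_1\otimes\dots\otimes\xi_k\rangle:\phi(0,x)\,dx=0,$$ with absolutely convergent integrals; 2. for every $\psi\in C^\infty(D)$ and a.e. $t$, $\int_{D^2}\langle\nu^2_{t,x_1,x_2},\xi_1\otimes\xi_2\rangle:(\nabla\psi(x_1)\otimes\nabla\psi(x_2))\,dx_1dx_2=0$. It is *dissipative* if for all $M\ge1$, $\alpha_1,\dots,\alpha_M>0$ with $\sum_i\alpha_i=1$, and all $\bar\mu_1,\dots,\bar\mu_M\in\mathcal P(L^2_x)$ with $\sum_i\alpha_i\bar\mu_i=\bar\mu$, there are weak-$*$ measurable $t\mapsto\mu_{i,t}\in\mathcal P(L^2_x)$ with $\sum_i\alpha_i\mu_{i,t}=\mu_t$ for all $t\in[0,T)$ and $\mu_{i,0}=\bar\mu_i$, such that for each $i$ $$\int_0^T\!\!\int_{L^2_x}\int_D\big[u\cdot\partial_t\phi+(u\otimes u):\nabla\phi\big]dx\,d\mu_{i,t}(u)\,dt=-\int_{L^2_x}\int_Du\cdot\phi(0,x)\,dx\,d\bar\mu_i(u)$$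 for all test fields $\phi$, and $\int\|u\|_{L^2_x}^2d\mu_{i,t}\le\int\|u\|_{L^2_x}^2d\bar\mu_i$ for a.e. $t\in[0,T)$. **Theorem.** If $\bar\mu\in\mathcal P(L^2_x)$ satisfies $\bar\mu(\mathcal G)=1$ and $\bar\mu(\{u:\|u\|_{L^2_x}<M\})=1$ for some $M>0$, then there exists a dissipative statistical solution $\mu_t$ on $[0,T)$ of the incompressible Euler equations with initial data $\bar\mu$, and it is unique: every dissipative statistical solution $\mu'_t$ with initial data $\bar\mu$ satisfies $\mu'_t=\mu_t$ for a.e. $t\in[0,T)$. -/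

import Mathlib

open MeasureTheory ProbabilityTheory Filter Topology
open scoped ENNReal NNReal ContDiff

noncomputable section

namespace EulerStat

/-! ### The torus, the phase space and `L²` -/

/-- Needed for the measure and the Fourier characters on the circle `ℝ / 2πℤ`. -/
instance factTwoPiPos : Fact ((0 : ℝ) < 2 * Real.pi) := ⟨Real.two_pi_pos⟩

/-- The flat torus `D = 𝕋ᵈ = [-π, π]ᵈ` with end points identified; its `volume` is Lebesgue measure
(of total mass `(2π)ᵈ`). -/
abbrev Torus (d : ℕ) : Type := Fin d → AddCircle (2 * Real.pi)

/-- The phase space `U = ℝᵈ` with the Euclidean norm. -/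
abbrev Vec (d : ℕ) : Type := EuclideanSpace ℝ (Fin d)

/-- `L²ₓ = L²(D; U)`. -/
abbrev L2 (d : ℕ) : Type := Lp (Vec d) 2 (volume : Measure (Torus d))

/-- `L²ₓ` carries its Borel σ-algebra. -/
instance measurableSpaceL2 (d : ℕ) : MeasurableSpace (L2 d) := borel _

instance borelSpaceL2 (d : ℕ) : BorelSpace (L2 d) := ⟨rfl⟩

/-- The real inner product of `ℝᵈ`. -/
def dot {d : ℕ} (a b : Vec d) : ℝ := inner ℝ a b

/-- The covering map `ℝᵈ → 𝕋ᵈ`. -/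
def toTorus {d : ℕ} (y : Vec d) : Torus d := fun i => (y i : AddCircle (2 * Real.pi))

/-! ### Calculus on `[0, T) × 𝕋ᵈ` -/

/-- Spatial (Fréchet) derivative of a function on the torus. -/
def spaceDeriv {d : ℕ} {F : Type*} [NormedAddCommGroup F] [NormedSpace ℝ F]
    (f : Torus d → F) (x : Torus d) : Vec d →L[ℝ] F :=
  fderiv ℝ (fun h : Vec d => f (x + toTorus h)) 0

/-- Gradient of a scalar function on the torus. -/
def grad {d : ℕ} (f : Torus d → ℝ) (x : Torus d) : Vec d :=
  gradient (fun h : Vec d => f (x + toTorus h)) 0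

/-- Divergence of a vector field on the torus. -/
def divergence {d : ℕ} (f : Torus d → Vec d) (x : Torus d) : ℝ :=
  ∑ i, (spaceDeriv f x (EuclideanSpace.single i 1)) i

/-- Time derivative on `[0, T)` (one-sided at `t = 0`). -/
def timeDeriv {F : Type*} [NormedAddCommGroup F] [NormedSpace ℝ F]
    (T : ℝ) (f : ℝ → F) (t : ℝ) : F :=
  derivWithin f (Set.Ico 0 T) t

/-- `φ ∈ Cⁿ([0, T) × D)`, i.e. its `2π`-periodic lift is of class `Cⁿ` on `[0, T) × ℝᵈ`. -/
def IsCn {d : ℕ} {F : Type*} [NormedAddCommGroup F] [NormedSpace ℝ F]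
    (n : WithTop ℕ∞) (T : ℝ) (φ : ℝ → Torus d → F) : Prop :=
  ContDiffOn ℝ n (fun q : ℝ × Vec d => φ q.1 (toTorus q.2)) (Set.Ico 0 T ×ˢ Set.univ)

/-- Divergence-free test vector fields `φ ∈ C_c^∞([0, T) × D; ℝᵈ)`. -/
structure IsTestField {d : ℕ} (T : ℝ) (φ : ℝ → Torus d → Vec d) : Prop where
  smooth : IsCn ∞ T φ
  compactSupport : ∃ T' < T, ∀ t ∈ Set.Ico 0 T, T' ≤ t → ∀ x, φ t x = 0
  divFree : ∀ t ∈ Set.Ico 0 T, ∀ x, divergence (φ t) x = 0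

/-! ### Classical solutions of the incompressible Euler equations and the set `𝒢` -/

/-- `(v, p)` is a classical (`C¹`) solution on `[0, T) × D` of
`∂ₜ v + v · ∇v + ∇p = 0`, `div v = 0`. -/
structure IsClassicalSolution {d : ℕ} (T : ℝ) (v : ℝ → Torus d → Vec d)
    (p : ℝ → Torus d → ℝ) : Prop where
  velocity_C1 : IsCn 1 T v
  pressure_C1 : ∀ t ∈ Set.Ico 0 T, ContDiff ℝ 1 (fun y : Vec d => p t (toTorus y))
  momentum : ∀ t ∈ Set.Ico 0 T, ∀ x,
    timeDeriv T (fun s => v s x) t + spaceDeriv (v t) x (v t x) + grad (p t) x = 0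
  divFree : ∀ t ∈ Set.Ico 0 T, ∀ x, divergence (v t) x = 0

/-- `vbar ∈ 𝒞` with `C(vbar) = C`: the datum `vbar` is the initial value of a classical solution `v`
on `[0, T)` for which `C = sup_{t ∈ [0, T)} ‖∇v(t)‖_{L^∞}` is finite. The norm of the matrix `∇v` is
the operator norm with respect to the Euclidean norm. -/
def IsClassicalDatum {d : ℕ} (T : ℝ) (vbar : L2 d) (C : ℝ) : Prop :=
  ∃ (v : ℝ → Torus d → Vec d) (p : ℝ → Torus d → ℝ),
    IsClassicalSolution T v p ∧ (vbar : Torus d → Vec d) =ᵐ[volume] v 0 ∧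
      IsLUB {c : ℝ | ∃ t ∈ Set.Ico 0 T, ∃ x, c = ‖spaceDeriv (v t) x‖} C

/-- The set `𝒢ₙ` of all `ubar ∈ L²ₓ` such that `‖ubar - vbar‖ < (1/n) exp (-C(vbar) T)` for some
`vbar ∈ 𝒞`. -/
def genericSetAt (d : ℕ) (T : ℝ) (n : ℕ) : Set (L2 d) :=
  {ubar | ∃ (vbar : L2 d) (C : ℝ), IsClassicalDatum T vbar C ∧
    ‖ubar - vbar‖ < 1 / (n : ℝ) * Real.exp (-(C * T))}

/-- `𝒢 = ⋂_{n ≥ 1} 𝒢ₙ`. -/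
def genericSet (d : ℕ) (T : ℝ) : Set (L2 d) :=
  {ubar | ∀ n : ℕ, 1 ≤ n → ubar ∈ genericSetAt d T n}

/-! ### Time-parametrized probability measures -/

/-- Weak-* measurability of `t ↦ μ_t`, `t ∈ [0, T)`: the map `t ↦ ∫ F dμ_t` is (Lebesgue)
measurable on `[0, T)` for all `F ∈ C_b(L²ₓ)`. -/
def IsWeakStarMeasurable {d : ℕ} (T : ℝ) (μ : ℝ → ProbabilityMeasure (L2 d)) : Prop :=
  ∀ F : BoundedContinuousFunction (L2 d) ℝ,
    AEMeasurable (fun t => ∫ u, F u ∂(μ t : Measure (L2 d))) (volume.restrict (Set.Ico 0 T))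

/-- The space `L¹_t(𝒫) = L¹([0, T); 𝒫(L²ₓ))`. -/
structure IsL1P {d : ℕ} (T : ℝ) (μ : ℝ → ProbabilityMeasure (L2 d)) : Prop where
  weakStarMeasurable : IsWeakStarMeasurable T μ
  integrable : ∫⁻ t in Set.Ico 0 T, ∫⁻ u, ‖u‖ₑ ∂(μ t : Measure (L2 d)) < ⊤

/-- The character `x ↦ exp (i k · x)` of the torus. -/
def character {d : ℕ} (k : Fin d → ℤ) (x : Torus d) : ℂ := ∏ i, fourier (k i) (x i)

/-- The `j`-th component of the Fourier coefficient
`û(k) = (2π)⁻ᵈ ∫_D u(x) exp (-i k · x) dx`. -/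
def fourierCoefficient {d : ℕ} (u : L2 d) (k : Fin d → ℤ) (j : Fin d) : ℂ :=
  (((2 * Real.pi) ^ d)⁻¹ : ℝ) * ∫ x : Torus d, ((u x j : ℝ) : ℂ) * character (-k) x

/-- The negative Sobolev norm `‖u‖_{H^{-L}} = (∑_k (1 + |k|²)^{-L} |û(k)|²)^{1/2}`; the series
converges for `u ∈ L²ₓ` and `L ≥ 0`. -/
def negSobolevNorm {d : ℕ} (L : ℝ) (u : L2 d) : ℝ :=
  Real.sqrt (∑' k : Fin d → ℤ,
    (1 + ∑ i, (k i : ℝ) ^ 2) ^ (-L) * ∑ j, ‖fourierCoefficient u k j‖ ^ 2)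

/-- Time-regularity of `t ↦ μ_t`: for almost all `s, t ∈ [0, T)` there is a transport plan
`π_{s,t}` from `μ_s` to `μ_t` with `∫ ‖u - v‖_{H^{-L}} dπ_{s,t}(u, v) ≤ C |t - s|`. -/
def IsTimeRegular {d : ℕ} (T : ℝ) (μ : ℝ → ProbabilityMeasure (L2 d)) : Prop :=
  ∃ L : ℝ, 0 < L ∧ ∃ C : ℝ, 0 < C ∧ ∃ π : ℝ → ℝ → ProbabilityMeasure (L2 d × L2 d),
    ∀ᵐ q ∂((volume.restrict (Set.Ico 0 T)).prod (volume.restrict (Set.Ico 0 T)) :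
        Measure (ℝ × ℝ)),
      (π q.1 q.2 : Measure (L2 d × L2 d)).map Prod.fst = (μ q.1 : Measure (L2 d)) ∧
      (π q.1 q.2 : Measure (L2 d × L2 d)).map Prod.snd = (μ q.2 : Measure (L2 d)) ∧
      ∫⁻ w, ENNReal.ofReal (negSobolevNorm L (w.1 - w.2)) ∂(π q.1 q.2 : Measure (L2 d × L2 d)) ≤
        ENNReal.ofReal (C * |q.2 - q.1|)

/-! ### Correlation measures -/

/-- A hierarchy of maps `νᵏ : Dᵏ → measures on Uᵏ`, measurable in `x ∈ Dᵏ`. (The member `k = 0`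
lives on one-point spaces and carries no information.) -/
abbrev Hierarchy (d : ℕ) : Type := (k : ℕ) → Kernel (Fin k → Torus d) (Fin k → Vec d)

/-- The Euclidean ball `B_r(x)` of the torus. -/
def torusBall {d : ℕ} (x : Torus d) (r : ℝ) : Set (Torus d) :=
  {y | Real.sqrt (∑ i, ‖y i - x i‖ ^ 2) < r}

/-- Correlation measures from `D` to `U`. -/
structure IsCorrelationMeasure {d : ℕ} (ν : Hierarchy d) : Prop where
  markov : ∀ k, IsMarkovKernel (ν k)
  l2Bounded : ∫⁻ x : Torus d, ∫⁻ ξ, ‖ξ 0‖ₑ ^ 2 ∂(ν 1 (fun _ => x)) < ⊤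
  symmetric : ∀ (k : ℕ) (σ : Equiv.Perm (Fin k)), ∀ᵐ x : Fin k → Torus d,
    ν k (fun i => x (σ i)) = (ν k x).map (fun ξ i => ξ (σ i))
  consistent : ∀ k : ℕ, ∀ᵐ x : Fin (k + 1) → Torus d,
    (ν (k + 1) x).map (fun ξ (i : Fin k) => ξ i.castSucc) = ν k (fun i => x i.castSucc)
  diagonalContinuity : Tendsto
    (fun r : ℝ => ∫⁻ x : Torus d, ⨍⁻ y in torusBall x r,
      (∫⁻ ξ, ‖ξ 0 - ξ 1‖ₑ ^ 2 ∂(ν 2 ![x, y])) ∂volume)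
    (𝓝[>] 0) (𝓝 0)

/-- `ν` is the correlation measure associated with the probability measure `μ` on `L²ₓ`:
`∫_{Dᵏ} ∫_{Uᵏ} g(x, ξ) dνᵏ_x(ξ) dx = ∫_{L²ₓ} ∫_{Dᵏ} g(x, u(x₁), …, u(x_k)) dx dμ(u)`
for all `k` and all `g ∈ C₀(Dᵏ × Uᵏ)`. -/
structure IsAssociated {d : ℕ} (ν : Hierarchy d) (μ : ProbabilityMeasure (L2 d)) : Prop where
  correlation : IsCorrelationMeasure ν
  duality : ∀ (k : ℕ)
    (g : ZeroAtInftyContinuousMap ((Fin k → Torus d) × (Fin k → Vec d)) ℝ),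
    ∫ x : Fin k → Torus d, ∫ ξ, g (x, ξ) ∂(ν k x) =
      ∫ u : L2 d, (∫ x : Fin k → Torus d, g (x, fun i => u (x i))) ∂(μ : Measure (L2 d))

/-! ### Statistical solutions -/

/-- `(ξ₁ ⊗ ⋯ ⊗ ξ_k) : φ(t, x)` for `φ = φ₁ ⊗ ⋯ ⊗ φ_k`. -/
def tensorPairing {d k : ℕ} (φ : Fin k → ℝ → Torus d → Vec d) (t : ℝ)
    (x : Fin k → Torus d) (ξ : Fin k → Vec d) : ℝ :=
  ∏ j, dot (ξ j) (φ j t (x j))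

/-- `∑ᵢ (ξ₁ ⊗ ⋯ ⊗ F(ξᵢ) ⊗ ⋯ ⊗ ξ_k) : ∇_{xᵢ} φ`, where `F(ξ) = ξ ⊗ ξ`. -/
def fluxPairing {d k : ℕ} (φ : Fin k → ℝ → Torus d → Vec d) (t : ℝ)
    (x : Fin k → Torus d) (ξ : Fin k → Vec d) : ℝ :=
  ∑ i, (∏ j ∈ Finset.univ.erase i, dot (ξ j) (φ j t (x j))) *
    dot (spaceDeriv (φ i t) (x i) (ξ i)) (ξ i)

/-- The evolution equation of the `k`-point correlations against `φ₁ ⊗ ⋯ ⊗ φ_k`, all integrals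
being absolutely convergent. -/
def MomentEquation {d k : ℕ} (T : ℝ) (ν : ℝ → Hierarchy d) (νbar : Hierarchy d)
    (φ : Fin k → ℝ → Torus d → Vec d) : Prop :=
  ∫⁻ t in Set.Ico 0 T, ∫⁻ x : Fin k → Torus d, (∫⁻ ξ,
      (‖timeDeriv T (fun s => tensorPairing φ s x ξ) t‖ₑ + ‖fluxPairing φ t x ξ‖ₑ)
      ∂(ν t k x)) < ⊤ ∧
  ∫⁻ x : Fin k → Torus d, (∫⁻ ξ, ‖tensorPairing φ 0 x ξ‖ₑ ∂(νbar k x)) < ⊤ ∧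
  (∫ t in Set.Ico 0 T, ∫ x : Fin k → Torus d, (∫ ξ,
      (timeDeriv T (fun s => tensorPairing φ s x ξ) t + fluxPairing φ t x ξ) ∂(ν t k x))) +
    ∫ x : Fin k → Torus d, (∫ ξ, tensorPairing φ 0 x ξ ∂(νbar k x)) = 0

/-- Statistical solutions on `[0, T)` of the incompressible Euler equations with initial data
`μbar`. -/
structure IsStatisticalSolution {d : ℕ} (T : ℝ) (μbar : ProbabilityMeasure (L2 d))
    (μ : ℝ → ProbabilityMeasure (L2 d)) : Prop where
  mem_L1P : IsL1P T μ
  timeRegular : IsTimeRegular T μ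
  equations : ∃ (ν : ℝ → Hierarchy d) (νbar : Hierarchy d),
    (∀ᵐ t ∂(volume.restrict (Set.Ico 0 T)), IsAssociated (ν t) (μ t)) ∧
    IsAssociated νbar μbar ∧
    (∀ k : ℕ, 1 ≤ k → ∀ φ : Fin k → ℝ → Torus d → Vec d, (∀ i, IsTestField T (φ i)) →
      MomentEquation T ν νbar φ) ∧
    (∀ ψ : Torus d → ℝ, ContDiff ℝ ∞ (fun y : Vec d => ψ (toTorus y)) →
      ∀ᵐ t ∂(volume.restrict (Set.Ico 0 T)),
        ∫ x : Fin 2 → Torus d,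
          (∫ ξ, dot (ξ 0) (grad ψ (x 0)) * dot (ξ 1) (grad ψ (x 1)) ∂(ν t 2 x)) = 0)

/-- `(μ₁, …, μ_M) ∈ Λ(α, μ)`, i.e. `∑ᵢ αᵢ μᵢ = μ`. -/
def IsDecomposition {d M : ℕ} (α : Fin M → ℝ≥0) (μ : ProbabilityMeasure (L2 d))
    (μs : Fin M → ProbabilityMeasure (L2 d)) : Prop :=
  ∑ i, α i • (μs i : Measure (L2 d)) = (μ : Measure (L2 d))

/-- The first moment equation of the time-parametrized measure `μ` with initial data `μbar`. -/
def WeakEulerEquation {d : ℕ} (T : ℝ) (μbar : ProbabilityMeasure (L2 d))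
    (μ : ℝ → ProbabilityMeasure (L2 d)) : Prop :=
  ∀ φ : ℝ → Torus d → Vec d, IsTestField T φ →
    ∫ t in Set.Ico 0 T, (∫ u : L2 d, (∫ x : Torus d,
        (dot (u x) (timeDeriv T (fun s => φ s x) t) +
          dot (spaceDeriv (φ t) x (u x)) (u x))) ∂(μ t : Measure (L2 d))) =
      -∫ u : L2 d, (∫ x : Torus d, dot (u x) (φ 0 x)) ∂(μbar : Measure (L2 d))

/-- Dissipative statistical solutions on `[0, T)` with initial data `μbar`. -/
structure IsDissipativeSolution {d : ℕ} (T : ℝ) (μbar : ProbabilityMeasure (L2 d))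
    (μ : ℝ → ProbabilityMeasure (L2 d)) : Prop where
  statistical : IsStatisticalSolution T μbar μ
  dissipative : ∀ (M : ℕ) (α : Fin M → ℝ≥0), (∀ i, 0 < α i) → ∑ i, α i = 1 →
    ∀ μbars : Fin M → ProbabilityMeasure (L2 d), IsDecomposition α μbar μbars →
    ∃ μs : Fin M → ℝ → ProbabilityMeasure (L2 d),
      (∀ t ∈ Set.Ico 0 T, IsDecomposition α (μ t) (fun i => μs i t)) ∧
      ∀ i, IsWeakStarMeasurable T (μs i) ∧ μs i 0 = μbars i ∧
        WeakEulerEquation T (μbars i) (μs i) ∧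
        ∀ᵐ t ∂(volume.restrict (Set.Ico 0 T)),
          ∫⁻ u, ‖u‖ₑ ^ 2 ∂(μs i t : Measure (L2 d)) ≤
            ∫⁻ u, ‖u‖ₑ ^ 2 ∂(μbars i : Measure (L2 d))

end EulerStat

end

/-!
Initial data in the generic set can be approximated by data of classical solutions so well that the
approximation survives the growth of perturbations on the whole time interval. This turns the
weak-strong uniqueness of the Euler equations into existence, uniqueness and continuous dependence
for single fields, and then for measures.

**The flow.** For a classical solution `v` with `‖∇v‖ ≤ C` and a divergence-free field `u`, the rate
of change that the Euler equations prescribe for `∫ u · v` is `∫ ((u - v) · ∇v) · (u - v)`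
(`IsClassicalSolution.rate_eq`). It follows with Grönwall's inequality that weak solutions that are
continuous in time and conserve the energy (`IsWeakTrajectory`) satisfy
`‖u(t) - v(t)‖ ≤ exp (C t) ‖u(0) - v(0)‖` (`IsWeakTrajectory.norm_sub_le`). If `u(0)` is generic,
then classical solutions whose data are `exp (-C T) / n`-close to `u(0)` form a uniform Cauchy
sequence. Its limit is the only weak trajectory from `u(0)`; this defines `flow`, which is jointly
continuous on generic data (`isWeakTrajectory_flow`, `continuousOn_flow`).

**Existence.** The solution is the image `flowMeasure` of the initial measure under the flow. Its
correlation measures are the laws of `(u(x₁), …, u(x_k))`, which make sense because the elements of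
`L²` have representatives that are jointly measurable in `(u, x)` (`rep`,
`isAssociated_correlationMeasure`). The moment equation for `φ₁ ⊗ ⋯ ⊗ φ_k` is the fundamental
theorem of calculus for `∏ⱼ ∫ u(t) · φⱼ(t)` along the trajectories, averaged over the initial data
(`momentEquation_flowMeasure`). Time regularity holds for the coupling of the two times by the flow:
along a trajectory the `k`-th Fourier coefficient is Lipschitz in time with constant of order `|k|`
(`isTimeRegular_flowMeasure`). A decomposition of the initial measure is transported by the flow
to a decomposition of the solution (`isDissipativeSolution_flowMeasure`).

**Uniqueness.** Let `μ_t` be a dissipative solution. The divergence constraint on its two-point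
correlations says that `∫ (∫ u · ∇ψ)² dμ_t = 0`, so that `μ_t` is carried by divergence-free fields
(`ae_isDivFree`). Hence the relative energy argument applies to each component of a decomposition
of `μ_t`: the first moment equation may be tested with a classical solution `v`, by approximation
with smooth test fields (`exists_testField_approx`), and the energy inequality gives
`∫ ‖u - v(t)‖² dμ_{i,t} ≤ exp (2 C T) ∫ ‖u - v(0)‖² dμ_{i,0}` (`ae_integral_norm_sub_sq_le`).
Now cut the initial measure into finitely many pieces, each contained in a ball of radius
`δ exp (-C T)` around a classical datum, up to a set of measure `δ`. The components of `μ_t` that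
correspond to the pieces are `δ`-close in mean square to point masses on the classical solutions, so
that `μ_t` is close to a measure that does not depend on the solution chosen
(`exists_approximate_integral`). As `δ → 0`, any two dissipative solutions agree
(`IsDissipativeSolution.ae_eq`).
-/

noncomputable section

namespace EulerStat

section

variable {d : ℕ} {F : Type*} [NormedAddCommGroup F] [NormedSpace ℝ F]

/-! ### Differential calculus on the torus -/

lemma toTorus_add (y z : Vec d) : toTorus (y + z) = toTorus y + toTorus z := by
  funext i; simp [toTorus]

lemma toTorus_zero : toTorus (0 : Vec d) = 0 := by
  funext i; simp [toTorus]

lemma isOpenQuotientMap_toTorus : IsOpenQuotientMap (toTorus (d := d)) := by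
  have h1 : IsOpenQuotientMap
      (Pi.map (fun (_ : Fin d) (r : ℝ) => (r : AddCircle (2 * Real.pi)))) :=
    IsOpenQuotientMap.piMap fun _ => QuotientAddGroup.isOpenQuotientMap_mk
  exact h1.comp (EuclideanSpace.equiv (Fin d) ℝ).toHomeomorph.isOpenQuotientMap

lemma continuous_toTorus : Continuous (toTorus (d := d)) := isOpenQuotientMap_toTorus.continuous

lemma surjective_toTorus : Function.Surjective (toTorus (d := d)) :=
  isOpenQuotientMap_toTorus.surjective

lemma spaceDeriv_toTorus (f : Torus d → F) (y : Vec d) :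
    spaceDeriv f (toTorus y) = fderiv ℝ (fun h => f (toTorus h)) y := by
  have h := fderiv_comp_add_left (𝕜 := ℝ) (f := fun h : Vec d => f (toTorus h)) (x := 0) y
  simp only [toTorus_add, add_zero] at h
  exact h

lemma spaceDeriv_eq_of_hasFDerivAt {f : Torus d → F} {y : Vec d} {f' : Vec d →L[ℝ] F}
    (h : HasFDerivAt (fun h => f (toTorus h)) f' y) : spaceDeriv f (toTorus y) = f' := by
  rw [spaceDeriv_toTorus, h.fderiv]

/-- `spaceDeriv` is defined by a derivative at the origin; this identifies it with the derivative of
the periodic lift at any point of the fibre. -/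
lemma hasFDerivAt_spaceDeriv {f : Torus d → F}
    (h : ContDiff ℝ 1 (fun y => f (toTorus y))) (y : Vec d) :
    HasFDerivAt (fun h => f (toTorus h)) (spaceDeriv f (toTorus y)) y := by
  rw [spaceDeriv_toTorus]
  exact (h.differentiable one_ne_zero y).hasFDerivAt

lemma hasFDerivAt_spaceDeriv_add {f : Torus d → F}
    (h : ContDiff ℝ 1 (fun y => f (toTorus y))) (x : Torus d) (y : Vec d) :
    HasFDerivAt (fun h => f (x + toTorus h)) (spaceDeriv f (x + toTorus y)) y := by
  obtain ⟨z, rfl⟩ := surjective_toTorus x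
  have h1 := hasFDerivAt_spaceDeriv h (z + y)
  have h2 := h1.comp y ((hasFDerivAt_id y).const_add z)
  rw [ContinuousLinearMap.comp_id, toTorus_add] at h2
  refine h2.congr_of_eventuallyEq (Eventually.of_forall fun w => ?_)
  simp [toTorus_add]

lemma continuous_of_lift {Y : Type*} [TopologicalSpace Y] {f : Torus d → Y}
    (h : Continuous (fun y => f (toTorus y))) :
    Continuous f :=
  isOpenQuotientMap_toTorus.continuous_comp_iff.1 h

lemma continuous_spaceDeriv {f : Torus d → F} (h : ContDiff ℝ 1 (fun y => f (toTorus y))) :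
    Continuous (spaceDeriv f) := by
  refine continuous_of_lift ?_
  simp only [spaceDeriv_toTorus]
  exact h.continuous_fderiv one_ne_zero

lemma inner_grad (f : Torus d → ℝ) (x : Torus d) (w : Vec d) :
    inner ℝ (grad f x) w = spaceDeriv f x w := by
  simp [grad, gradient, spaceDeriv]

lemma continuous_grad {f : Torus d → ℝ} (h : ContDiff ℝ 1 (fun y => f (toTorus y))) :
    Continuous (grad f) :=
  (InnerProductSpace.toDual ℝ (Vec d)).symm.continuous.comp (continuous_spaceDeriv h)

/-- The trace of an endomorphism of `ℝᵈ`, as a continuous linear functional; it sends the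
derivative of a vector field to its divergence. -/
def traceCLM (d : ℕ) : (Vec d →L[ℝ] Vec d) →L[ℝ] ℝ :=
  ∑ i, (EuclideanSpace.proj (𝕜 := ℝ) i).comp
    (ContinuousLinearMap.apply ℝ (Vec d) (EuclideanSpace.single i (1 : ℝ)))

lemma traceCLM_apply (A : Vec d →L[ℝ] Vec d) :
    traceCLM d A = ∑ i, (A (EuclideanSpace.single i 1)) i := by
  simp [traceCLM]

lemma divergence_eq_traceCLM (f : Torus d → Vec d) (x : Torus d) :
    divergence f x = traceCLM d (spaceDeriv f x) := by
  rw [traceCLM_apply]; rfl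

lemma traceCLM_smulRight (l : Vec d →L[ℝ] ℝ) (w : Vec d) :
    traceCLM d (l.smulRight w) = l w := by
  rw [traceCLM_apply]
  conv_rhs => rw [← (EuclideanSpace.basisFun (Fin d) ℝ).sum_repr w]
  simp [mul_comm]

/-! ### Joint calculus on `[0, T) × 𝕋ᵈ` -/

/-- Joint continuity on `[0, T) × 𝕋ᵈ`. -/
def JointlyContinuous {Y : Type*} [TopologicalSpace Y] (T : ℝ) (f : ℝ → Torus d → Y) : Prop :=
  Continuous (fun p : Set.Ico (0 : ℝ) T × Torus d => f p.1 p.2)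

lemma JointlyContinuous.of_lift {Y : Type*} [TopologicalSpace Y] {T : ℝ} {f : ℝ → Torus d → Y}
    (h : ContinuousOn (fun q : ℝ × Vec d => f q.1 (toTorus q.2)) (Set.Ico 0 T ×ˢ Set.univ)) :
    JointlyContinuous T f := by
  have hq : IsOpenQuotientMap (Prod.map id toTorus : Set.Ico (0 : ℝ) T × Vec d → _ × Torus d) :=
    IsOpenQuotientMap.id.prodMap isOpenQuotientMap_toTorus
  refine hq.continuous_comp_iff.1 ?_
  have h2 : Continuous (fun p : Set.Ico (0 : ℝ) T × Vec d => ((p.1 : ℝ), p.2)) := by fun_prop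
  exact h.comp_continuous h2 (fun p => ⟨p.1.2, trivial⟩)

lemma JointlyContinuous.slice {Y : Type*} [TopologicalSpace Y] {T : ℝ} {f : ℝ → Torus d → Y}
    (h : JointlyContinuous T f) {t : ℝ} (ht : t ∈ Set.Ico 0 T) : Continuous (f t) :=
  h.comp (Continuous.prodMk_right (⟨t, ht⟩ : Set.Ico (0 : ℝ) T))

/-- A continuous function on the torus as a bundled map; the value is `0` for a function that is
not continuous. -/
def toC {Y : Type*} [TopologicalSpace Y] [Zero Y] (f : Torus d → Y) : C(Torus d, Y) :=
  open Classical in if h : Continuous f then ⟨f, h⟩ else 0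

lemma toC_apply {Y : Type*} [TopologicalSpace Y] [Zero Y] {f : Torus d → Y} (h : Continuous f)
    (x : Torus d) : toC f x = f x := by
  simp [toC, h]

lemma JointlyContinuous.continuousOn_toC {Y : Type*} [NormedAddCommGroup Y] {T : ℝ}
    {f : ℝ → Torus d → Y} (h : JointlyContinuous T f) :
    ContinuousOn (fun t => toC (f t)) (Set.Ico 0 T) := by
  rw [continuousOn_iff_continuous_domRestrict]
  let g : C(Set.Ico (0 : ℝ) T × Torus d, Y) := ⟨_, h⟩
  have : Set.domRestrict (Set.Ico 0 T) (fun t => toC (f t)) = fun t => g.curry t := by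
    funext t
    ext x
    exact toC_apply (h.slice t.2) x
  rw [this]
  exact g.curry.continuous

section IsCn

variable {T : ℝ} {v : ℝ → Torus d → F}

lemma IsCn.mono {n m : WithTop ℕ∞} (h : IsCn n T v) (hm : m ≤ n) : IsCn m T v :=
  ContDiffOn.of_le h hm

/-- The joint derivative on `[0, T) × ℝᵈ` of the lift. -/
def liftDeriv (T : ℝ) (v : ℝ → Torus d → F) (q : ℝ × Vec d) : ℝ × Vec d →L[ℝ] F :=
  fderivWithin ℝ (fun q : ℝ × Vec d => v q.1 (toTorus q.2)) (Set.Ico 0 T ×ˢ Set.univ) q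

lemma uniqueDiffOn_slab : UniqueDiffOn ℝ (Set.Ico 0 T ×ˢ (Set.univ : Set (Vec d))) :=
  (uniqueDiffOn_Ico 0 T).prod uniqueDiffOn_univ

lemma IsCn.hasFDerivWithinAt (h : IsCn 1 T v) {t : ℝ} (ht : t ∈ Set.Ico 0 T) (y : Vec d) :
    HasFDerivWithinAt (fun q : ℝ × Vec d => v q.1 (toTorus q.2)) (liftDeriv T v (t, y))
      (Set.Ico 0 T ×ˢ Set.univ) (t, y) :=
  (h.differentiableOn one_ne_zero (t, y) ⟨ht, trivial⟩).hasFDerivWithinAt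

lemma IsCn.hasFDerivAt (h : IsCn 1 T v) {t : ℝ} (ht : t ∈ Set.Ioo 0 T) (y : Vec d) :
    HasFDerivAt (fun q : ℝ × Vec d => v q.1 (toTorus q.2)) (liftDeriv T v (t, y)) (t, y) :=
  (h.hasFDerivWithinAt ⟨ht.1.le, ht.2⟩ y).hasFDerivAt
    (prod_mem_nhds (Ico_mem_nhds ht.1 ht.2) univ_mem)

lemma IsCn.contDiff_slice {n : WithTop ℕ∞} (h : IsCn n T v) {t : ℝ} (ht : t ∈ Set.Ico 0 T) :
    ContDiff ℝ n (fun y => v t (toTorus y)) := by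
  rw [← contDiffOn_univ]
  exact ContDiffOn.comp (g := fun q : ℝ × Vec d => v q.1 (toTorus q.2)) (f := fun y => (t, y)) h
    (by fun_prop) (fun y _ => ⟨ht, trivial⟩)

lemma IsCn.spaceDeriv_eq (h : IsCn 1 T v) {t : ℝ} (ht : t ∈ Set.Ico 0 T) (y : Vec d) :
    spaceDeriv (v t) (toTorus y) = (liftDeriv T v (t, y)).comp (.inr ℝ ℝ (Vec d)) := by
  refine spaceDeriv_eq_of_hasFDerivAt ?_
  have h1 : HasFDerivWithinAt (fun z : Vec d => ((t, z) : ℝ × Vec d)) (.inr ℝ ℝ (Vec d))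
      Set.univ y := (hasFDerivAt_prodMk_right t y).hasFDerivWithinAt
  have h2 := (h.hasFDerivWithinAt ht y).comp y h1 (fun z _ => ⟨ht, trivial⟩)
  exact h2.hasFDerivAt univ_mem

lemma IsCn.hasDerivWithinAt_lift (h : IsCn 1 T v) {t : ℝ} (ht : t ∈ Set.Ico 0 T) (y : Vec d) :
    HasDerivWithinAt (fun s => v s (toTorus y)) (liftDeriv T v (t, y) (1, 0)) (Set.Ico 0 T) t := by
  have h1 : HasDerivWithinAt (fun s : ℝ => ((s, y) : ℝ × Vec d)) (1, 0) (Set.Ico 0 T) t :=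
    (hasDerivWithinAt_id t _).prodMk (hasDerivWithinAt_const t _ y)
  exact (h.hasFDerivWithinAt ht y).comp_hasDerivWithinAt (t := Set.Ico 0 T ×ˢ Set.univ) t h1
    (fun s hs => ⟨hs, trivial⟩)

lemma IsCn.timeDeriv_eq (h : IsCn 1 T v) {t : ℝ} (ht : t ∈ Set.Ico 0 T) (y : Vec d) :
    timeDeriv T (fun s => v s (toTorus y)) t = liftDeriv T v (t, y) (1, 0) :=
  (h.hasDerivWithinAt_lift ht y).derivWithin (uniqueDiffOn_Ico 0 T t ht)

lemma IsCn.hasDerivWithinAt (h : IsCn 1 T v) {t : ℝ} (ht : t ∈ Set.Ico 0 T) (x : Torus d) :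
    HasDerivWithinAt (fun s => v s x) (timeDeriv T (fun s => v s x) t) (Set.Ico 0 T) t := by
  obtain ⟨y, rfl⟩ := surjective_toTorus x
  rw [h.timeDeriv_eq ht]
  exact h.hasDerivWithinAt_lift ht y

lemma continuousOn_liftDeriv (h : IsCn 1 T v) :
    ContinuousOn (liftDeriv T v) (Set.Ico 0 T ×ˢ Set.univ) :=
  h.continuousOn_fderivWithin uniqueDiffOn_slab le_rfl

lemma IsCn.jointlyContinuous {n : WithTop ℕ∞} (h : IsCn n T v) : JointlyContinuous T v :=
  .of_lift h.continuousOn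

lemma IsCn.jointlyContinuous_spaceDeriv (h : IsCn 1 T v) :
    JointlyContinuous T (fun t => spaceDeriv (v t)) := by
  refine .of_lift ?_
  refine ContinuousOn.congr (f := fun q => (liftDeriv T v q).comp (.inr ℝ ℝ (Vec d))) ?_ ?_
  · exact (continuousOn_liftDeriv h).clm_comp continuousOn_const
  · rintro ⟨t, y⟩ ⟨ht, -⟩
    exact h.spaceDeriv_eq ht y

lemma IsCn.jointlyContinuous_timeDeriv (h : IsCn 1 T v) :
    JointlyContinuous T (fun t x => timeDeriv T (fun s => v s x) t) := by
  refine .of_lift ?_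
  refine ContinuousOn.congr (f := fun q => liftDeriv T v q (1, 0)) ?_ ?_
  · exact (continuousOn_liftDeriv h).clm_apply continuousOn_const
  · rintro ⟨t, y⟩ ⟨ht, -⟩
    exact h.timeDeriv_eq ht y

end IsCn

/-! ### Integration by parts -/

/-- The integral over the torus of a derivative vanishes: `∫ g (x + y) dx` does not depend on
`y`. -/
lemma integral_spaceDeriv [CompleteSpace F] {g : Torus d → F}
    (h : ContDiff ℝ 1 (fun y => g (toTorus y))) : ∫ x, spaceDeriv g x = 0 := by
  have hg : Continuous g := continuous_of_lift h.continuous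
  have hc := continuous_spaceDeriv h
  obtain ⟨K, hK⟩ := (isCompact_range hc).isBounded.exists_norm_le
  have key := hasFDerivAt_integral_of_dominated_of_fderiv_le (𝕜 := ℝ) (μ := volume)
    (F := fun (y : Vec d) (x : Torus d) => g (x + toTorus y))
    (F' := fun (y : Vec d) (x : Torus d) => spaceDeriv g (x + toTorus y))
    (x₀ := 0) (s := Set.univ) (bound := fun _ => K) univ_mem
    (.of_forall fun y => (hg.comp (continuous_id.add continuous_const)).aestronglyMeasurable)
    ((hg.comp (continuous_id.add continuous_const)).integrable_of_hasCompactSupport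
      (HasCompactSupport.of_compactSpace _))
    (hc.comp (continuous_id.add continuous_const)).aestronglyMeasurable
    (.of_forall fun x y _ => hK _ ⟨_, rfl⟩) (integrable_const K)
    (.of_forall fun x y _ => hasFDerivAt_spaceDeriv_add h x y)
  simp only [toTorus_zero, add_zero, integral_add_right_eq_self] at key
  exact key.unique (hasFDerivAt_const _ _)

lemma contDiff_smul_lift {n : WithTop ℕ∞} {f : Torus d → ℝ} {w : Torus d → F}
    (hf : ContDiff ℝ n (fun y => f (toTorus y)))
    (hw : ContDiff ℝ n (fun y => w (toTorus y))) :
    ContDiff ℝ n (fun y => (fun x => f x • w x) (toTorus y)) := hf.smul hw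

/-- A divergence-free `C¹` field is orthogonal to all `C¹` gradients. -/
lemma integral_inner_grad_eq_zero {f : Torus d → ℝ} {w : Torus d → Vec d}
    (hf : ContDiff ℝ 1 (fun y => f (toTorus y)))
    (hw : ContDiff ℝ 1 (fun y => w (toTorus y))) (hdiv : ∀ x, divergence w x = 0) :
    ∫ x, spaceDeriv f x (w x) = 0 := by
  have h0 := integral_spaceDeriv (g := fun x => f x • w x) (contDiff_smul_lift hf hw)
  have h1 : ∀ x, traceCLM d (spaceDeriv (fun x => f x • w x) x) = spaceDeriv f x (w x) := by
    intro x
    obtain ⟨y, rfl⟩ := surjective_toTorus x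
    rw [spaceDeriv_eq_of_hasFDerivAt
      ((hasFDerivAt_spaceDeriv hf y).smul (hasFDerivAt_spaceDeriv hw y))]
    rw [map_add, map_smul, ← divergence_eq_traceCLM, hdiv, traceCLM_smulRight]
    simp
  have hc : Continuous (spaceDeriv (fun x => f x • w x)) :=
    continuous_spaceDeriv (f := fun x => f x • w x) (contDiff_smul_lift hf hw)
  have h2 := (traceCLM d).integral_comp_comm (μ := (volume : Measure (Torus d)))
    (hc.integrable_of_hasCompactSupport (HasCompactSupport.of_compactSpace _))
  simp only [h1, h0, map_zero] at h2
  exact h2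

end

section

variable {d : ℕ}

/-! ### Continuous fields as elements and multipliers of `L²` -/

/-- A continuous vector field as an element of `L²`; the value is `0` for a field that is not
continuous. -/
def contL2 (f : Torus d → Vec d) : L2 d :=
  ContinuousMap.toLp 2 (volume : Measure (Torus d)) ℝ (toC f)

lemma coeFn_contL2 {f : Torus d → Vec d} (hf : Continuous f) : contL2 f =ᵐ[volume] f := by
  filter_upwards [ContinuousMap.coeFn_toLp (p := 2) (𝕜 := ℝ) (volume : Measure (Torus d)) (toC f)]
    with x hx
  rw [contL2, hx, toC_apply hf]

lemma inner_contL2 (u : L2 d) {f : Torus d → Vec d} (hf : Continuous f) :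
    inner ℝ u (contL2 f) = ∫ x, dot (u x) (f x) := by
  rw [L2.inner_def]
  refine integral_congr_ae ?_
  filter_upwards [coeFn_contL2 hf] with x hx
  rw [hx, dot]

lemma inner_contL2_contL2 {f g : Torus d → Vec d} (hf : Continuous f) (hg : Continuous g) :
    inner ℝ (contL2 f) (contL2 g) = ∫ x, dot (f x) (g x) := by
  rw [inner_contL2 _ hg]
  refine integral_congr_ae ?_
  filter_upwards [coeFn_contL2 hf] with x hx
  rw [hx]

lemma eq_contL2 {u : L2 d} {f : Torus d → Vec d} (hf : Continuous f) (h : u =ᵐ[volume] f) :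
    u = contL2 f :=
  Lp.ext (h.trans (coeFn_contL2 hf).symm)

lemma toC_add {Y : Type*} [TopologicalSpace Y] [AddMonoid Y] [ContinuousAdd Y] {f g : Torus d → Y}
    (hf : Continuous f) (hg : Continuous g) : toC (fun x => f x + g x) = toC f + toC g := by
  ext x
  rw [toC_apply (f := fun x => f x + g x) (hf.add hg), ContinuousMap.add_apply,
    toC_apply hf, toC_apply hg]

lemma toC_smul {Y : Type*} [NormedAddCommGroup Y] [NormedSpace ℝ Y] (c : ℝ) {f : Torus d → Y}
    (hf : Continuous f) : toC (fun x => c • f x) = c • toC f := by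
  ext x
  rw [toC_apply (f := fun x => c • f x) (hf.const_smul c), ContinuousMap.smul_apply, toC_apply hf]

lemma toC_sub {Y : Type*} [NormedAddCommGroup Y] {f g : Torus d → Y}
    (hf : Continuous f) (hg : Continuous g) : toC (fun x => f x - g x) = toC f - toC g := by
  ext x
  rw [toC_apply (f := fun x => f x - g x) (hf.sub hg), ContinuousMap.sub_apply,
    toC_apply hf, toC_apply hg]

lemma contL2_add {f g : Torus d → Vec d} (hf : Continuous f) (hg : Continuous g) :
    contL2 (fun x => f x + g x) = contL2 f + contL2 g := by
  rw [contL2, toC_add hf hg, map_add]; rfl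

lemma contL2_sub {f g : Torus d → Vec d} (hf : Continuous f) (hg : Continuous g) :
    contL2 (fun x => f x - g x) = contL2 f - contL2 g := by
  rw [contL2, toC_sub hf hg, map_sub]; rfl

lemma contL2_smul (c : ℝ) {f : Torus d → Vec d} (hf : Continuous f) :
    contL2 (fun x => c • f x) = c • contL2 f := by
  rw [contL2, toC_smul c hf, map_smul]; rfl

lemma norm_toC_le {Y : Type*} [NormedAddCommGroup Y] {f : Torus d → Y} {c : ℝ} (hc : 0 ≤ c)
    (hf : ∀ x, ‖f x‖ ≤ c) : ‖toC f‖ ≤ c := by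
  by_cases h : Continuous f
  · rw [ContinuousMap.norm_le _ hc]
    intro x
    rw [toC_apply h]
    exact hf x
  · simpa [toC, h] using hc

/-- The norm of the embedding of the continuous fields into `L²`. -/
def embConst (d : ℕ) : ℝ := ‖ContinuousMap.toLp (E := Vec d) 2 (volume : Measure (Torus d)) ℝ‖

lemma embConst_nonneg : 0 ≤ embConst d := norm_nonneg _

lemma norm_contL2_le {f : Torus d → Vec d} {c : ℝ} (hc : 0 ≤ c) (hf : ∀ x, ‖f x‖ ≤ c) :
    ‖contL2 f‖ ≤ embConst d * c :=
  (ContinuousLinearMap.le_opNorm _ _).trans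
    (mul_le_mul_of_nonneg_left (norm_toC_le hc hf) embConst_nonneg)

/-- Pointwise application of a continuous matrix field to an element of `L²`. -/
def opL2 : C(Torus d, Vec d →L[ℝ] Vec d) →L[ℝ] L2 d →L[ℝ] L2 d :=
  ((ContinuousLinearMap.id ℝ (Vec d →L[ℝ] Vec d)).holderL volume ∞ 2 2).comp
    (ContinuousMap.toLp ∞ (volume : Measure (Torus d)) ℝ)

lemma coeFn_opL2 (A : C(Torus d, Vec d →L[ℝ] Vec d)) (u : L2 d) :
    opL2 A u =ᵐ[volume] fun x => A x (u x) := by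
  have h1 := ContinuousLinearMap.coeFn_holder (r := 2)
    (ContinuousLinearMap.id ℝ (Vec d →L[ℝ] Vec d))
    (ContinuousMap.toLp ∞ (volume : Measure (Torus d)) ℝ A) u
  filter_upwards [h1, ContinuousMap.coeFn_toLp (p := ∞) (𝕜 := ℝ) (volume : Measure (Torus d)) A]
    with x hx hx2
  rw [hx2] at hx
  exact hx

lemma norm_opL2_le (A : C(Torus d, Vec d →L[ℝ] Vec d)) (u : L2 d) {c : ℝ}
    (hA : ∀ x, ‖A x‖ ≤ c) : ‖opL2 A u‖ ≤ c * ‖u‖ := by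
  refine Lp.norm_le_mul_norm_of_ae_le_mul ?_
  filter_upwards [coeFn_opL2 A u] with x hx
  rw [hx]
  exact ((A x).le_opNorm _).trans (mul_le_mul_of_nonneg_right (hA x) (norm_nonneg _))

lemma abs_inner_opL2_le (A : C(Torus d, Vec d →L[ℝ] Vec d)) (u : L2 d) {c : ℝ}
    (hA : ∀ x, ‖A x‖ ≤ c) : |inner ℝ (opL2 A u) u| ≤ c * ‖u‖ ^ 2 := by
  refine (abs_real_inner_le_norm _ _).trans ?_
  rw [pow_two, ← mul_assoc]
  exact mul_le_mul_of_nonneg_right (norm_opL2_le A u hA) (norm_nonneg _)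

lemma opL2_contL2 {A : Torus d → Vec d →L[ℝ] Vec d} {f : Torus d → Vec d} (hA : Continuous A)
    (hf : Continuous f) : opL2 (toC A) (contL2 f) = contL2 (fun x => A x (f x)) := by
  refine eq_contL2 (hA.clm_apply hf) ?_
  filter_upwards [coeFn_opL2 (toC A) (contL2 f), coeFn_contL2 hf] with x hx hx2
  rw [hx, hx2, toC_apply hA]

lemma inner_opL2 {A : Torus d → Vec d →L[ℝ] Vec d} (hA : Continuous A) (u w : L2 d) :
    inner ℝ (opL2 (toC A) u) w = ∫ x, dot (A x (u x)) (w x) := by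
  rw [L2.inner_def]
  refine integral_congr_ae ?_
  filter_upwards [coeFn_opL2 (toC A) u] with x hx
  rw [hx, toC_apply hA, dot]

/-- The rate of change `∫ (u · ∂ₜφ + (u · ∇φ) · u) dx` that the Euler equations prescribe for
`∫ u · φ dx`. -/
def rate (T : ℝ) (φ : ℝ → Torus d → Vec d) (t : ℝ) (u : L2 d) : ℝ :=
  inner ℝ u (contL2 fun x => timeDeriv T (fun s => φ s x) t) +
    inner ℝ (opL2 (toC (spaceDeriv (φ t))) u) u

lemma rate_eq_integral {T : ℝ} {φ : ℝ → Torus d → Vec d} (hφ : IsCn 1 T φ) {t : ℝ}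
    (ht : t ∈ Set.Ico 0 T) (u : L2 d) :
    rate T φ t u = ∫ x : Torus d, (dot (u x) (timeDeriv T (fun s => φ s x) t) +
          dot (spaceDeriv (φ t) x (u x)) (u x)) := by
  have h1 := hφ.jointlyContinuous_timeDeriv.slice ht
  have h2 := hφ.jointlyContinuous_spaceDeriv.slice ht
  rw [rate, inner_contL2 u h1, inner_opL2 h2, ← integral_add]
  · refine (L2.integrable_inner (𝕜 := ℝ) u
      (contL2 fun x => timeDeriv T (fun s => φ s x) t)).congr ?_
    filter_upwards [coeFn_contL2 h1] with x hx
    rw [hx, dot]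
  · refine (L2.integrable_inner (𝕜 := ℝ) (opL2 (toC (spaceDeriv (φ t))) u) u).congr ?_
    filter_upwards [coeFn_opL2 (toC (spaceDeriv (φ t))) u] with x hx
    rw [hx, toC_apply h2, dot]

lemma continuousOn_contL2 {T : ℝ} {f : ℝ → Torus d → Vec d} (h : JointlyContinuous T f) :
    ContinuousOn (fun t => contL2 (f t)) (Set.Ico 0 T) :=
  (ContinuousMap.toLp 2 (volume : Measure (Torus d)) ℝ).continuous.comp_continuousOn
    h.continuousOn_toC

/-- Joint continuity in the time and the `L²` topology; it serves to pass to the limit in the weak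
formulation and to integrate `rate` against families of measures. -/
lemma continuousOn_rate {T : ℝ} {φ : ℝ → Torus d → Vec d} (hφ : IsCn 1 T φ) :
    ContinuousOn (fun p : ℝ × L2 d => rate T φ p.1 p.2) (Set.Ico 0 T ×ˢ Set.univ) := by
  have h0 : Set.MapsTo (Prod.fst : ℝ × L2 d → ℝ) (Set.Ico 0 T ×ˢ Set.univ) (Set.Ico 0 T) :=
    fun p hp => hp.1
  have h1 : ContinuousOn (fun p : ℝ × L2 d => contL2 fun x => timeDeriv T (fun s => φ s x) p.1)
      (Set.Ico 0 T ×ˢ Set.univ) :=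
    (continuousOn_contL2 hφ.jointlyContinuous_timeDeriv).comp continuousOn_fst h0
  have h2 : ContinuousOn (fun p : ℝ × L2 d => toC (spaceDeriv (φ p.1)))
      (Set.Ico 0 T ×ˢ Set.univ) :=
    hφ.jointlyContinuous_spaceDeriv.continuousOn_toC.comp continuousOn_fst h0
  refine (continuousOn_snd.inner h1).add (ContinuousOn.inner ?_ continuousOn_snd)
  exact (opL2.continuous.comp_continuousOn h2).clm_apply continuousOn_snd

/-! ### Weakly divergence-free fields -/

/-- `u` is weakly divergence-free: it is orthogonal to all smooth gradients. -/
def IsDivFree (u : L2 d) : Prop :=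
  ∀ ψ : Torus d → ℝ, ContDiff ℝ ∞ (fun y : Vec d => ψ (toTorus y)) →
    inner ℝ u (contL2 (grad ψ)) = 0

lemma isDivFree_contL2 {w : Torus d → Vec d} (hw : ContDiff ℝ 1 (fun y => w (toTorus y)))
    (hdiv : ∀ x, divergence w x = 0) : IsDivFree (contL2 w) := by
  intro ψ hψ
  have hψ1 : ContDiff ℝ 1 (fun y : Vec d => ψ (toTorus y)) := hψ.of_le (mod_cast le_top)
  rw [inner_contL2_contL2 (continuous_of_lift hw.continuous) (continuous_grad hψ1)]
  have h : ∀ x, dot (w x) (grad ψ x) = spaceDeriv ψ x (w x) := fun x => by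
    rw [dot, real_inner_comm, inner_grad]
  simp only [h]
  exact integral_inner_grad_eq_zero hψ1 hw hdiv

lemma IsDivFree.sub {u w : L2 d} (hu : IsDivFree u) (hw : IsDivFree w) : IsDivFree (u - w) := by
  intro ψ hψ
  rw [inner_sub_left, hu ψ hψ, hw ψ hψ, sub_zero]

lemma isClosed_isDivFree : IsClosed {u : L2 d | IsDivFree u} := by
  simp only [IsDivFree, Set.ofPred_forall]
  refine isClosed_iInter fun ψ => isClosed_iInter fun _ => ?_
  exact isClosed_eq (by fun_prop) continuous_const

end

section

/-! ### Mollification -/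

/-- A `C¹` function with bounded and uniformly continuous derivative can be approximated in `C¹` by
smooth functions, in a way that keeps periods and linear constraints on the derivative, and enlarges
the support only slightly. The approximation is the convolution with a bump function. -/
lemma exists_contDiff_approx {E F : Type*} [NormedAddCommGroup E] [NormedSpace ℝ E]
    [FiniteDimensional ℝ E] [MeasurableSpace E] [BorelSpace E] [NormedAddCommGroup F]
    [NormedSpace ℝ F] [CompleteSpace F] {f : E → F} {f' : E → E →L[ℝ] F}
    (hf : ∀ q, HasFDerivAt f (f' q) q) (hf' : UniformContinuous f') {K : ℝ}
    (hK : ∀ q, ‖f' q‖ ≤ K) {δ ε : ℝ} (hδ : 0 < δ) (hε : 0 < ε) :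
    ∃ (g : E → F) (g' : E → E →L[ℝ] F), ContDiff ℝ ∞ g ∧ (∀ q, HasFDerivAt g (g' q) q) ∧
      (∀ q, ‖g q - f q‖ ≤ ε) ∧ (∀ q, ‖g' q - f' q‖ ≤ ε) ∧
      (∀ a, (∀ q, f (q + a) = f q) → ∀ q, g (q + a) = g q) ∧
      (∀ l : (E →L[ℝ] F) →L[ℝ] ℝ, (∀ q, l (f' q) = 0) → ∀ q, l (g' q) = 0) ∧
      (∀ q, (∀ z ∈ Metric.ball q δ, f z = 0) → g q = 0) := by
  let μ : Measure E := Measure.addHaar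
  have hfc : Continuous f := continuous_iff_continuousAt.2 fun q => (hf q).continuousAt
  have hf'c : Continuous f' := hf'.continuous
  have hfu : UniformContinuous f := by
    have h : LipschitzWith K.toNNReal f := by
      refine lipschitzWith_of_nnnorm_fderiv_le (𝕜 := ℝ) (fun q => (hf q).differentiableAt)
        fun q => ?_
      rw [(hf q).fderiv, ← NNReal.coe_le_coe]
      exact (hK q).trans (Real.le_coe_toNNReal K)
    exact h.uniformContinuous
  obtain ⟨δ₁, hδ₁, h₁⟩ := Metric.uniformContinuous_iff.1 hfu ε hε
  obtain ⟨δ₂, hδ₂, h₂⟩ := Metric.uniformContinuous_iff.1 hf' ε hε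
  let r := min δ (min δ₁ δ₂)
  have hr : 0 < r := lt_min hδ (lt_min hδ₁ hδ₂)
  let ρ : ContDiffBump (0 : E) := ⟨r / 2, r, half_pos hr, half_lt_self hr⟩
  have hρc : HasCompactSupport (ρ.normed μ) := ρ.hasCompactSupport_normed
  have hρ : Continuous (ρ.normed μ) := ρ.continuous_normed
  let g : E → F := convolution (ρ.normed μ) f (ContinuousLinearMap.lsmul ℝ ℝ) μ
  let g' : E → E →L[ℝ] F := convolution (ρ.normed μ) f' (ContinuousLinearMap.lsmul ℝ ℝ) μ
  have hgdef : ∀ q, g q = ∫ t, ρ.normed μ t • f (q - t) ∂μ := fun q => rfl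
  have hg'def : ∀ q, g' q = ∫ t, ρ.normed μ t • f' (q - t) ∂μ := fun q => rfl
  have hint : ∀ q, Integrable (fun t => ρ.normed μ t • f (q - t)) μ := fun q =>
    (hρ.smul (hfc.comp (continuous_const.sub continuous_id))).integrable_of_hasCompactSupport
      hρc.smul_right
  have hint' : ∀ q, Integrable (fun t => ρ.normed μ t • f' (q - t)) μ := fun q =>
    (hρ.smul (hf'c.comp (continuous_const.sub continuous_id))).integrable_of_hasCompactSupport
      hρc.smul_right
  refine ⟨g, g', ?_, ?_, ?_, ?_, ?_, ?_, ?_⟩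
  · exact hρc.contDiff_convolution_left (n := ⊤) _ ρ.contDiff_normed hfc.locallyIntegrable
  · intro q
    refine hasFDerivAt_integral_of_dominated_of_fderiv_le (𝕜 := ℝ) (μ := μ)
      (F := fun q t => ρ.normed μ t • f (q - t)) (F' := fun q t => ρ.normed μ t • f' (q - t))
      (bound := fun t => ρ.normed μ t * K) (s := Set.univ) univ_mem
      (.of_forall fun q => (hint q).aestronglyMeasurable) (hint q)
      (hint' q).aestronglyMeasurable ?_ ?_ ?_
    · refine .of_forall fun t q _ => ?_
      rw [norm_smul, Real.norm_of_nonneg (ρ.nonneg_normed t)]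
      exact mul_le_mul_of_nonneg_left (hK _) (ρ.nonneg_normed t)
    · exact ρ.integrable_normed.mul_const K
    · refine .of_forall fun t q _ => ?_
      have h := (hf (q - t)).comp q ((hasFDerivAt_id q).sub_const t)
      rw [ContinuousLinearMap.comp_id] at h
      exact h.const_smul _
  · intro q
    rw [← dist_eq_norm]
    refine ρ.dist_normed_convolution_le hfc.aestronglyMeasurable fun x hx => (h₁ ?_).le
    exact lt_of_lt_of_le hx ((min_le_right _ _).trans (min_le_left _ _))
  · intro q
    rw [← dist_eq_norm]
    refine ρ.dist_normed_convolution_le hf'c.aestronglyMeasurable fun x hx => (h₂ ?_).le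
    exact lt_of_lt_of_le hx ((min_le_right _ _).trans (min_le_right _ _))
  · intro a ha q
    rw [hgdef, hgdef]
    congr 1
    funext t
    rw [add_sub_right_comm, ha]
  · intro l hl q
    rw [hg'def, ← l.integral_comp_comm (hint' q)]
    simp [hl]
  · intro q hq
    have h := ρ.normed_convolution_eq_right (μ := μ) (g := f) (x₀ := q) fun x hx => by
      rw [hq x (Metric.ball_subset_ball (min_le_left _ _) hx), hq q (Metric.mem_ball_self hδ)]
    exact h.trans (hq q (Metric.mem_ball_self hδ))

variable {d : ℕ}

/-- `toTorus` as a homomorphism. -/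
def toTorusHom (d : ℕ) : Vec d →+ Torus d where
  toFun := toTorus
  map_zero' := toTorus_zero
  map_add' := toTorus_add

lemma uniformContinuous_toTorus : UniformContinuous (toTorus (d := d)) :=
  uniformContinuous_addMonoidHom_of_continuous (f := toTorusHom d) continuous_toTorus

/-- The function on the torus with a given periodic lift. -/
def descend {Y : Type*} (g : Vec d → Y) (x : Torus d) : Y :=
  g (Function.surjInv surjective_toTorus x)

lemma descend_toTorus {Y : Type*} {g : Vec d → Y}
    (h : ∀ a, toTorus a = 0 → ∀ y, g (y + a) = g y) (y : Vec d) : descend g (toTorus y) = g y := by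
  have h1 : toTorus (Function.surjInv surjective_toTorus (toTorus y)) = toTorus y :=
    Function.surjInv_eq _ _
  have h2 := h (Function.surjInv surjective_toTorus (toTorus y) - y) (by
    have := (toTorusHom d).map_sub (Function.surjInv surjective_toTorus (toTorus y)) y
    rw [show toTorus _ = toTorusHom d _ from rfl, this]
    change toTorus _ - toTorus _ = 0
    rw [h1, sub_self]) y
  rw [descend, ← h2]
  congr 1
  abel

/-- Weakly divergence-free fields are orthogonal to gradients that are merely continuous. -/
lemma IsDivFree.inner_grad_eq_zero {u : L2 d} (hu : IsDivFree u) {ψ : Torus d → ℝ}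
    (hψ : ContDiff ℝ 1 (fun y : Vec d => ψ (toTorus y))) :
    inner ℝ u (contL2 (grad ψ)) = 0 := by
  have hc := continuous_spaceDeriv hψ
  obtain ⟨K, hK⟩ := (isCompact_range hc).isBounded.exists_norm_le
  have huc : UniformContinuous fun y : Vec d => spaceDeriv ψ (toTorus y) :=
    (CompactSpace.uniformContinuous_of_continuous hc).comp uniformContinuous_toTorus
  have key : ∀ ε > 0, |inner ℝ u (contL2 (grad ψ))| ≤ ‖u‖ * (embConst d * ε) := by
    intro ε hε
    obtain ⟨g, g', hg, hgd, -, hg', hper, -, -⟩ := exists_contDiff_approx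
      (hasFDerivAt_spaceDeriv hψ) huc (K := K) (fun q => hK _ ⟨_, rfl⟩) one_pos hε
    have hlift : ∀ y, descend g (toTorus y) = g y := descend_toTorus fun a ha =>
      hper a fun q => by simp only [toTorus_add, ha, add_zero]
    have hsm : ContDiff ℝ ∞ (fun y : Vec d => descend g (toTorus y)) := by
      simpa only [hlift] using hg
    have hsm1 : ContDiff ℝ 1 (fun y : Vec d => descend g (toTorus y)) :=
      hsm.of_le (mod_cast le_top)
    have h1 : inner ℝ u (contL2 (grad ψ)) =
        inner ℝ u (contL2 (fun x => grad ψ x - grad (descend g) x)) := by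
      rw [contL2_sub (continuous_grad hψ) (continuous_grad hsm1), inner_sub_right, hu _ hsm,
        sub_zero]
    rw [h1]
    refine (abs_real_inner_le_norm _ _).trans (mul_le_mul_of_nonneg_left ?_ (norm_nonneg _))
    refine norm_contL2_le hε.le fun x => ?_
    obtain ⟨y, rfl⟩ := surjective_toTorus x
    have h2 : spaceDeriv (descend g) (toTorus y) = g' y :=
      spaceDeriv_eq_of_hasFDerivAt (by simpa only [hlift] using hgd y)
    have h3 : grad ψ (toTorus y) - grad (descend g) (toTorus y) =
        (InnerProductSpace.toDual ℝ (Vec d)).symm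
          (spaceDeriv ψ (toTorus y) - spaceDeriv (descend g) (toTorus y)) := by
      rw [map_sub]; rfl
    rw [h3, LinearIsometryEquiv.norm_map, h2, norm_sub_rev]
    exact hg' y
  by_contra hne
  have hpos : 0 < |inner ℝ u (contL2 (grad ψ))| := abs_pos.2 hne
  have h0 : 0 ≤ ‖u‖ * embConst d := mul_nonneg (norm_nonneg _) embConst_nonneg
  have := key (|inner ℝ u (contL2 (grad ψ))| / (2 * (‖u‖ * embConst d + 1))) (by positivity)
  rw [← mul_assoc, mul_div_assoc', le_div_iff₀ (by positivity)] at this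
  nlinarith

/-! ### Approximation of `C¹` fields by test fields -/

/-- The joint derivative on `[0, T) × 𝕋ᵈ`. -/
def jointDeriv {F : Type*} [NormedAddCommGroup F] [NormedSpace ℝ F] (T : ℝ)
    (v : ℝ → Torus d → F) (t : ℝ) (x : Torus d) : ℝ × Vec d →L[ℝ] F :=
  (ContinuousLinearMap.fst ℝ ℝ (Vec d)).smulRight (timeDeriv T (fun s => v s x) t) +
    (spaceDeriv (v t) x).comp (.snd ℝ ℝ (Vec d))

section

variable {F : Type*} [NormedAddCommGroup F] [NormedSpace ℝ F] {T : ℝ} {v : ℝ → Torus d → F}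

lemma liftDeriv_eq_jointDeriv (h : IsCn 1 T v) {t : ℝ} (ht : t ∈ Set.Ico 0 T) (y : Vec d) :
    liftDeriv T v (t, y) = jointDeriv T v t (toTorus y) := by
  ext
  · simp [jointDeriv, h.timeDeriv_eq ht]
  · simp [jointDeriv, h.spaceDeriv_eq ht]

lemma JointlyContinuous.continuousOn {Y : Type*} [TopologicalSpace Y] {f : ℝ → Torus d → Y}
    (h : JointlyContinuous T f) :
    ContinuousOn (fun p : ℝ × Torus d => f p.1 p.2) (Set.Ico 0 T ×ˢ Set.univ) := by
  rw [continuousOn_iff_continuous_domRestrict]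
  have h2 : Continuous (fun p : (Set.Ico (0 : ℝ) T ×ˢ Set.univ : Set (ℝ × Torus d)) =>
      ((⟨p.1.1, p.2.1⟩, p.1.2) : Set.Ico (0 : ℝ) T × Torus d)) := by fun_prop
  exact h.comp h2

lemma IsCn.continuousOn_jointDeriv (h : IsCn 1 T v) :
    ContinuousOn (fun p : ℝ × Torus d => jointDeriv T v p.1 p.2) (Set.Ico 0 T ×ˢ Set.univ) := by
  refine JointlyContinuous.continuousOn (JointlyContinuous.of_lift ?_)
  refine (continuousOn_liftDeriv h).congr ?_
  rintro ⟨t, y⟩ ⟨ht, -⟩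
  exact (liftDeriv_eq_jointDeriv h ht y).symm

end

/-- The case of a cut-off `χ` for which `χ(t) v(t + δ)` is supported in the interior of the time
interval, so that its extension by zero can be mollified. -/
lemma exists_testField_approx_shift {T : ℝ} {v : ℝ → Torus d → Vec d} (hv : IsCn 1 T v)
    (hdiv : ∀ t ∈ Set.Ico 0 T, ∀ x, divergence (v t) x = 0) {χ : ℝ → ℝ} (hχ : ContDiff ℝ ∞ χ)
    {δ : ℝ} (hδ : 0 < δ) (hχc : HasCompactSupport χ)
    (hχs : tsupport χ ⊆ Set.Ioo (-δ) (T - δ)) {ε : ℝ} (hε : 0 < ε) :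
    ∃ φ : ℝ → Torus d → Vec d, IsTestField T φ ∧ ∀ t ∈ Set.Ico 0 T, ∀ x,
      ‖φ t x - χ t • v (t + δ) x‖ ≤ ε ∧
      ‖timeDeriv T (fun s => φ s x) t -
        (χ t • timeDeriv T (fun s => v s x) (t + δ) + deriv χ t • v (t + δ) x)‖ ≤ ε ∧
      ‖spaceDeriv (φ t) x - χ t • spaceDeriv (v (t + δ)) x‖ ≤ ε := by
  let f : ℝ × Vec d → Vec d := fun q => χ q.1 • v (q.1 + δ) (toTorus q.2)
  let H : ℝ × Torus d → (ℝ × Vec d →L[ℝ] Vec d) := fun p => χ p.1 • jointDeriv T v (p.1 + δ) p.2 +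
    deriv χ p.1 • (ContinuousLinearMap.fst ℝ ℝ (Vec d)).smulRight (v (p.1 + δ) p.2)
  have hmem : ∀ {t}, t ∈ tsupport χ → t + δ ∈ Set.Ioo 0 T := fun {t} ht => by
    have := hχs ht; constructor <;> linarith [this.1, this.2]
  have hzero : ∀ {t}, t ∉ tsupport χ → ∀ᶠ s in 𝓝 t, χ s = 0 ∧ deriv χ s = 0 := fun {t} ht => by
    have h1 := (isClosed_tsupport χ).isOpen_compl.mem_nhds ht
    filter_upwards [h1] with s hs
    exact ⟨image_eq_zero_of_notMem_tsupport hs,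
      image_eq_zero_of_notMem_tsupport fun h => hs (tsupport_deriv_subset (f := χ) h)⟩
  have hH0 : ∀ t x, χ t = 0 → deriv χ t = 0 → H (t, x) = 0 := by
    intro t x h1 h2
    ext <;> simp [H, h1, h2]
  have hHc : Continuous H := by
    rw [continuous_iff_continuousAt]
    rintro ⟨t, x⟩
    by_cases ht : t ∈ tsupport χ
    · have hS : Set.Ico 0 T ×ˢ Set.univ ∈ 𝓝 ((t + δ, x) : ℝ × Torus d) :=
        prod_mem_nhds (Ico_mem_nhds (hmem ht).1 (hmem ht).2) univ_mem
      have hsh : ContinuousAt (fun p : ℝ × Torus d => (p.1 + δ, p.2)) (t, x) := by fun_prop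
      have h1 : ContinuousAt (fun p : ℝ × Torus d => jointDeriv T v (p.1 + δ) p.2) (t, x) :=
        ContinuousAt.comp (g := fun p : ℝ × Torus d => jointDeriv T v p.1 p.2)
          (f := fun p : ℝ × Torus d => (p.1 + δ, p.2))
          (hv.continuousOn_jointDeriv.continuousAt hS) hsh
      have h2 : ContinuousAt (fun p : ℝ × Torus d => v (p.1 + δ) p.2) (t, x) :=
        ContinuousAt.comp (g := fun p : ℝ × Torus d => v p.1 p.2)
          (f := fun p : ℝ × Torus d => (p.1 + δ, p.2))
          (hv.jointlyContinuous.continuousOn.continuousAt hS) hsh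
      have h3 : ContinuousAt (fun p : ℝ × Torus d => χ p.1) (t, x) :=
        (hχ.continuous.comp continuous_fst).continuousAt
      have h4 : ContinuousAt (fun p : ℝ × Torus d => deriv χ p.1) (t, x) :=
        ((hχ.continuous_deriv (mod_cast le_top)).comp continuous_fst).continuousAt
      exact (h3.smul h1).add (h4.smul
        (((ContinuousLinearMap.smulRightL ℝ (ℝ × Vec d) (Vec d))
          (ContinuousLinearMap.fst ℝ ℝ (Vec d))).continuous.continuousAt.comp h2))
    · have h1 : ∀ᶠ p : ℝ × Torus d in 𝓝 (t, x), H p = 0 := by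
        filter_upwards [(continuous_fst (X := ℝ) (Y := Torus d)).continuousAt.eventually
          (hzero ht)] with p hp
        exact hH0 _ _ hp.1 hp.2
      exact continuousAt_const.congr (h1.mono fun p hp => hp.symm)
  -- the torus is compact, so that `H` is uniformly continuous and bounded
  have hHs : HasCompactSupport H := by
    refine HasCompactSupport.intro (hχc.isCompact.prod (isCompact_univ (X := Torus d))) ?_
    rintro ⟨t, x⟩ ht
    have ht' : t ∉ tsupport χ := fun h => ht ⟨h, trivial⟩
    obtain ⟨h1, h2⟩ := (hzero ht').self_of_nhds
    exact hH0 _ _ h1 h2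
  have hHu : UniformContinuous H := hHs.uniformContinuous_of_continuous hHc
  obtain ⟨K, hK⟩ := hHc.bounded_above_of_compact_support hHs
  have hf : ∀ q : ℝ × Vec d, HasFDerivAt f (H (q.1, toTorus q.2)) q := by
    rintro ⟨t, y⟩
    by_cases ht : t ∈ tsupport χ
    · have h1 : HasFDerivAt (fun q : ℝ × Vec d => v q.1 (toTorus q.2))
          (jointDeriv T v (t + δ) (toTorus y)) (t + δ, y) := by
        rw [← liftDeriv_eq_jointDeriv hv ⟨(hmem ht).1.le, (hmem ht).2⟩]
        exact hv.hasFDerivAt (hmem ht) y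
      have h2 : HasFDerivAt (fun q : ℝ × Vec d => q + (δ, 0))
          (ContinuousLinearMap.id ℝ (ℝ × Vec d)) (t, y) := (hasFDerivAt_id _).add_const _
      have h1' : HasFDerivAt (fun q : ℝ × Vec d => v q.1 (toTorus q.2))
          (jointDeriv T v (t + δ) (toTorus y)) ((t, y) + (δ, 0)) := by
        simpa using h1
      have h3 := h1'.comp (t, y) h2
      rw [ContinuousLinearMap.comp_id] at h3
      have h4 : HasFDerivAt (fun q : ℝ × Vec d => χ q.1)
          (deriv χ t • ContinuousLinearMap.fst ℝ ℝ (Vec d)) (t, y) :=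
        ((hχ.differentiable (by simp) t).hasDerivAt).comp_hasFDerivAt (t, y) hasFDerivAt_fst
      have h5 := h4.smul h3
      have h6 : f = fun q : ℝ × Vec d =>
          χ q.1 • ((fun q : ℝ × Vec d => v q.1 (toTorus q.2)) ∘ fun q => q + (δ, 0)) q := by
        funext q; simp [f]
      rw [h6]
      refine h5.congr_fderiv ?_
      ext <;> simp [H]
    · have h1 : ∀ᶠ q : ℝ × Vec d in 𝓝 (t, y), f q = 0 := by
        filter_upwards [(continuous_fst (X := ℝ) (Y := Vec d)).continuousAt.eventually
          (hzero ht)] with p hp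
        simp [f, hp.1]
      have h2 : H (t, toTorus y) = 0 := by
        obtain ⟨h1, h2⟩ := (hzero ht).self_of_nhds
        exact hH0 _ _ h1 h2
      rw [h2]
      exact (hasFDerivAt_const (0 : Vec d) _).congr_of_eventuallyEq h1
  have huc : UniformContinuous fun q : ℝ × Vec d => H (q.1, toTorus q.2) :=
    hHu.comp (uniformContinuous_id.prodMap uniformContinuous_toTorus)
  obtain ⟨T₁, hT₁, hT₁χ⟩ : ∃ T₁ < T, ∀ t, T₁ ≤ t → χ t = 0 := by
    obtain ⟨c, hc⟩ := hχc.isCompact.bddAbove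
    rcases (tsupport χ).eq_empty_or_nonempty with h | h
    · refine ⟨T - 1, by linarith, fun t _ => image_eq_zero_of_notMem_tsupport (by simp [h])⟩
    · refine ⟨T - δ, by linarith, fun t ht => image_eq_zero_of_notMem_tsupport fun h => ?_⟩
      exact absurd (hχs h).2 (not_lt.2 ht)
  obtain ⟨g, g', hg, hgd, hgf, hg', hper, hlin, hsupp⟩ := exists_contDiff_approx hf huc
    (fun q => hK _) (δ := (T - T₁) / 2) (by linarith) hε
  have hlift : ∀ t y, descend (fun z => g (t, z)) (toTorus y) = g (t, y) := fun t =>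
    descend_toTorus fun a ha y => by
      have := hper (0, a) (fun q => by simp [f, toTorus_add, ha]) (t, y)
      simpa using this
  let φ : ℝ → Torus d → Vec d := fun t => descend fun z => g (t, z)
  have hφn : IsCn ∞ T φ := by
    refine (hg.contDiffOn).congr ?_
    rintro ⟨t, y⟩ -
    exact hlift t y
  have hφ1 : IsCn 1 T φ := hφn.mono (mod_cast le_top)
  have hsp : ∀ t y, spaceDeriv (φ t) (toTorus y) = (g' (t, y)).comp (.inr ℝ ℝ (Vec d)) := by
    intro t y
    refine spaceDeriv_eq_of_hasFDerivAt ?_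
    simp only [φ, hlift]
    exact (hgd (t, y)).comp y (hasFDerivAt_prodMk_right t y)
  have hti : ∀ t ∈ Set.Ico 0 T, ∀ y,
      timeDeriv T (fun s => φ s (toTorus y)) t = g' (t, y) (1, 0) := by
    intro t ht y
    simp only [φ, hlift]
    have h1 : HasDerivAt (fun s : ℝ => ((s, y) : ℝ × Vec d)) (1, 0) t :=
      (hasDerivAt_id t).prodMk (hasDerivAt_const t y)
    exact (((hgd (t, y)).comp_hasDerivAt t h1).hasDerivWithinAt).derivWithin
      (uniqueDiffOn_Ico 0 T t ht)
  refine ⟨φ, ⟨hφn, ⟨(T + T₁) / 2, by linarith, ?_⟩, ?_⟩, ?_⟩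
  · intro t _ htT x
    refine hsupp _ ?_
    rintro ⟨s, z⟩ hz
    have hz1 : |s - t| < (T - T₁) / 2 := by
      rw [Metric.mem_ball, Prod.dist_eq] at hz
      exact lt_of_le_of_lt (le_max_left _ _) hz
    have : χ s = 0 := hT₁χ s (by linarith [(abs_lt.1 hz1).1])
    simp [f, this]
  · intro t _ x
    obtain ⟨y, rfl⟩ := surjective_toTorus x
    rw [divergence_eq_traceCLM, hsp]
    let l : (ℝ × Vec d →L[ℝ] Vec d) →L[ℝ] ℝ := (traceCLM d).comp
      ((ContinuousLinearMap.compL ℝ (Vec d) (ℝ × Vec d) (Vec d)).flip (.inr ℝ ℝ (Vec d)))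
    refine hlin l (fun q => ?_) (t, y)
    have h1 : (H (q.1, toTorus q.2)).comp (.inr ℝ ℝ (Vec d)) =
        χ q.1 • spaceDeriv (v (q.1 + δ)) (toTorus q.2) := by
      ext; simp [H, jointDeriv]
    change traceCLM d ((H (q.1, toTorus q.2)).comp (.inr ℝ ℝ (Vec d))) = 0
    rw [h1, map_smul, ← divergence_eq_traceCLM]
    by_cases hq : q.1 ∈ tsupport χ
    · rw [hdiv _ ⟨(hmem hq).1.le, (hmem hq).2⟩, smul_zero]
    · rw [(hzero hq).self_of_nhds.1, zero_smul]
  · intro t ht x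
    obtain ⟨y, rfl⟩ := surjective_toTorus x
    refine ⟨?_, ?_, ?_⟩
    · have := hgf (t, y)
      rwa [← hlift t y] at this
    · rw [hti t ht]
      have h1 : χ t • timeDeriv T (fun s => v s (toTorus y)) (t + δ) +
          deriv χ t • v (t + δ) (toTorus y) = H (t, toTorus y) (1, 0) := by
        simp [H, jointDeriv]
      rw [h1, ← sub_apply]
      refine (ContinuousLinearMap.le_opNorm _ _).trans ?_
      have h2 : ‖((1, 0) : ℝ × Vec d)‖ ≤ 1 := by simp [Prod.norm_def]
      exact (mul_le_of_le_one_right (norm_nonneg _) h2).trans (hg' (t, y))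
    · rw [hsp]
      have h1 : χ t • spaceDeriv (v (t + δ)) (toTorus y) =
          (H (t, toTorus y)).comp (.inr ℝ ℝ (Vec d)) := by
        ext; simp [H, jointDeriv]
      rw [h1, ← ContinuousLinearMap.sub_comp]
      refine (ContinuousLinearMap.opNorm_comp_le _ _).trans ?_
      exact (mul_le_of_le_one_right (norm_nonneg _)
        (ContinuousLinearMap.norm_inr_le_one _ _ _)).trans (hg' (t, y))

end

section

variable {d : ℕ}

lemma exists_uniform_modulus {E : Type*} [NormedAddCommGroup E] {T T₁ : ℝ} {c : ℝ → E}
    (hc : ContinuousOn c (Set.Ico 0 T)) (hT₁ : T₁ < T) {ε : ℝ} (hε : 0 < ε) :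
    ∃ δ > 0, ∀ s ∈ Set.Icc 0 T₁, ∀ t ∈ Set.Icc 0 T₁, |s - t| < δ → ‖c s - c t‖ < ε := by
  have h := isCompact_Icc.uniformContinuousOn_of_continuous
    (hc.mono (fun t ht => ⟨ht.1, ht.2.trans_lt hT₁⟩ : Set.Icc 0 T₁ ⊆ Set.Ico 0 T))
  obtain ⟨δ, hδ, h⟩ := Metric.uniformContinuousOn_iff.1 h ε hε
  refine ⟨δ, hδ, fun s hs t ht hst => ?_⟩
  have := h s hs t ht (by rwa [Real.dist_eq])
  rwa [dist_eq_norm] at this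

lemma norm_sub_le_of_toC {Y : Type*} [NormedAddCommGroup Y] {f g : Torus d → Y} {c : ℝ}
    (hf : Continuous f) (hg : Continuous g) (h : ‖toC f - toC g‖ < c) (x : Torus d) :
    ‖f x - g x‖ ≤ c := by
  have := (toC f - toC g).norm_coe_le_norm x
  rw [ContinuousMap.sub_apply, toC_apply hf, toC_apply hg] at this
  exact this.trans h.le

lemma norm_add_smul_sub_le {Y : Type*} [NormedAddCommGroup Y] [NormedSpace ℝ Y] {a b c : Y}
    {r B η : ℝ} (h1 : ‖a - r • b‖ ≤ η) (h2 : r = 0 ∨ |r| ≤ B ∧ ‖b - c‖ ≤ η) (hB : 0 ≤ B)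
    (hη : 0 ≤ η) : ‖a - r • c‖ ≤ (1 + B) * η := by
  have h3 : ‖r • (b - c)‖ ≤ B * η := by
    rcases h2 with h | ⟨h, h'⟩
    · rw [h, zero_smul, norm_zero]; positivity
    · rw [norm_smul, Real.norm_eq_abs]
      exact mul_le_mul h h' (norm_nonneg _) hB
  have h4 : a - r • c = (a - r • b) + r • (b - c) := by rw [smul_sub]; abel
  rw [h4]
  refine (norm_add_le _ _).trans ?_
  linarith

lemma opL2_sub_smul (A B : C(Torus d, Vec d →L[ℝ] Vec d)) (c : ℝ) (u : L2 d) :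
    opL2 (A - c • B) u = opL2 A u - c • opL2 B u := by
  have h : opL2 (A - c • B) = opL2 A - c • opL2 B := by
    rw [ContinuousLinearMap.map_sub, ContinuousLinearMap.map_smul]
  rw [h]
  rfl

/-- The field `χ v`, for a divergence-free `C¹` field `v` on `[0, T)` and a smooth cut-off `χ` in
time, can be approximated by test fields. To stay away from the boundary `t = 0`, the field `v` is
first shifted forward in time. -/
lemma exists_testField_approx {T : ℝ} {v : ℝ → Torus d → Vec d} (hv : IsCn 1 T v)
    (hdiv : ∀ t ∈ Set.Ico 0 T, ∀ x, divergence (v t) x = 0) {χ : ℝ → ℝ} (hχ : ContDiff ℝ ∞ χ)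
    {T' : ℝ} (hT'0 : 0 ≤ T') (hT' : T' < T) (hχ0 : ∀ t, T' ≤ t → χ t = 0) {ε : ℝ} (hε : 0 < ε) :
    ∃ φ : ℝ → Torus d → Vec d, IsTestField T φ ∧
      ‖contL2 (φ 0) - χ 0 • contL2 (v 0)‖ ≤ ε ∧
      ∀ t ∈ Set.Ico 0 T, ∀ u : L2 d, |rate T φ t u -
        (χ t * rate T v t u + deriv χ t * inner ℝ u (contL2 (v t)))| ≤ ε * (‖u‖ + ‖u‖ ^ 2) := by
  have hχ' : Continuous (deriv χ) := hχ.continuous_deriv (mod_cast le_top)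
  obtain ⟨B₁, hB₁⟩ := (isCompact_Icc (a := 0) (b := T')).exists_bound_of_continuousOn
    hχ.continuous.continuousOn
  obtain ⟨B₂, hB₂⟩ := (isCompact_Icc (a := 0) (b := T')).exists_bound_of_continuousOn
    hχ'.continuousOn
  let B := max 0 (max B₁ B₂)
  have hB : 0 ≤ B := le_max_left _ _
  let E := embConst d
  have hE : 0 ≤ E := embConst_nonneg
  let η := ε / ((1 + 2 * B) * (E + 1))
  have hη : 0 < η := by positivity
  have hT₁ : (T' + T) / 2 < T := by linarith
  obtain ⟨δ₁, hδ₁, h₁⟩ := exists_uniform_modulus hv.jointlyContinuous.continuousOn_toC hT₁ hη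
  obtain ⟨δ₂, hδ₂, h₂⟩ :=
    exists_uniform_modulus hv.jointlyContinuous_timeDeriv.continuousOn_toC hT₁ hη
  obtain ⟨δ₃, hδ₃, h₃⟩ :=
    exists_uniform_modulus hv.jointlyContinuous_spaceDeriv.continuousOn_toC hT₁ hη
  let m := min (min δ₁ δ₂) (min δ₃ ((T - T') / 2))
  have hm : 0 < m := lt_min (lt_min hδ₁ hδ₂) (lt_min hδ₃ (by linarith))
  obtain ⟨δ, hδ, hδm⟩ := exists_between hm
  have hδ₁' : δ < δ₁ := hδm.trans_le ((min_le_left _ _).trans (min_le_left _ _))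
  have hδ₂' : δ < δ₂ := hδm.trans_le ((min_le_left _ _).trans (min_le_right _ _))
  have hδ₃' : δ < δ₃ := hδm.trans_le ((min_le_right _ _).trans (min_le_left _ _))
  have hδT : δ < (T - T') / 2 := hδm.trans_le ((min_le_right _ _).trans (min_le_right _ _))
  -- a cut-off that is `1` for `t ≥ -δ/3` and `0` for `t ≤ -2δ/3`: it does not change `χ` on
  -- `[0, T)` and keeps the support of `χ κ` inside `(-δ, T - δ)`
  let κ : ℝ → ℝ := fun t => Real.smoothTransition (2 + 3 * t / δ)
  have hκ : ContDiff ℝ ∞ κ := by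
    refine Real.smoothTransition.contDiff.comp ?_
    fun_prop
  have hκ1 : ∀ t, -(δ / 3) ≤ t → κ t = 1 := fun t ht => by
    refine Real.smoothTransition.one_of_one_le ?_
    have : -1 ≤ 3 * t / δ := by rw [le_div_iff₀ hδ]; linarith
    linarith
  have hκ0 : ∀ t, t ≤ -(2 * δ / 3) → κ t = 0 := fun t ht => by
    refine Real.smoothTransition.zero_of_nonpos ?_
    have : 3 * t / δ ≤ -2 := by rw [div_le_iff₀ hδ]; linarith
    linarith
  let χ' : ℝ → ℝ := fun t => χ t * κ t
  have hsub : tsupport χ' ⊆ Set.Icc (-(2 * δ / 3)) T' := by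
    refine closure_minimal (fun t ht => ?_) isClosed_Icc
    by_contra hcon
    rw [Set.mem_Icc, not_and_or, not_le, not_le] at hcon
    refine ht ?_
    rcases hcon with h | h
    · simp [χ', hκ0 t h.le]
    · simp [χ', hχ0 t h.le]
  obtain ⟨φ, hφ, happ⟩ := exists_testField_approx_shift hv hdiv (χ := χ') (hχ.mul hκ) hδ
    (isCompact_Icc.of_isClosed_subset (isClosed_tsupport _) hsub)
    (fun t ht => ⟨by linarith [(hsub ht).1], by linarith [(hsub ht).2]⟩) hη
  have hφ1 : IsCn 1 T φ := hφ.smooth.mono (mod_cast le_top)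
  have hχeq : ∀ t, 0 ≤ t → χ' t = χ t ∧ deriv χ' t = deriv χ t := by
    intro t ht
    have h : χ' =ᶠ[𝓝 t] χ := by
      filter_upwards [Ioi_mem_nhds (show -(δ / 3) < t by linarith)] with s hs
      simp [χ', hκ1 s (le_of_lt hs)]
    exact ⟨h.self_of_nhds, h.deriv_eq⟩
  have hχB : ∀ t, 0 ≤ t → (χ t = 0 ∧ deriv χ t = 0) ∨ (|χ t| ≤ B ∧ |deriv χ t| ≤ B ∧ t ≤ T') := by
    intro t ht
    rcases le_or_gt t T' with h | h
    · right
      refine ⟨(hB₁ t ⟨ht, h⟩).trans ?_, (hB₂ t ⟨ht, h⟩).trans ?_, h⟩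
      · exact (le_max_left _ _).trans (le_max_right _ _)
      · exact (le_max_right _ _).trans (le_max_right _ _)
    · left
      have h2 : χ =ᶠ[𝓝 t] fun _ => 0 := by
        filter_upwards [Ioi_mem_nhds h] with s hs
        exact hχ0 s (le_of_lt hs)
      exact ⟨h2.self_of_nhds, by rw [h2.deriv_eq, deriv_const]⟩
  let θ := (1 + 2 * B) * η
  have hθ : 0 ≤ θ := by positivity
  have hθε : θ * (E + 1) = ε := by simp only [θ, η]; field_simp
  have hmem : ∀ t, 0 ≤ t → t ≤ T' → t ∈ Set.Icc 0 ((T' + T) / 2) ∧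
      t + δ ∈ Set.Icc 0 ((T' + T) / 2) ∧ t ∈ Set.Ico 0 T ∧ t + δ ∈ Set.Ico 0 T ∧
        |t + δ - t| = δ := by
    intro t h0 h1
    refine ⟨⟨h0, by linarith⟩, ⟨by linarith, by linarith⟩, ⟨h0, by linarith⟩,
      ⟨by linarith, by linarith⟩, ?_⟩
    rw [add_sub_cancel_left, abs_of_pos hδ]
  have main : ∀ t ∈ Set.Ico 0 T, ∀ x, ‖φ t x - χ t • v t x‖ ≤ θ ∧
      ‖timeDeriv T (fun s => φ s x) t -
        (χ t • timeDeriv T (fun s => v s x) t + deriv χ t • v t x)‖ ≤ θ ∧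
      ‖spaceDeriv (φ t) x - χ t • spaceDeriv (v t) x‖ ≤ θ := by
    intro t ht x
    obtain ⟨e1, e2⟩ := hχeq t ht.1
    obtain ⟨a1, a2, a3⟩ := happ t ht x
    rw [e1] at a1 a2 a3
    rw [e2] at a2
    have hle : (1 + B) * η ≤ θ := by simp only [θ]; nlinarith
    have hv1 : t ≤ T' → ‖v (t + δ) x - v t x‖ ≤ η := fun h => by
      obtain ⟨m1, m2, m3, m4, m5⟩ := hmem t ht.1 h
      exact norm_sub_le_of_toC (hv.jointlyContinuous.slice m4) (hv.jointlyContinuous.slice m3)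
        (h₁ _ m2 _ m1 (m5.trans_lt hδ₁')) x
    have hv2 : t ≤ T' →
        ‖timeDeriv T (fun s => v s x) (t + δ) - timeDeriv T (fun s => v s x) t‖ ≤ η :=
      fun h => by
        obtain ⟨m1, m2, m3, m4, m5⟩ := hmem t ht.1 h
        exact norm_sub_le_of_toC (hv.jointlyContinuous_timeDeriv.slice m4)
          (hv.jointlyContinuous_timeDeriv.slice m3) (h₂ _ m2 _ m1 (m5.trans_lt hδ₂')) x
    have hv3 : t ≤ T' → ‖spaceDeriv (v (t + δ)) x - spaceDeriv (v t) x‖ ≤ η :=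
      fun h => by
        obtain ⟨m1, m2, m3, m4, m5⟩ := hmem t ht.1 h
        exact norm_sub_le_of_toC (hv.jointlyContinuous_spaceDeriv.slice m4)
          (hv.jointlyContinuous_spaceDeriv.slice m3) (h₃ _ m2 _ m1 (m5.trans_lt hδ₃')) x
    refine ⟨?_, ?_, ?_⟩
    · refine (norm_add_smul_sub_le a1 ?_ hB hη.le).trans hle
      exact (hχB t ht.1).imp (fun h => h.1) fun h => ⟨h.1, hv1 h.2.2⟩
    · have s1 : ‖(timeDeriv T (fun s => φ s x) t - deriv χ t • v (t + δ) x) -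
          χ t • timeDeriv T (fun s => v s x) (t + δ)‖ ≤ η := by
        convert a2 using 2; abel
      have s2 := norm_add_smul_sub_le s1
        ((hχB t ht.1).imp (fun h => h.1) fun h => ⟨h.1, hv2 h.2.2⟩) hB hη.le
      have s3 : ‖deriv χ t • (v (t + δ) x - v t x)‖ ≤ B * η := by
        rcases hχB t ht.1 with h | h
        · rw [h.2, zero_smul, norm_zero]; positivity
        · rw [norm_smul, Real.norm_eq_abs]
          exact mul_le_mul h.2.1 (hv1 h.2.2) (norm_nonneg _) hB
      have s4 : timeDeriv T (fun s => φ s x) t -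
          (χ t • timeDeriv T (fun s => v s x) t + deriv χ t • v t x) =
          (timeDeriv T (fun s => φ s x) t - deriv χ t • v (t + δ) x -
            χ t • timeDeriv T (fun s => v s x) t) + deriv χ t • (v (t + δ) x - v t x) := by
        rw [smul_sub]; abel
      rw [s4]
      refine (norm_add_le _ _).trans ((add_le_add s2 s3).trans ?_)
      simp only [θ]; linarith
    · refine (norm_add_smul_sub_le a3 ?_ hB hη.le).trans hle
      exact (hχB t ht.1).imp (fun h => h.1) fun h => ⟨h.1, hv3 h.2.2⟩
  have hT0 : (0 : ℝ) ∈ Set.Ico 0 T := ⟨le_rfl, hT'0.trans_lt hT'⟩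
  have hEθ : E * θ ≤ ε := by nlinarith
  have hθ' : θ ≤ ε := by nlinarith
  refine ⟨φ, hφ, ?_, fun t ht u => ?_⟩
  · have c1 := hφ1.jointlyContinuous.slice hT0
    have c2 := hv.jointlyContinuous.slice hT0
    have c2' : Continuous fun x => χ 0 • v 0 x := by fun_prop
    rw [← contL2_smul _ c2, ← contL2_sub c1 c2']
    exact (norm_contL2_le hθ fun x => (main 0 hT0 x).1).trans hEθ
  · have c1 := hφ1.jointlyContinuous_timeDeriv.slice ht
    have c2 := hv.jointlyContinuous_timeDeriv.slice ht
    have c3 := hv.jointlyContinuous.slice ht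
    have c4 := hφ1.jointlyContinuous_spaceDeriv.slice ht
    have c5 := hv.jointlyContinuous_spaceDeriv.slice ht
    have c2' : Continuous fun x => χ t • timeDeriv T (fun s => v s x) t := by fun_prop
    have c3' : Continuous fun x => deriv χ t • v t x := by fun_prop
    have c5' : Continuous fun x => χ t • spaceDeriv (v t) x := by fun_prop
    let b : Torus d → Vec d := fun x =>
      χ t • timeDeriv T (fun s => v s x) t + deriv χ t • v t x
    have hbc : Continuous b := c2'.add c3'
    have hb : contL2 b = χ t • contL2 (fun x => timeDeriv T (fun s => v s x) t) +
        deriv χ t • contL2 (v t) := by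
      rw [← contL2_smul _ c2, ← contL2_smul _ c3]
      exact contL2_add c2' c3'
    have key : rate T φ t u - (χ t * rate T v t u + deriv χ t * inner ℝ u (contL2 (v t))) =
        inner ℝ u (contL2 fun x => timeDeriv T (fun s => φ s x) t - b x) +
        inner ℝ (opL2 (toC fun x => spaceDeriv (φ t) x - χ t • spaceDeriv (v t) x) u) u := by
      rw [contL2_sub c1 hbc, hb,
        toC_sub c4 c5', toC_smul _ c5, opL2_sub_smul]
      simp only [rate, inner_sub_right, inner_add_right, inner_smul_right,
        inner_sub_left, inner_smul_left, RCLike.conj_to_real]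
      ring
    rw [key, mul_add]
    refine (abs_add_le _ _).trans (add_le_add ?_ ?_)
    · refine (abs_real_inner_le_norm _ _).trans ?_
      rw [mul_comm]
      exact mul_le_mul_of_nonneg_right
        ((norm_contL2_le hθ fun x => (main t ht x).2.1).trans hEθ) (norm_nonneg _)
    · refine abs_inner_opL2_le _ _ fun x => ?_
      rw [toC_apply (f := fun x => spaceDeriv (φ t) x - χ t • spaceDeriv (v t) x)
        (c4.sub c5')]
      exact ((main t ht x).2.2).trans hθ'

end

section

variable {d : ℕ}

/-! ### Curves in `L²` given by `C¹` fields -/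

lemma IsCn.continuousOn_contL2 {T : ℝ} {v : ℝ → Torus d → Vec d} {n : WithTop ℕ∞}
    (hv : IsCn n T v) : ContinuousOn (fun t => contL2 (v t)) (Set.Ico 0 T) :=
  EulerStat.continuousOn_contL2 hv.jointlyContinuous

lemma uIcc_subset_Ico {T t : ℝ} (ht : t ∈ Set.Ico 0 T) : Set.uIcc 0 t ⊆ Set.Ico 0 T := by
  rw [Set.uIcc_of_le ht.1]
  exact fun s hs => ⟨hs.1, hs.2.trans_lt ht.2⟩

lemma intervalIntegrable_of_continuousOn_Ico {E : Type*} [NormedAddCommGroup E] {T t : ℝ}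
    {c : ℝ → E} (hc : ContinuousOn c (Set.Ico 0 T)) (ht : t ∈ Set.Ico 0 T) :
    IntervalIntegrable c volume 0 t :=
  (hc.mono (uIcc_subset_Ico ht)).intervalIntegrable

/-- A `C¹` vector field is differentiable in time as a curve in `L²`. -/
lemma IsCn.hasDerivAt_contL2 {T : ℝ} {v : ℝ → Torus d → Vec d} (hv : IsCn 1 T v) {t : ℝ}
    (ht : t ∈ Set.Ioo 0 T) :
    HasDerivAt (fun t => contL2 (v t)) (contL2 fun x => timeDeriv T (fun s => v s x) t) t := by
  let c' : ℝ → C(Torus d, Vec d) := fun t => toC fun x => timeDeriv T (fun s => v s x) t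
  have hc' : ContinuousOn c' (Set.Ico 0 T) := hv.jointlyContinuous_timeDeriv.continuousOn_toC
  -- the curve of continuous fields is the Bochner integral of its pointwise time derivative
  have hint : ∀ s ∈ Set.Ico 0 T, toC (v s) = toC (v 0) + ∫ r in (0 : ℝ)..s, c' r := by
    intro s hs
    have h0 : (0 : ℝ) ∈ Set.Ico 0 T := ⟨le_rfl, hs.1.trans_lt hs.2⟩
    have hii := intervalIntegrable_of_continuousOn_Ico hc' hs
    ext1 x
    have h1 : (∫ r in (0 : ℝ)..s, c' r) x = ∫ r in (0 : ℝ)..s, c' r x := by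
      have := ContinuousLinearMap.intervalIntegral_comp_comm (μ := volume)
        (ContinuousMap.evalCLM ℝ x : C(Torus d, Vec d) →L[ℝ] Vec d) hii
      exact this.symm
    have h2 : ∫ r in (0 : ℝ)..s, timeDeriv T (fun s => v s x) r = v s x - v 0 x := by
      refine intervalIntegral.integral_eq_sub_of_hasDerivAt_of_le (f := fun r => v r x) hs.1
        ?_ ?_ ?_
      · intro r hr
        exact ((hv.hasDerivWithinAt ⟨hr.1, hr.2.trans_lt hs.2⟩ x).continuousWithinAt).mono
          (fun r hr => ⟨hr.1, hr.2.trans_lt hs.2⟩)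
      · intro r hr
        exact (hv.hasDerivWithinAt ⟨hr.1.le, hr.2.trans hs.2⟩ x).hasDerivAt
          (Ico_mem_nhds hr.1 (hr.2.trans hs.2))
      · refine ContinuousOn.intervalIntegrable ?_
        have h3 : ContinuousOn (fun r => c' r x) (Set.uIcc 0 s) :=
          (ContinuousMap.evalCLM ℝ x : C(Torus d, Vec d) →L[ℝ] Vec d).continuous.comp_continuousOn
            (hc'.mono (uIcc_subset_Ico hs))
        refine h3.congr fun r hr => ?_
        exact (toC_apply (hv.jointlyContinuous_timeDeriv.slice (uIcc_subset_Ico hs hr)) x).symm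
    have h3 : ∫ r in (0 : ℝ)..s, c' r x = ∫ r in (0 : ℝ)..s, timeDeriv T (fun s => v s x) r := by
      refine intervalIntegral.integral_congr fun r hr => ?_
      exact toC_apply (hv.jointlyContinuous_timeDeriv.slice (uIcc_subset_Ico hs hr)) x
    rw [ContinuousMap.add_apply, h1, h3, h2, toC_apply (hv.jointlyContinuous.slice hs),
      toC_apply (hv.jointlyContinuous.slice h0)]
    abel
  have hd : HasDerivAt (fun s => toC (v 0) + ∫ r in (0 : ℝ)..s, c' r) (c' t) t := by
    refine HasDerivAt.const_add _ ?_
    have hnhds : Set.Ico 0 T ∈ 𝓝 t := Ico_mem_nhds ht.1 ht.2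
    refine intervalIntegral.integral_hasDerivAt_right
      (intervalIntegrable_of_continuousOn_Ico hc' ⟨ht.1.le, ht.2⟩) ?_ (hc'.continuousAt hnhds)
    exact (hc'.mono Set.Ioo_subset_Ico_self).stronglyMeasurableAtFilter isOpen_Ioo t ht
  have hd2 : HasDerivAt (fun s => toC (v s)) (c' t) t := by
    refine hd.congr_of_eventuallyEq ?_
    filter_upwards [Ico_mem_nhds ht.1 ht.2] with s hs
    exact hint s hs
  exact (ContinuousMap.toLp 2 (volume : Measure (Torus d)) ℝ).hasFDerivAt.comp_hasDerivAt t hd2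

/-- The fundamental theorem of calculus for the `L²` product of two `C¹` fields. -/
lemma inner_contL2_sub_eq_integral {T : ℝ} {v φ : ℝ → Torus d → Vec d} (hv : IsCn 1 T v)
    (hφ : IsCn 1 T φ) {t : ℝ} (ht : t ∈ Set.Ico 0 T) :
    inner ℝ (contL2 (v t)) (contL2 (φ t)) - inner ℝ (contL2 (v 0)) (contL2 (φ 0)) =
      ∫ s in (0 : ℝ)..t,
        (inner ℝ (contL2 (v s)) (contL2 fun x => timeDeriv T (fun r => φ r x) s) +
          inner ℝ (contL2 fun x => timeDeriv T (fun r => v r x) s) (contL2 (φ s))) := by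
  have c1 := hv.continuousOn_contL2
  have c2 := hφ.continuousOn_contL2
  have c3 := EulerStat.continuousOn_contL2 hv.jointlyContinuous_timeDeriv
  have c4 := EulerStat.continuousOn_contL2 hφ.jointlyContinuous_timeDeriv
  refine (intervalIntegral.integral_eq_sub_of_hasDerivAt_of_le
    (f := fun t => inner ℝ (contL2 (v t)) (contL2 (φ t))) ht.1 ?_ ?_ ?_).symm
  · exact (c1.inner c2).mono (fun r hr => ⟨hr.1, hr.2.trans_lt ht.2⟩)
  · intro r hr
    have hr' : r ∈ Set.Ioo 0 T := ⟨hr.1, hr.2.trans ht.2⟩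
    exact (hv.hasDerivAt_contL2 hr').inner ℝ (hφ.hasDerivAt_contL2 hr')
  · exact intervalIntegrable_of_continuousOn_Ico ((c1.inner c4).add (c3.inner c2)) ht

/-! ### Classical solutions -/

lemma integrable_dot_opL2 {A : Torus d → Vec d →L[ℝ] Vec d} (hA : Continuous A) (u : L2 d)
    {f : Torus d → Vec d} (hf : Continuous f) :
    Integrable (fun x => dot (A x (u x)) (f x)) := by
  refine (L2.integrable_inner (𝕜 := ℝ) (opL2 (toC A) u) (contL2 f)).congr ?_
  filter_upwards [coeFn_opL2 (toC A) u, coeFn_contL2 hf] with x hx hx2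
  rw [hx, hx2, toC_apply hA, dot]

lemma inner_opL2_contL2 {A : Torus d → Vec d →L[ℝ] Vec d} (hA : Continuous A) (u : L2 d)
    {f : Torus d → Vec d} (hf : Continuous f) :
    inner ℝ (opL2 (toC A) u) (contL2 f) = ∫ x, dot (A x (u x)) (f x) := by
  rw [inner_opL2 hA]
  refine integral_congr_ae ?_
  filter_upwards [coeFn_contL2 hf] with x hx
  rw [hx]

/-- Transport by a divergence-free field is antisymmetric, since `w · ∇(a · b)` has integral
zero. -/
lemma IsDivFree.advection_antisymm {w : L2 d} (hw : IsDivFree w) {a b : Torus d → Vec d}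
    (ha : ContDiff ℝ 1 (fun y => a (toTorus y))) (hb : ContDiff ℝ 1 (fun y => b (toTorus y))) :
    inner ℝ (opL2 (toC (spaceDeriv a)) w) (contL2 b) +
      inner ℝ (opL2 (toC (spaceDeriv b)) w) (contL2 a) = 0 := by
  have hab : ContDiff ℝ 1 (fun y => (fun x => (inner ℝ (a x) (b x) : ℝ)) (toTorus y)) :=
    ha.inner ℝ hb
  have ha' := continuous_spaceDeriv ha
  have hb' := continuous_spaceDeriv hb
  have hac : Continuous a := continuous_of_lift ha.continuous
  have hbc : Continuous b := continuous_of_lift hb.continuous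
  rw [inner_opL2_contL2 ha' w hbc, inner_opL2_contL2 hb' w hac,
    ← integral_add (integrable_dot_opL2 ha' w hbc) (integrable_dot_opL2 hb' w hac),
    ← hw.inner_grad_eq_zero (ψ := fun x => (inner ℝ (a x) (b x) : ℝ)) hab,
    inner_contL2 _ (continuous_grad (f := fun x => (inner ℝ (a x) (b x) : ℝ)) hab)]
  refine integral_congr_ae (.of_forall fun x => ?_)
  change _ = dot (w x) (grad _ x)
  simp only [dot]
  rw [real_inner_comm (grad _ x), inner_grad]
  obtain ⟨y, rfl⟩ := surjective_toTorus x
  rw [spaceDeriv_eq_of_hasFDerivAt (f := fun x => (inner ℝ (a x) (b x) : ℝ))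
    ((hasFDerivAt_spaceDeriv ha y).inner ℝ (hasFDerivAt_spaceDeriv hb y))]
  simp [real_inner_comm, add_comm]

section Classical

variable {T : ℝ} {v : ℝ → Torus d → Vec d} {p : ℝ → Torus d → ℝ}

lemma IsClassicalSolution.isDivFree (h : IsClassicalSolution T v p) {t : ℝ}
    (ht : t ∈ Set.Ico 0 T) : IsDivFree (contL2 (v t)) :=
  isDivFree_contL2 (h.velocity_C1.contDiff_slice ht) (h.divFree t ht)

/-- The momentum equation as an identity in `L²`. -/
lemma IsClassicalSolution.contL2_timeDeriv (h : IsClassicalSolution T v p) {t : ℝ}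
    (ht : t ∈ Set.Ico 0 T) :
    contL2 (fun x => timeDeriv T (fun s => v s x) t) =
      -(opL2 (toC (spaceDeriv (v t))) (contL2 (v t)) + contL2 (grad (p t))) := by
  have c1 := h.velocity_C1.jointlyContinuous.slice ht
  have c2 := h.velocity_C1.jointlyContinuous_spaceDeriv.slice ht
  have c3 := continuous_grad (h.pressure_C1 t ht)
  have c4 : Continuous fun x => spaceDeriv (v t) x (v t x) := c2.clm_apply c1
  have h0 : (fun x => timeDeriv T (fun s => v s x) t) =
      fun x => (-1 : ℝ) • (spaceDeriv (v t) x (v t x) + grad (p t) x) := by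
    funext x
    have := h.momentum t ht x
    rw [neg_one_smul, eq_neg_iff_add_eq_zero, ← add_assoc]
    exact this
  have c5 : Continuous fun x => spaceDeriv (v t) x (v t x) + grad (p t) x := c4.add c3
  rw [h0, contL2_smul _ c5, contL2_add c4 c3, opL2_contL2 c2 c1, neg_one_smul]

/-- The relative energy identity: for a divergence-free field `u`, the rate prescribed by the Euler
equations for `∫ u · v` is quadratic in the distance of `u` to the classical solution `v`. -/
lemma IsClassicalSolution.rate_eq (h : IsClassicalSolution T v p) {t : ℝ}
    (ht : t ∈ Set.Ico 0 T) {u : L2 d} (hu : IsDivFree u) :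
    rate T v t u =
      inner ℝ (opL2 (toC (spaceDeriv (v t))) (u - contL2 (v t))) (u - contL2 (v t)) := by
  have h1 := (hu.sub (h.isDivFree ht)).advection_antisymm (h.velocity_C1.contDiff_slice ht)
    (h.velocity_C1.contDiff_slice ht)
  have h2 : inner ℝ (opL2 (toC (spaceDeriv (v t))) (u - contL2 (v t))) (contL2 (v t)) = 0 := by
    linarith
  have h3 := hu.inner_grad_eq_zero (h.pressure_C1 t ht)
  rw [rate, h.contL2_timeDeriv ht, inner_neg_right, inner_add_right, h3, inner_sub_right, h2,
    map_sub, inner_sub_left, real_inner_comm u (opL2 (toC (spaceDeriv (v t))) (contL2 (v t)))]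
  ring

lemma IsClassicalSolution.abs_rate_le (h : IsClassicalSolution T v p) {t : ℝ}
    (ht : t ∈ Set.Ico 0 T) {u : L2 d} (hu : IsDivFree u) {C : ℝ}
    (hC : ∀ x, ‖spaceDeriv (v t) x‖ ≤ C) :
    |rate T v t u| ≤ C * ‖u - contL2 (v t)‖ ^ 2 := by
  rw [h.rate_eq ht hu]
  refine abs_inner_opL2_le _ _ fun x => ?_
  rw [toC_apply (h.velocity_C1.jointlyContinuous_spaceDeriv.slice ht)]
  exact hC x

/-- For a divergence-free test field, the time derivative of a classical solution acts like its
flux. -/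
lemma IsClassicalSolution.inner_timeDeriv (h : IsClassicalSolution T v p) {t : ℝ}
    (ht : t ∈ Set.Ico 0 T) {w : Torus d → Vec d} (hw : ContDiff ℝ 1 (fun y => w (toTorus y)))
    (hdiv : ∀ x, divergence w x = 0) :
    inner ℝ (contL2 (fun x => timeDeriv T (fun s => v s x) t)) (contL2 w) =
      inner ℝ (opL2 (toC (spaceDeriv w)) (contL2 (v t))) (contL2 (v t)) := by
  have h1 := (h.isDivFree ht).advection_antisymm (h.velocity_C1.contDiff_slice ht) hw
  have h2 := (isDivFree_contL2 hw hdiv).inner_grad_eq_zero (h.pressure_C1 t ht)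
  rw [h.contL2_timeDeriv ht, inner_neg_left, inner_add_left,
    real_inner_comm (contL2 w) (contL2 (grad (p t))), h2]
  linarith

end Classical

/-- Weak solutions of the Euler equations that are continuous in time with values in `L²` and
conserve the energy. The weak formulation is tested with `C¹` fields on `[0, t]`. -/
structure IsWeakTrajectory (T : ℝ) (u : ℝ → L2 d) : Prop where
  continuousOn : ContinuousOn u (Set.Ico 0 T)
  isDivFree : ∀ t ∈ Set.Ico 0 T, IsDivFree (u t)
  energy : ∀ t ∈ Set.Ico 0 T, ‖u t‖ = ‖u 0‖
  weak : ∀ φ : ℝ → Torus d → Vec d, IsCn 1 T φ → (∀ t ∈ Set.Ico 0 T, ∀ x, divergence (φ t) x = 0) →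
    ∀ t ∈ Set.Ico 0 T, inner ℝ (u t) (contL2 (φ t)) - inner ℝ (u 0) (contL2 (φ 0)) =
      ∫ s in (0 : ℝ)..t, rate T φ s (u s)

/-- Classical solutions are weak trajectories; the conservation of energy is the antisymmetry of the
transport term. -/
lemma IsClassicalSolution.isWeakTrajectory {T : ℝ} {v : ℝ → Torus d → Vec d}
    {p : ℝ → Torus d → ℝ} (h : IsClassicalSolution T v p) :
    IsWeakTrajectory T (fun t => contL2 (v t)) where
  continuousOn := h.velocity_C1.continuousOn_contL2
  isDivFree t ht := h.isDivFree ht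
  energy t ht := by
    have h1 := inner_contL2_sub_eq_integral h.velocity_C1 h.velocity_C1 ht
    have h2 : ∀ s ∈ Set.uIcc 0 t,
        inner ℝ (contL2 (v s)) (contL2 fun x => timeDeriv T (fun r => v r x) s) +
          inner ℝ (contL2 fun x => timeDeriv T (fun r => v r x) s) (contL2 (v s)) = 0 := by
      intro s hs
      have hs' := uIcc_subset_Ico ht hs
      have h3 := h.inner_timeDeriv hs' (h.velocity_C1.contDiff_slice hs') (h.divFree s hs')
      have h4 := (h.isDivFree hs').advection_antisymm (h.velocity_C1.contDiff_slice hs')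
        (h.velocity_C1.contDiff_slice hs')
      rw [real_inner_comm, h3]
      exact h4
    rw [intervalIntegral.integral_congr h2, intervalIntegral.integral_zero,
      real_inner_self_eq_norm_sq, real_inner_self_eq_norm_sq, sub_eq_zero] at h1
    exact (pow_left_inj₀ (norm_nonneg _) (norm_nonneg _) two_ne_zero).1 h1
  weak φ hφ hdiv t ht := by
    rw [inner_contL2_sub_eq_integral h.velocity_C1 hφ ht]
    refine intervalIntegral.integral_congr fun s hs => ?_
    have hs' := uIcc_subset_Ico ht hs
    simp only [rate]
    rw [h.inner_timeDeriv hs' (hφ.contDiff_slice hs') (hdiv s hs')]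

/-! ### Grönwall's inequality -/

/-- Grönwall's inequality in integral form, for a function that is merely integrable. -/
lemma gronwall_integral {R : ℝ → ℝ} {R₀ K b : ℝ} (hK : 0 ≤ K) (hb : 0 ≤ b)
    (hint : IntervalIntegrable R volume 0 b)
    (h : ∀ᵐ t ∂(volume.restrict (Set.Icc 0 b)), R t ≤ R₀ + K * ∫ s in (0 : ℝ)..t, R s) :
    R₀ + K * ∫ s in (0 : ℝ)..b, R s ≤ R₀ * Real.exp (K * b) := by
  let J : ℝ → ℝ := fun t => R₀ + K * ∫ s in (0 : ℝ)..t, R s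
  have hJ : ContinuousOn J (Set.Icc 0 b) := by
    refine continuousOn_const.add (continuousOn_const.mul ?_)
    have := intervalIntegral.continuousOn_primitive_interval' hint (Set.left_mem_uIcc)
    rwa [Set.uIcc_of_le hb] at this
  -- `J` is continuous but need not be differentiable; its own primitive `M` is, it dominates `J`,
  -- and `exp (-K t) M` is antitone
  let M : ℝ → ℝ := fun t => R₀ + K * ∫ s in (0 : ℝ)..t, J s
  have hJi : ∀ t ∈ Set.Icc 0 b, IntervalIntegrable J volume 0 t := fun t ht => by
    refine ContinuousOn.intervalIntegrable ?_
    rw [Set.uIcc_of_le ht.1]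
    exact hJ.mono (Set.Icc_subset_Icc_right ht.2)
  have hJM : ∀ t ∈ Set.Icc 0 b, J t ≤ M t := by
    intro t ht
    refine add_le_add_right (mul_le_mul_of_nonneg_left ?_ hK) _
    refine intervalIntegral.integral_mono_ae_restrict ht.1 (hint.mono_set ?_) (hJi t ht) ?_
    · rw [Set.uIcc_of_le ht.1, Set.uIcc_of_le hb]
      exact Set.Icc_subset_Icc_right ht.2
    · exact ae_mono (Measure.restrict_mono (Set.Icc_subset_Icc_right ht.2) le_rfl) h
  have hMd : ∀ t ∈ Set.Ioo 0 b, HasDerivAt M (K * J t) t := by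
    intro t ht
    refine HasDerivAt.const_add _ (HasDerivAt.const_mul _ ?_)
    refine intervalIntegral.integral_hasDerivAt_right (hJi t ⟨ht.1.le, ht.2.le⟩) ?_
      (hJ.continuousAt (Icc_mem_nhds ht.1 ht.2))
    exact (hJ.mono Set.Ioo_subset_Icc_self).stronglyMeasurableAtFilter isOpen_Ioo t ht
  have hMc : ContinuousOn M (Set.Icc 0 b) := by
    refine continuousOn_const.add (continuousOn_const.mul ?_)
    have := intervalIntegral.continuousOn_primitive_interval' (hJi b ⟨hb, le_rfl⟩)
      (Set.left_mem_uIcc)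
    rwa [Set.uIcc_of_le hb] at this
  have hanti : AntitoneOn (fun t => Real.exp (-(K * t)) * M t) (Set.Icc 0 b) := by
    have hd : ∀ t ∈ Set.Ioo 0 b, HasDerivAt (fun t => Real.exp (-(K * t)) * M t)
        (Real.exp (-(K * t)) * (-K) * M t + Real.exp (-(K * t)) * (K * J t)) t := by
      intro t ht
      have h1 : HasDerivAt (fun t => -(K * t)) (-K) t := by
        simpa using ((hasDerivAt_id t).const_mul K).fun_neg
      exact h1.exp.mul (hMd t ht)
    refine antitoneOn_of_deriv_nonpos (convex_Icc 0 b) ?_ ?_ ?_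
    · exact ContinuousOn.mul (by fun_prop) hMc
    · rw [interior_Icc]
      exact fun t ht => (hd t ht).differentiableAt.differentiableWithinAt
    · rw [interior_Icc]
      intro t ht
      rw [(hd t ht).deriv]
      have h1 := hJM t ⟨ht.1.le, ht.2.le⟩
      have h2 := Real.exp_pos (-(K * t))
      have h3 : 0 ≤ K * (M t - J t) := mul_nonneg hK (sub_nonneg.2 h1)
      nlinarith
  have h1 := hanti ⟨le_rfl, hb⟩ ⟨hb, le_rfl⟩ hb
  have h2 : M 0 = R₀ := by simp [M]
  simp only [mul_zero, neg_zero, Real.exp_zero, one_mul, h2] at h1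
  have h3 := hJM b ⟨hb, le_rfl⟩
  have h4 : M b ≤ R₀ * Real.exp (K * b) := by
    rw [Real.exp_neg, inv_mul_le_iff₀ (Real.exp_pos _)] at h1
    linarith
  exact h3.trans h4

end

section

variable {d : ℕ}
lemma continuousOn_rate_curve {T : ℝ} {φ : ℝ → Torus d → Vec d} (hφ : IsCn 1 T φ) {u : ℝ → L2 d}
    (hu : ContinuousOn u (Set.Ico 0 T)) :
    ContinuousOn (fun s => rate T φ s (u s)) (Set.Ico 0 T) :=
  ContinuousOn.comp (g := fun p : ℝ × L2 d => rate T φ p.1 p.2) (f := fun s => (s, u s))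
    (continuousOn_rate hφ) (continuousOn_id.prodMk hu) fun _ hs => ⟨hs, trivial⟩

/-- Weak-strong stability: a weak trajectory stays close to a classical solution. -/
lemma IsWeakTrajectory.norm_sub_le {T : ℝ} {u : ℝ → L2 d} (hu : IsWeakTrajectory T u)
    {v : ℝ → Torus d → Vec d} {p : ℝ → Torus d → ℝ} (h : IsClassicalSolution T v p) {C : ℝ}
    (hC : ∀ t ∈ Set.Ico 0 T, ∀ x, ‖spaceDeriv (v t) x‖ ≤ C) {t : ℝ} (ht : t ∈ Set.Ico 0 T) :
    ‖u t - contL2 (v t)‖ ≤ Real.exp (C * t) * ‖u 0 - contL2 (v 0)‖ := by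
  have hw := h.isWeakTrajectory
  have h0 : (0 : ℝ) ∈ Set.Ico 0 T := ⟨le_rfl, ht.1.trans_lt ht.2⟩
  have hC0 : 0 ≤ C := (norm_nonneg _).trans (hC 0 h0 0)
  let R : ℝ → ℝ := fun s => ‖u s - contL2 (v s)‖ ^ 2
  have hR : ContinuousOn R (Set.Ico 0 T) := ((hu.continuousOn.sub hw.continuousOn).norm).pow 2
  have hrate : ContinuousOn (fun s => rate T v s (u s)) (Set.Ico 0 T) :=
    continuousOn_rate_curve h.velocity_C1 hu.continuousOn
  have key : ∀ s ∈ Set.Ico 0 T, R s ≤ R 0 + (2 * C) * ∫ r in (0 : ℝ)..s, R r := by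
    intro s hs
    have h1 := hu.weak v h.velocity_C1 h.divFree s hs
    -- expand the square: both energies are conserved, so only the mixed term changes
    have h2 : R s = R 0 - 2 * ∫ r in (0 : ℝ)..s, rate T v r (u r) := by
      rw [← h1]
      change ‖_‖ ^ 2 = ‖_‖ ^ 2 - _
      rw [norm_sub_sq_real, norm_sub_sq_real, hu.energy s hs, hw.energy s hs]
      ring
    have h3 : -(∫ r in (0 : ℝ)..s, rate T v r (u r)) ≤ C * ∫ r in (0 : ℝ)..s, R r := by
      rw [← intervalIntegral.integral_neg, ← intervalIntegral.integral_const_mul]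
      refine intervalIntegral.integral_mono_on hs.1
        (intervalIntegrable_of_continuousOn_Ico hrate hs).neg
        ((intervalIntegrable_of_continuousOn_Ico hR hs).const_mul C) fun r hr => ?_
      have hr' : r ∈ Set.Ico 0 T := ⟨hr.1, hr.2.trans_lt hs.2⟩
      exact (neg_le_abs _).trans (h.abs_rate_le hr' (hu.isDivFree r hr') (hC r hr'))
    rw [h2]
    linarith
  have h1 := gronwall_integral (R := R) (R₀ := R 0) (K := 2 * C) (b := t) (by positivity) ht.1
    (intervalIntegrable_of_continuousOn_Ico hR ht) (by
      refine (ae_restrict_iff' measurableSet_Icc).2 (.of_forall fun s hs => ?_)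
      exact key s ⟨hs.1, hs.2.trans_lt ht.2⟩)
  have h2 := (key t ht).trans h1
  refine (pow_le_pow_iff_left₀ (norm_nonneg _) (by positivity) two_ne_zero).1 ?_
  rw [mul_pow, ← Real.exp_nat_mul]
  refine h2.trans (le_of_eq ?_)
  rw [mul_comm]
  congr 2
  push_cast
  ring

end

section

variable {d : ℕ}

/-! ### The flow on generic data -/

lemma isOpen_genericSetAt (d : ℕ) (T : ℝ) (n : ℕ) : IsOpen (genericSetAt d T n) := by
  have h : genericSetAt d T n = ⋃ (vbar : L2 d) (C : ℝ) (_ : IsClassicalDatum T vbar C),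
      Metric.ball vbar (1 / (n : ℝ) * Real.exp (-(C * T))) := by
    ext u
    simp [genericSetAt, dist_eq_norm]
  rw [h]
  exact isOpen_iUnion fun _ => isOpen_iUnion fun _ => isOpen_iUnion fun _ => Metric.isOpen_ball

lemma measurableSet_genericSet (d : ℕ) (T : ℝ) : MeasurableSet (genericSet d T) := by
  have h : genericSet d T = ⋂ (n : ℕ) (_ : 1 ≤ n), genericSetAt d T n := by
    ext u; simp [genericSet]
  rw [h]
  exact .iInter fun n => .iInter fun _ => (isOpen_genericSetAt d T n).measurableSet

/-- A classical solution whose velocity gradient is bounded by `C`. -/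
structure IsLipschitzSolution (T : ℝ) (v : ℝ → Torus d → Vec d) (C : ℝ) : Prop where
  classical : ∃ p, IsClassicalSolution T v p
  bound : ∀ t ∈ Set.Ico 0 T, ∀ x, ‖spaceDeriv (v t) x‖ ≤ C

lemma IsLipschitzSolution.nonneg {T : ℝ} (hT : 0 < T) {v : ℝ → Torus d → Vec d} {C : ℝ}
    (h : IsLipschitzSolution T v C) : 0 ≤ C :=
  (norm_nonneg _).trans (h.bound 0 ⟨le_rfl, hT⟩ 0)

lemma exists_lipschitzSolution_near {T : ℝ} (hT : 0 < T) {u : L2 d} (hu : u ∈ genericSet d T)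
    (n : ℕ) : ∃ v C, IsLipschitzSolution T v C ∧
      ‖u - contL2 (v 0)‖ < 1 / ((n : ℝ) + 1) * Real.exp (-(C * T)) := by
  obtain ⟨vbar, C, ⟨v, p, hv, hv0, hC⟩, hn⟩ := hu (n + 1) (by omega)
  have h0 : (0 : ℝ) ∈ Set.Ico 0 T := ⟨le_rfl, hT⟩
  refine ⟨v, C, ⟨⟨p, hv⟩, fun t ht x => hC.1 ⟨t, ht, x, rfl⟩⟩, ?_⟩
  rw [eq_contL2 (hv.velocity_C1.jointlyContinuous.slice h0) hv0] at hn
  exact_mod_cast hn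

lemma IsWeakTrajectory.norm_sub_le_exp {T : ℝ} {u : ℝ → L2 d} (hu : IsWeakTrajectory T u)
    {v : ℝ → Torus d → Vec d} {C : ℝ} (h : IsLipschitzSolution T v C) {t : ℝ}
    (ht : t ∈ Set.Ico 0 T) :
    ‖u t - contL2 (v t)‖ ≤ Real.exp (C * T) * ‖u 0 - contL2 (v 0)‖ := by
  obtain ⟨p, hp⟩ := h.classical
  have hC := h.nonneg (ht.1.trans_lt ht.2)
  refine (hu.norm_sub_le hp h.bound ht).trans (mul_le_mul_of_nonneg_right ?_ (norm_nonneg _))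
  exact Real.exp_le_exp.2 (mul_le_mul_of_nonneg_left ht.2.le hC)

lemma IsLipschitzSolution.isWeakTrajectory {T : ℝ} {v : ℝ → Torus d → Vec d} {C : ℝ}
    (h : IsLipschitzSolution T v C) : IsWeakTrajectory T (fun t => contL2 (v t)) :=
  h.classical.choose_spec.isWeakTrajectory

/-- Two classical solutions issued from points close to the same datum, measured by the worst
stability constant of each, stay close on all of `[0, T)`. -/
lemma IsLipschitzSolution.norm_sub_le {T : ℝ} {u : L2 d} {v w : ℝ → Torus d → Vec d} {C C' a b : ℝ}
    (hv : IsLipschitzSolution T v C) (hw : IsLipschitzSolution T w C')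
    (ha : ‖u - contL2 (v 0)‖ < a * Real.exp (-(C * T)))
    (hb : ‖u - contL2 (w 0)‖ < b * Real.exp (-(C' * T))) {t : ℝ} (ht : t ∈ Set.Ico 0 T) :
    ‖contL2 (v t) - contL2 (w t)‖ ≤ a + b := by
  have hTpos : 0 < T := ht.1.trans_lt ht.2
  have hab : ‖contL2 (v 0) - contL2 (w 0)‖ ≤
      a * Real.exp (-(C * T)) + b * Real.exp (-(C' * T)) := by
    have := norm_sub_le_norm_sub_add_norm_sub (contL2 (v 0)) u (contL2 (w 0))
    rw [norm_sub_rev (contL2 (v 0)) u] at this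
    linarith
  have ha0 : 0 ≤ a := by
    have := (norm_nonneg _).trans ha.le
    exact nonneg_of_mul_nonneg_left this (Real.exp_pos _)
  have hb0 : 0 ≤ b := by
    have := (norm_nonneg _).trans hb.le
    exact nonneg_of_mul_nonneg_left this (Real.exp_pos _)
  -- apply stability with the smaller of the two constants, which both weights compensate
  have hexp : ∀ x y : ℝ, x ≤ y → Real.exp (x * T) * Real.exp (-(y * T)) ≤ 1 := fun x y h => by
    rw [← Real.exp_add, Real.exp_le_one_iff]
    nlinarith
  rcases le_total C C' with hCC | hCC
  · have h1 := hw.isWeakTrajectory.norm_sub_le_exp hv ht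
    rw [norm_sub_rev, norm_sub_rev (contL2 (w 0))] at h1
    refine h1.trans ((mul_le_mul_of_nonneg_left hab (Real.exp_pos _).le).trans ?_)
    nlinarith [hexp C C le_rfl, hexp C C' hCC]
  · have h1 := hv.isWeakTrajectory.norm_sub_le_exp hw ht
    refine h1.trans ((mul_le_mul_of_nonneg_left hab (Real.exp_pos _).le).trans ?_)
    nlinarith [hexp C' C' le_rfl, hexp C' C hCC]

/-- A bound on the rate that is uniform on compact time intervals. -/
lemma exists_rate_bound {T : ℝ} {φ : ℝ → Torus d → Vec d} (hφ : IsCn 1 T φ) {b : ℝ}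
    (hb : b < T) : ∃ K, 0 ≤ K ∧ ∀ s ∈ Set.Icc 0 b, ∀ u : L2 d,
      |rate T φ s u| ≤ K * (‖u‖ + ‖u‖ ^ 2) := by
  have hsub : Set.Icc 0 b ⊆ Set.Ico 0 T := fun s hs => ⟨hs.1, hs.2.trans_lt hb⟩
  obtain ⟨K₁, hK₁⟩ := (isCompact_Icc (a := 0) (b := b)).exists_bound_of_continuousOn
    ((continuousOn_contL2 hφ.jointlyContinuous_timeDeriv).mono hsub)
  obtain ⟨K₂, hK₂⟩ := (isCompact_Icc (a := 0) (b := b)).exists_bound_of_continuousOn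
    (hφ.jointlyContinuous_spaceDeriv.continuousOn_toC.mono hsub)
  refine ⟨max 0 (max K₁ K₂), le_max_left _ _, fun s hs u => ?_⟩
  have h1 := (hK₁ s hs).trans ((le_max_left K₁ K₂).trans (le_max_right 0 _))
  have h2 := (hK₂ s hs).trans ((le_max_right K₁ K₂).trans (le_max_right 0 _))
  rw [mul_add]
  refine (abs_add_le _ _).trans (add_le_add ?_ ?_)
  · refine (abs_real_inner_le_norm _ _).trans ?_
    rw [mul_comm]
    exact mul_le_mul_of_nonneg_right h1 (norm_nonneg _)
  · exact abs_inner_opL2_le _ _ fun x => ((toC (spaceDeriv (φ s))).norm_coe_le_norm x).trans h2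

/-- A generic datum is the initial value of a weak trajectory, the uniform limit of classical
solutions. -/
lemma exists_isWeakTrajectory {T : ℝ} (hT : 0 < T) {ubar : L2 d} (hu : ubar ∈ genericSet d T) :
    ∃ u : ℝ → L2 d, IsWeakTrajectory T u ∧ u 0 = ubar := by
  -- the classical solutions issued from data `1 / (n + 1)`-close form a uniform Cauchy sequence
  choose v C hv hvu using exists_lipschitzSolution_near hT hu
  let V : ℕ → ℝ → L2 d := fun n t => contL2 (v n t)
  have hV : ∀ n, IsWeakTrajectory T (V n) := fun n => (hv n).isWeakTrajectory
  have h0 : (0 : ℝ) ∈ Set.Ico 0 T := ⟨le_rfl, hT⟩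
  have hdist : ∀ n m, ∀ t ∈ Set.Ico 0 T, ‖V n t - V m t‖ ≤ 1 / ((n : ℝ) + 1) + 1 / ((m : ℝ) + 1) :=
    fun n m t ht => (hv n).norm_sub_le (hv m) (hvu n) (hvu m) ht
  have hlim0 : Tendsto (fun n : ℕ => 1 / ((n : ℝ) + 1)) atTop (𝓝 0) :=
    tendsto_one_div_add_atTop_nhds_zero_nat
  have hex : ∀ t, ∃ y, t ∈ Set.Ico 0 T → Tendsto (fun n => V n t) atTop (𝓝 y) := by
    intro t
    by_cases ht : t ∈ Set.Ico 0 T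
    · have hc : CauchySeq fun n => V n t := by
        refine Metric.cauchySeq_iff'.2 fun ε hε => ?_
        obtain ⟨N, hN⟩ := exists_nat_one_div_lt (half_pos hε)
        refine ⟨N, fun n hn => ?_⟩
        rw [dist_eq_norm]
        refine (hdist n N t ht).trans_lt ?_
        have : 1 / ((n : ℝ) + 1) ≤ 1 / ((N : ℝ) + 1) := by gcongr
        linarith
      obtain ⟨y, hy⟩ := cauchySeq_tendsto_of_complete hc
      exact ⟨y, fun _ => hy⟩
    · exact ⟨0, fun h => absurd h ht⟩
  choose u hlim using hex
  have hunif : ∀ n, ∀ t ∈ Set.Ico 0 T, ‖V n t - u t‖ ≤ 1 / ((n : ℝ) + 1) := by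
    intro n t ht
    have h1 : Tendsto (fun m => ‖V n t - V m t‖) atTop (𝓝 ‖V n t - u t‖) :=
      (tendsto_const_nhds.sub (hlim t ht)).norm
    have h2 : Tendsto (fun m : ℕ => 1 / ((n : ℝ) + 1) + 1 / ((m : ℝ) + 1)) atTop
        (𝓝 (1 / ((n : ℝ) + 1) + 0)) := tendsto_const_nhds.add hlim0
    rw [add_zero] at h2
    exact le_of_tendsto_of_tendsto' h1 h2 fun m => hdist n m t ht
  have hu0 : u 0 = ubar := by
    refine tendsto_nhds_unique (hlim 0 h0) ?_
    rw [tendsto_iff_norm_sub_tendsto_zero]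
    refine squeeze_zero (fun _ => norm_nonneg _) (fun n => ?_) hlim0
    rw [norm_sub_rev]
    refine (hvu n).le.trans (mul_le_of_le_one_right (by positivity) ?_)
    rw [Real.exp_le_one_iff]
    have := mul_nonneg ((hv n).nonneg hT) hT.le
    linarith
  have hcont : ContinuousOn u (Set.Ico 0 T) := by
    have htu : TendstoUniformlyOn V u atTop (Set.Ico 0 T) := by
      rw [Metric.tendstoUniformlyOn_iff]
      intro ε hε
      filter_upwards [hlim0.eventually (gt_mem_nhds hε)] with n hn t ht
      rw [dist_comm, dist_eq_norm]
      exact (hunif n t ht).trans_lt hn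
    exact htu.continuousOn (.of_forall fun n => (hV n).continuousOn)
  refine ⟨u, ⟨hcont, fun t ht => ?_, fun t ht => ?_, fun φ hφ hdiv t ht => ?_⟩, hu0⟩
  · exact isClosed_isDivFree.mem_of_tendsto (hlim t ht) (.of_forall fun n => (hV n).isDivFree t ht)
  · refine tendsto_nhds_unique (hlim t ht).norm ?_
    exact (hlim 0 h0).norm.congr fun n => ((hV n).energy t ht).symm
  · have h1 : Tendsto (fun n => inner ℝ (V n t) (contL2 (φ t)) - inner ℝ (V n 0) (contL2 (φ 0)))
        atTop (𝓝 (inner ℝ (u t) (contL2 (φ t)) - inner ℝ (u 0) (contL2 (φ 0)))) :=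
      ((hlim t ht).inner tendsto_const_nhds).sub ((hlim 0 h0).inner tendsto_const_nhds)
    refine tendsto_nhds_unique h1 ?_
    have h2 : ∀ n, inner ℝ (V n t) (contL2 (φ t)) - inner ℝ (V n 0) (contL2 (φ 0)) =
        ∫ s in (0 : ℝ)..t, rate T φ s (V n s) := fun n => (hV n).weak φ hφ hdiv t ht
    simp only [h2]
    obtain ⟨K, hK0, hK⟩ := exists_rate_bound hφ ht.2
    have hVn : ∀ n, ∀ s ∈ Set.Ico 0 T, ‖V n s‖ ≤ ‖ubar‖ + 1 := by
      intro n s hs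
      have e1 := hunif n 0 h0
      have e2 : 1 / ((n : ℝ) + 1) ≤ 1 := by
        rw [div_le_one (by positivity)]
        linarith [n.cast_nonneg (α := ℝ)]
      rw [(hV n).energy s hs, ← hu0]
      linarith [norm_sub_norm_le (V n 0) (u 0)]
    refine intervalIntegral.tendsto_integral_filter_of_dominated_convergence
      (fun _ => K * ((‖ubar‖ + 1) + (‖ubar‖ + 1) ^ 2)) ?_ ?_ intervalIntegrable_const ?_
    · refine .of_forall fun n => ?_
      have := (continuousOn_rate_curve hφ (hV n).continuousOn).mono (uIcc_subset_Ico ht)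
      exact (this.mono Set.uIoc_subset_uIcc).aestronglyMeasurable measurableSet_uIoc
    · refine .of_forall fun n => .of_forall fun s hs => ?_
      rw [Set.uIoc_of_le ht.1] at hs
      refine (hK s ⟨hs.1.le, hs.2⟩ _).trans (mul_le_mul_of_nonneg_left ?_ hK0)
      have := hVn n s ⟨hs.1.le, hs.2.trans_lt ht.2⟩
      gcongr
    · refine .of_forall fun s hs => ?_
      have hs' := uIcc_subset_Ico ht (Set.uIoc_subset_uIcc hs)
      have hc : Continuous fun w : L2 d => rate T φ s w := by
        rw [← continuousOn_univ]
        exact ContinuousOn.comp (g := fun p : ℝ × L2 d => rate T φ p.1 p.2) (f := fun w => (s, w))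
          (continuousOn_rate hφ) (by fun_prop) fun _ _ => ⟨hs', trivial⟩
      exact (hc.tendsto (u s)).comp (hlim s hs')

/-- The flow of the Euler equations on generic data, extended by the identity to other data and
other times. -/
def flow (T t : ℝ) (ubar : L2 d) : L2 d :=
  open Classical in
  if h : ∃ u : ℝ → L2 d, ubar ∈ genericSet d T ∧ t ∈ Set.Ico 0 T ∧ IsWeakTrajectory T u ∧ u 0 = ubar
    then h.choose t else ubar

/-- The weight `exp (-C T)` in the definition of the generic set exactly compensates the growth in
weak-strong stability. -/
lemma IsWeakTrajectory.norm_sub_le_of_near {T : ℝ} {u : ℝ → L2 d} (hu : IsWeakTrajectory T u)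
    {v : ℝ → Torus d → Vec d} {C a : ℝ} (hv : IsLipschitzSolution T v C)
    (h : ‖u 0 - contL2 (v 0)‖ < a * Real.exp (-(C * T))) {t : ℝ} (ht : t ∈ Set.Ico 0 T) :
    ‖u t - contL2 (v t)‖ ≤ a := by
  refine (hu.norm_sub_le_exp hv ht).trans
    ((mul_le_mul_of_nonneg_left h.le (Real.exp_pos _).le).trans (le_of_eq ?_))
  rw [mul_left_comm, ← Real.exp_add, add_neg_cancel, Real.exp_zero, mul_one]

/-- Weak trajectories with generic initial value are unique. -/
lemma IsWeakTrajectory.eq_of_generic {T : ℝ} {u w : ℝ → L2 d} (hu : IsWeakTrajectory T u)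
    (hw : IsWeakTrajectory T w) (h : u 0 = w 0) (hg : u 0 ∈ genericSet d T) {t : ℝ}
    (ht : t ∈ Set.Ico 0 T) : u t = w t := by
  have hT : 0 < T := ht.1.trans_lt ht.2
  rw [← sub_eq_zero, ← norm_le_zero_iff]
  refine le_of_forall_pos_le_add fun ε hε => ?_
  obtain ⟨n, hn⟩ := exists_nat_one_div_lt (half_pos hε)
  obtain ⟨v, C, hv, hvu⟩ := exists_lipschitzSolution_near hT hg n
  have h1 := hu.norm_sub_le_of_near hv hvu ht
  have h2 := hw.norm_sub_le_of_near hv (h ▸ hvu) ht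
  have h3 := norm_sub_le_norm_sub_add_norm_sub (u t) (contL2 (v t)) (w t)
  rw [norm_sub_rev (contL2 (v t))] at h3
  linarith

lemma flow_of_notMem {T t : ℝ} {ubar : L2 d} (h : ubar ∉ genericSet d T) :
    flow T t ubar = ubar := by
  rw [flow, dif_neg]
  rintro ⟨u, h1, -⟩
  exact h h1

/-- The trajectory chosen in the definition of `flow` depends on `t` a priori; by uniqueness it does
not, and the flow follows one weak trajectory. -/
lemma isWeakTrajectory_flow {T : ℝ} (hT : 0 < T) {ubar : L2 d} (hu : ubar ∈ genericSet d T) :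
    IsWeakTrajectory T (fun t => flow T t ubar) ∧ flow T 0 ubar = ubar := by
  obtain ⟨u, hw, hu0⟩ := exists_isWeakTrajectory hT hu
  have key : ∀ t ∈ Set.Ico 0 T, flow T t ubar = u t := by
    intro t ht
    have hex : ∃ u : ℝ → L2 d, ubar ∈ genericSet d T ∧ t ∈ Set.Ico 0 T ∧ IsWeakTrajectory T u ∧
      u 0 = ubar := ⟨u, hu, ht, hw, hu0⟩
    rw [flow, dif_pos hex]
    obtain ⟨-, -, h1, h2⟩ := hex.choose_spec
    exact h1.eq_of_generic hw (h2.trans hu0.symm) (h2.symm ▸ hu) ht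
  have h0 : (0 : ℝ) ∈ Set.Ico 0 T := ⟨le_rfl, hT⟩
  refine ⟨⟨hw.continuousOn.congr key, ?_, ?_, ?_⟩, (key 0 h0).trans hu0⟩
  · intro t ht
    rw [key t ht]
    exact hw.isDivFree t ht
  · intro t ht
    rw [key t ht, key 0 h0]
    exact hw.energy t ht
  · intro φ hφ hdiv t ht
    rw [key t ht, key 0 h0, hw.weak φ hφ hdiv t ht]
    refine intervalIntegral.integral_congr fun s hs => ?_
    rw [key s (uIcc_subset_Ico ht hs)]

/-- The flow is jointly continuous on generic data: near a datum, all trajectories stay close to one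
classical solution. -/
lemma continuousOn_flow (d : ℕ) (T : ℝ) :
    ContinuousOn (fun p : ℝ × L2 d => flow T p.1 p.2) (Set.Ico 0 T ×ˢ genericSet d T) := by
  rintro ⟨t, u⟩ ⟨ht, hu⟩
  change t ∈ Set.Ico 0 T at ht
  change u ∈ genericSet d T at hu
  have hT : 0 < T := ht.1.trans_lt ht.2
  obtain ⟨htraj, h0⟩ := isWeakTrajectory_flow hT hu
  rw [ContinuousWithinAt, Metric.tendsto_nhds]
  intro ε hε
  obtain ⟨n, hn⟩ := exists_nat_one_div_lt (show 0 < ε / 4 by linarith)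
  obtain ⟨v, C, hv, hvu⟩ := exists_lipschitzSolution_near hT hu n
  have hc : ∀ᶠ s in 𝓝[Set.Ico 0 T] t, ‖flow T s u - flow T t u‖ < ε / 4 := by
    have := Metric.tendsto_nhds.1 (htraj.continuousOn t ht) (ε / 4) (by linarith)
    simpa only [dist_eq_norm] using this
  have hnear : ∀ᶠ w in 𝓝 u, ‖w - contL2 (v 0)‖ < 1 / ((n : ℝ) + 1) * Real.exp (-(C * T)) := by
    have hcont : Continuous fun w : L2 d => ‖w - contL2 (v 0)‖ := by fun_prop
    exact hcont.continuousAt.eventually (gt_mem_nhds hvu)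
  have hfst : Tendsto Prod.fst (𝓝[Set.Ico 0 T ×ˢ genericSet d T] (t, u)) (𝓝[Set.Ico 0 T] t) :=
    tendsto_nhdsWithin_iff.2 ⟨(continuous_fst.tendsto _).mono_left nhdsWithin_le_nhds,
      eventually_nhdsWithin_of_forall fun p hp => hp.1⟩
  have hsnd : Tendsto Prod.snd (𝓝[Set.Ico 0 T ×ˢ genericSet d T] (t, u)) (𝓝 u) :=
    (continuous_snd.tendsto _).mono_left nhdsWithin_le_nhds
  filter_upwards [hfst.eventually hc, hsnd.eventually hnear, self_mem_nhdsWithin]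
  rintro ⟨s, w⟩ h1 h2 ⟨hs, hw⟩
  simp only at h1 h2 hs hw
  obtain ⟨hwt, hw0⟩ := isWeakTrajectory_flow hT hw
  have e1 := hwt.norm_sub_le_of_near hv (by simpa only [hw0] using h2) hs
  have e2 := htraj.norm_sub_le_of_near hv (by simpa only [h0] using hvu) hs
  change dist (flow T s w) (flow T t u) < ε
  rw [dist_eq_norm]
  have e3 := norm_sub_le_norm_sub_add_norm_sub (flow T s w) (contL2 (v s)) (flow T t u)
  have e4 := norm_sub_le_norm_sub_add_norm_sub (contL2 (v s)) (flow T s u) (flow T t u)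
  rw [norm_sub_rev (contL2 (v s)) (flow T s u)] at e4
  linarith

lemma measurable_flow (T : ℝ) (t : ℝ) : Measurable (flow T t : L2 d → L2 d) := by
  by_cases ht : t ∈ Set.Ico 0 T
  · classical
    have h1 : (flow T t : L2 d → L2 d) =
        (genericSet d T).piecewise (flow T t) (fun u => u) := by
      funext u
      by_cases hu : u ∈ genericSet d T
      · rw [Set.piecewise_eq_of_mem _ _ _ hu]
      · rw [Set.piecewise_eq_of_notMem _ _ _ hu, flow_of_notMem hu]
    rw [h1]
    refine ContinuousOn.measurable_piecewise ?_ continuousOn_id (measurableSet_genericSet d T)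
    exact ContinuousOn.comp (g := fun p : ℝ × L2 d => flow T p.1 p.2) (f := fun u => (t, u))
      (continuousOn_flow d T) (by fun_prop) fun u hu => ⟨ht, hu⟩
  · have : (flow T t : L2 d → L2 d) = id := by
      funext u
      rw [flow, dif_neg]
      · rfl
      · rintro ⟨u, -, h, -⟩
        exact ht h
    rw [this]
    exact measurable_id

/-- The instance for `Lp` spaces takes `2 ≠ ∞` as a `Fact`. -/
instance secondCountable_L2 : SecondCountableTopology (L2 d) := by
  have : Fact ((2 : ℝ≥0∞) ≠ ⊤) := ⟨by simp⟩
  infer_instance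

end

section

variable {d : ℕ}

/-! ### Weak-* measurable families as kernels -/

/-- Indicators of closed sets are decreasing limits of bounded continuous functions. -/
lemma IsWeakStarMeasurable.aemeasurable_measure {T : ℝ} {m : ℝ → ProbabilityMeasure (L2 d)}
    (hm : IsWeakStarMeasurable T m) {K : Set (L2 d)} (hK : IsClosed K) :
    AEMeasurable (fun t => (m t : Measure (L2 d)) K) (volume.restrict (Set.Ico 0 T)) := by
  refine aemeasurable_of_tendsto_metrizable_ae' (f := fun (n : ℕ) t =>
    ∫⁻ u, hK.apprSeq n u ∂(m t : Measure (L2 d))) (fun n => ?_)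
    (.of_forall fun t => HasOuterApproxClosed.tendsto_lintegral_apprSeq hK _)
  let g : BoundedContinuousFunction (L2 d) ℝ :=
    BoundedContinuousFunction.comp _
      (isometry_subtype_coe.lipschitz : LipschitzWith 1 ((↑) : ℝ≥0 → ℝ)) (hK.apprSeq n)
  have h := (hm g).ennreal_ofReal
  refine h.congr (.of_forall fun t => ?_)
  have h1 := BoundedContinuousFunction.toReal_lintegral_coe_eq_integral (hK.apprSeq n)
    (m t : Measure (L2 d))
  simp only
  rw [show (∫ u, g u ∂(m t : Measure (L2 d))) = ∫ u, ((hK.apprSeq n u : ℝ≥0) : ℝ)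
    ∂(m t : Measure (L2 d)) from rfl, ← h1, ENNReal.ofReal_toReal]
  exact ((hK.apprSeq n).lintegral_lt_top_of_nnreal _).ne

/-- A weak-* measurable family of probability measures agrees for almost all times with a
Markov kernel. -/
lemma IsWeakStarMeasurable.exists_kernel {T : ℝ} {m : ℝ → ProbabilityMeasure (L2 d)}
    (hm : IsWeakStarMeasurable T m) : ∃ κ : Kernel ℝ (L2 d), IsMarkovKernel κ ∧
      ∀ᵐ t ∂(volume.restrict (Set.Ico 0 T)), κ t = m t := by
  classical
  let B : Set (Set (L2 d)) := TopologicalSpace.countableBasis (L2 d)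
  have hB : B.Countable := TopologicalSpace.countable_countableBasis _
  have hBb : TopologicalSpace.IsTopologicalBasis B := TopologicalSpace.isBasis_countableBasis _
  -- complements of finite unions of basic open sets form a countable π-system of closed sets
  let 𝒦 : Set (Set (L2 d)) := (fun S : Set (Set (L2 d)) => (⋃₀ S)ᶜ) '' {S | S.Finite ∧ S ⊆ B}
  have h𝒦c : 𝒦.Countable := (Set.countable_ofPred_finite_subset hB).image _
  have h𝒦cl : ∀ K ∈ 𝒦, IsClosed K := by
    rintro _ ⟨S, ⟨-, hS⟩, rfl⟩
    exact (isOpen_sUnion fun s hs => hBb.isOpen (hS hs)).isClosed_compl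
  have hpi : IsPiSystem 𝒦 := by
    rintro _ ⟨S, ⟨hSf, hS⟩, rfl⟩ _ ⟨S', ⟨hSf', hS'⟩, rfl⟩ -
    refine ⟨S ∪ S', ⟨hSf.union hSf', Set.union_subset hS hS'⟩, ?_⟩
    simp only [Set.sUnion_union, Set.compl_union]
  have hgen : measurableSpaceL2 d = MeasurableSpace.generateFrom 𝒦 := by
    apply le_antisymm
    · change borel (L2 d) ≤ _
      rw [hBb.borel_eq_generateFrom]
      refine MeasurableSpace.generateFrom_le fun U hU => ?_
      have : MeasurableSet[MeasurableSpace.generateFrom 𝒦] Uᶜ :=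
        MeasurableSpace.measurableSet_generateFrom
          ⟨{U}, ⟨Set.finite_singleton U, by simpa⟩, by simp⟩
      exact MeasurableSet.compl_iff.1 this
    · exact MeasurableSpace.generateFrom_le fun K hK => (h𝒦cl K hK).measurableSet
  have hae : ∀ K : 𝒦, AEMeasurable (fun t => (m t : Measure (L2 d)) K)
      (volume.restrict (Set.Ico 0 T)) := fun K => hm.aemeasurable_measure (h𝒦cl K K.2)
  have : Countable 𝒦 := h𝒦c
  have hall : ∀ᵐ t ∂(volume.restrict (Set.Ico 0 T)), ∀ K : 𝒦,
      (m t : Measure (L2 d)) K = (hae K).mk _ t := ae_all_iff.2 fun K => (hae K).ae_eq_mk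
  -- outside of `A` the family is replaced by a constant
  obtain ⟨A, hA, hAm, hAall⟩ := hall.exists_measurable_mem
  let κ₀ : ℝ → Measure (L2 d) := fun t => if t ∈ A then m t else m 0
  have hprob : ∀ t, IsProbabilityMeasure (κ₀ t) := by
    intro t
    by_cases ht : t ∈ A
    · simp only [κ₀, ht, if_true]; infer_instance
    · simp only [κ₀, ht, if_false]; infer_instance
  have hmeas : Measurable κ₀ := by
    refine Measurable.measure_of_isPiSystem_of_isProbabilityMeasure hgen hpi fun K hK => ?_
    have : (fun t => κ₀ t K) = fun t => if t ∈ A then (hae ⟨K, hK⟩).mk _ t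
        else (m 0 : Measure (L2 d)) K := by
      funext t
      by_cases ht : t ∈ A
      · simp only [κ₀, ht, if_true]
        exact hAall t ht ⟨K, hK⟩
      · simp only [κ₀, ht, if_false]
    rw [this]
    exact Measurable.ite hAm (hae ⟨K, hK⟩).measurable_mk measurable_const
  refine ⟨⟨κ₀, hmeas⟩, ⟨hprob⟩, ?_⟩
  filter_upwards [hA] with t ht
  change κ₀ t = m t
  simp only [κ₀, ht, if_true]

lemma measurable_indicator_of_continuousOn {T : ℝ} {f : ℝ → L2 d → ℝ}
    (hf : ContinuousOn (fun p : ℝ × L2 d => f p.1 p.2) (Set.Ico 0 T ×ˢ Set.univ)) :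
    Measurable ((Set.Ico 0 T ×ˢ (Set.univ : Set (L2 d))).indicator fun p => f p.1 p.2) := by
  classical
  rw [← Set.piecewise_eq_indicator]
  exact hf.measurable_piecewise continuousOn_const (measurableSet_Ico.prod .univ)

lemma aestronglyMeasurable_integral_kernel {T : ℝ} {f : ℝ → L2 d → ℝ}
    (hf : ContinuousOn (fun p : ℝ × L2 d => f p.1 p.2) (Set.Ico 0 T ×ˢ Set.univ))
    (κ : Kernel ℝ (L2 d)) [IsMarkovKernel κ] :
    AEStronglyMeasurable (fun t => ∫ u, f t u ∂(κ t)) (volume.restrict (Set.Ico 0 T)) := by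
  have h := (measurable_indicator_of_continuousOn hf).stronglyMeasurable
  have h2 := (h.integral_kernel_prod_right' (κ := κ)).aestronglyMeasurable
    (μ := volume.restrict (Set.Ico 0 T))
  refine h2.congr ((ae_restrict_iff' measurableSet_Ico).2 (.of_forall fun t ht => ?_))
  refine integral_congr_ae (.of_forall fun u => ?_)
  simp only
  rw [Set.indicator_of_mem]
  exact ⟨ht, trivial⟩

/-! ### A lemma of du Bois-Reymond -/

lemma setIntegral_Ico_eq_intervalIntegral {E : Type*} [NormedAddCommGroup E] [NormedSpace ℝ E]
    {T : ℝ} (hT : 0 ≤ T) (f : ℝ → E) :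
    ∫ t in Set.Ico 0 T, f t = ∫ t in (0 : ℝ)..T, f t := by
  rw [intervalIntegral.integral_of_le hT, integral_Ico_eq_integral_Ioo,
    integral_Ioc_eq_integral_Ioo]

/-- A function `G` on `[0, T)` with weak derivative `H` and weak initial value `G₀` is almost
everywhere the primitive of `H` with this initial value. -/
lemma ae_eq_add_integral_of_weak_deriv {T G₀ : ℝ} (hT : 0 < T) {G H : ℝ → ℝ}
    (hG : IntegrableOn G (Set.Ico 0 T)) (hH : IntegrableOn H (Set.Ico 0 T))
    (h : ∀ χ : ℝ → ℝ, ContDiff ℝ ∞ χ → ∀ T', 0 ≤ T' → T' < T → (∀ t, T' ≤ t → χ t = 0) →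
      ∫ t in Set.Ico 0 T, (χ t * H t + deriv χ t * G t) = -(χ 0 * G₀)) :
    ∀ᵐ t ∂(volume.restrict (Set.Ico 0 T)), G t = G₀ + ∫ s in (0 : ℝ)..t, H s := by
  have hHi : IntervalIntegrable H volume 0 T := by
    rw [intervalIntegrable_iff_integrableOn_Ioc_of_le hT.le, integrableOn_Ioc_iff_integrableOn_Ioo,
      ← integrableOn_Ico_iff_integrableOn_Ioo]
    exact hH
  have hGi : IntervalIntegrable G volume 0 T := by
    rw [intervalIntegrable_iff_integrableOn_Ioc_of_le hT.le, integrableOn_Ioc_iff_integrableOn_Ioo,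
      ← integrableOn_Ico_iff_integrableOn_Ioo]
    exact hG
  let K : ℝ → ℝ := fun t => ∫ s in (0 : ℝ)..t, H s
  have hK : AbsolutelyContinuousOnInterval K 0 T :=
    hHi.absolutelyContinuousOnInterval_intervalIntegral (c := 0) (by simp)
  have hKc : ContinuousOn K (Set.uIcc 0 T) := hK.continuousOn
  have hKd : ∀ᵐ t, t ∈ Set.uIcc 0 T → deriv K t = H t := by
    filter_upwards [hHi.ae_hasDerivAt_integral] with t ht htm
    exact (ht htm 0 (by simp)).deriv
  have hKi : IntervalIntegrable K volume 0 T := hKc.intervalIntegrable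
  let f : ℝ → ℝ := fun t => G t - (G₀ + K t)
  have hfi : IntervalIntegrable f volume 0 T := hGi.sub (intervalIntegrable_const.add hKi)
  have hloc : LocallyIntegrableOn f (Set.Ioo 0 T) := by
    have : IntegrableOn f (Set.Ioo 0 T) := by
      rw [← integrableOn_Ioc_iff_integrableOn_Ioo,
        ← intervalIntegrable_iff_integrableOn_Ioc_of_le hT.le]
      exact hfi
    exact this.locallyIntegrableOn
  -- `f` is orthogonal to every test function `g` on `(0, T)`: apply the hypothesis to the primitive
  -- of `g` that vanishes at `T`, and integrate by parts against the absolutely continuous `K`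
  have hzero := isOpen_Ioo.ae_eq_zero_of_integral_contDiff_smul_eq_zero hloc (by
    intro g hg hgc hgs
    have hgcont := hg.continuous
    let P : ℝ → ℝ := fun t => ∫ s in (0 : ℝ)..t, g s
    have hP : ∀ t, HasDerivAt P (g t) t := fun t =>
      intervalIntegral.integral_hasDerivAt_right (hgcont.intervalIntegrable _ _)
        (hgcont.stronglyMeasurableAtFilter _ _) hgcont.continuousAt
    let χ : ℝ → ℝ := fun t => P t - P T
    have hχd : ∀ t, HasDerivAt χ (g t) t := fun t => (hP t).sub_const _
    have hχ' : deriv χ = g := funext fun t => (hχd t).deriv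
    have hχ : ContDiff ℝ ∞ χ := by
      rw [contDiff_infty_iff_deriv]
      exact ⟨fun t => (hχd t).differentiableAt, by rwa [hχ']⟩
    obtain ⟨T', hT'0, hT', hgT'⟩ : ∃ T', 0 ≤ T' ∧ T' < T ∧ ∀ t, T' ≤ t → g t = 0 := by
      rcases (tsupport g).eq_empty_or_nonempty with he | hne
      · exact ⟨0, le_rfl, hT, fun t _ => image_eq_zero_of_notMem_tsupport (by simp [he])⟩
      · have hmax := hgc.isCompact.sSup_mem hne
        have hlt := hgs hmax
        obtain ⟨b, hb1, hb2⟩ := exists_between hlt.2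
        refine ⟨b, (hlt.1.trans hb1).le, hb2, fun t ht => ?_⟩
        refine image_eq_zero_of_notMem_tsupport fun hmem => ?_
        exact absurd (le_csSup hgc.isCompact.bddAbove hmem) (not_le.2 (hb1.trans_le ht))
    have hχ0 : ∀ t, T' ≤ t → χ t = 0 := by
      intro t ht
      have : χ t = -∫ s in t..T, g s := by
        simp only [χ, P]
        have := intervalIntegral.integral_add_adjacent_intervals (μ := volume)
          (hgcont.intervalIntegrable 0 t) (hgcont.intervalIntegrable t T)
        linarith
      rw [this, intervalIntegral.integral_zero_ae, neg_zero]
      refine .of_forall fun s hs => hgT' s ?_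
      rcases le_total t T with h' | h'
      · rw [Set.uIoc_of_le h'] at hs; exact ht.trans hs.1.le
      · rw [Set.uIoc_of_ge h'] at hs; exact hT'.le.trans hs.1.le
    have key := h χ hχ T' hT'0 hT' hχ0
    rw [hχ', setIntegral_Ico_eq_intervalIntegral hT.le] at key
    have hχcont : Continuous χ := hχ.continuous
    have hχac : AbsolutelyContinuousOnInterval χ 0 T :=
      ContDiffOn.absolutelyContinuousOnInterval ((hχ.of_le (mod_cast le_top)).contDiffOn)
    have hparts := hχac.integral_mul_deriv_eq_deriv_mul hK
    have e1 : ∫ t in (0 : ℝ)..T, χ t * deriv K t = ∫ t in (0 : ℝ)..T, χ t * H t := by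
      refine intervalIntegral.integral_congr_ae ?_
      filter_upwards [hKd] with t ht htm
      rw [ht (Set.uIoc_subset_uIcc htm)]
    have hK0 : K 0 = 0 := by simp [K]
    rw [e1, hχ', hK0, hχ0 T hT'.le] at hparts
    have i1 : IntervalIntegrable (fun t => χ t * H t) volume 0 T :=
      hHi.continuousOn_mul hχcont.continuousOn
    have i2 : IntervalIntegrable (fun t => g t * G t) volume 0 T :=
      hGi.continuousOn_mul hgcont.continuousOn
    have i3 : IntervalIntegrable (fun t => g t * K t) volume 0 T :=
      hKi.continuousOn_mul hgcont.continuousOn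
    have i4 : IntervalIntegrable (fun t => g t * G₀) volume 0 T :=
      (hgcont.mul continuous_const).intervalIntegrable _ _
    rw [intervalIntegral.integral_add i1 i2, hparts] at key
    have e2 : χ 0 = -∫ t in (0 : ℝ)..T, g t := by simp [χ, P]
    have e3 : ∫ t, g t • f t = ∫ t in (0 : ℝ)..T, g t * f t := by
      rw [intervalIntegral.integral_of_le hT.le, ← integral_indicator measurableSet_Ioc]
      congr 1
      funext t
      by_cases ht : t ∈ Set.Ioc 0 T
      · rw [Set.indicator_of_mem ht, smul_eq_mul]
      · rw [Set.indicator_of_notMem ht]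
        have : g t = 0 := image_eq_zero_of_notMem_tsupport fun hmem =>
          ht (Set.Ioo_subset_Ioc_self (hgs hmem))
        rw [this, zero_smul]
    have e4 : ∫ t in (0 : ℝ)..T, g t * f t = (∫ t in (0 : ℝ)..T, g t * G t) -
        ((∫ t in (0 : ℝ)..T, g t * G₀) + ∫ t in (0 : ℝ)..T, g t * K t) := by
      rw [← intervalIntegral.integral_add i4 i3, ← intervalIntegral.integral_sub i2 (i4.add i3)]
      refine intervalIntegral.integral_congr fun t _ => ?_
      simp only [f]
      ring
    rw [e3, e4, intervalIntegral.integral_mul_const]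
    rw [e2] at key
    linarith)
  rw [ae_restrict_iff' measurableSet_Ico]
  have hne : ∀ᵐ t : ℝ, t ≠ 0 := by simp [ae_iff]
  filter_upwards [hzero, hne] with t ht ht0 htm
  have := ht ⟨lt_of_le_of_ne htm.1 (Ne.symm ht0), htm.2⟩
  simp only [f, K] at this
  linarith

end

section

variable {d : ℕ}

/-! ### Weak-strong stability of measures -/

section Moments

variable {ρ : Measure (L2 d)} [IsProbabilityMeasure ρ]

lemma integrable_norm_of_sq (h : Integrable (fun u : L2 d => ‖u‖ ^ 2) ρ) :
    Integrable (fun u : L2 d => ‖u‖) ρ := by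
  refine ((integrable_const (1 : ℝ)).add h).mono continuous_norm.aestronglyMeasurable
    (.of_forall fun u => ?_)
  simp only [Pi.add_apply]
  rw [norm_norm, Real.norm_of_nonneg (by positivity)]
  nlinarith [norm_nonneg u, sq_nonneg (‖u‖ - 1)]

lemma integral_norm_le_of_sq (h : Integrable (fun u : L2 d => ‖u‖ ^ 2) ρ) :
    ∫ u, ‖u‖ ∂ρ ≤ 1 + ∫ u, ‖u‖ ^ 2 ∂ρ := by
  have h1 : ∫ u, ‖u‖ ∂ρ ≤ ∫ u : L2 d, (1 + ‖u‖ ^ 2) ∂ρ := by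
    refine integral_mono (integrable_norm_of_sq h) ((integrable_const (1 : ℝ)).add h) fun u => ?_
    simp only
    nlinarith [norm_nonneg u, sq_nonneg (‖u‖ - 1)]
  rw [integral_add (integrable_const _) h] at h1
  simpa using h1

lemma integrable_inner_const (h : Integrable (fun u : L2 d => ‖u‖ ^ 2) ρ) (w : L2 d) :
    Integrable (fun u : L2 d => (inner ℝ u w : ℝ)) ρ := by
  refine ((integrable_norm_of_sq h).mul_const ‖w‖).mono ?_ (.of_forall fun u => ?_)
  · exact (by fun_prop : Continuous fun u : L2 d => (inner ℝ u w : ℝ)).aestronglyMeasurable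
  · rw [norm_mul, norm_norm, norm_norm]
    exact norm_inner_le_norm u w

lemma abs_integral_inner_le (h : Integrable (fun u : L2 d => ‖u‖ ^ 2) ρ) (w : L2 d) :
    |∫ u : L2 d, (inner ℝ u w : ℝ) ∂ρ| ≤ ‖w‖ * (1 + ∫ u, ‖u‖ ^ 2 ∂ρ) := by
  have h1 : |∫ u : L2 d, (inner ℝ u w : ℝ) ∂ρ| ≤ ∫ u, ‖w‖ * ‖u‖ ∂ρ := by
    rw [← Real.norm_eq_abs]
    refine norm_integral_le_of_norm_le ((integrable_norm_of_sq h).const_mul _)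
      (.of_forall fun u => ?_)
    exact (norm_inner_le_norm u w).trans_eq (mul_comm _ _)
  rw [integral_const_mul] at h1
  exact h1.trans (mul_le_mul_of_nonneg_left (integral_norm_le_of_sq h) (norm_nonneg _))

lemma integrable_norm_sub_sq (h : Integrable (fun u : L2 d => ‖u‖ ^ 2) ρ) (w : L2 d) :
    Integrable (fun u : L2 d => ‖u - w‖ ^ 2) ρ := by
  simp only [norm_sub_sq_real]
  exact (h.sub ((integrable_inner_const h w).const_mul 2)).add (integrable_const _)

lemma integral_norm_sub_sq (h : Integrable (fun u : L2 d => ‖u‖ ^ 2) ρ) (w : L2 d) :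
    ∫ u : L2 d, ‖u - w‖ ^ 2 ∂ρ =
      ∫ u, ‖u‖ ^ 2 ∂ρ - 2 * ∫ u : L2 d, (inner ℝ u w : ℝ) ∂ρ + ‖w‖ ^ 2 := by
  simp only [norm_sub_sq_real]
  have h2 := (integrable_inner_const h w).const_mul 2
  have h3 : Integrable (fun u : L2 d => ‖u‖ ^ 2 - 2 * inner ℝ u w) ρ := h.sub h2
  rw [integral_add h3 (integrable_const _), integral_sub h h2, integral_const_mul]
  simp

lemma integral_norm_sub_sq_le (h : Integrable (fun u : L2 d => ‖u‖ ^ 2) ρ) (w : L2 d) :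
    ∫ u : L2 d, ‖u - w‖ ^ 2 ∂ρ ≤ 2 * ∫ u, ‖u‖ ^ 2 ∂ρ + 2 * ‖w‖ ^ 2 := by
  have h1 : ∫ u : L2 d, ‖u - w‖ ^ 2 ∂ρ ≤ ∫ u : L2 d, (2 * ‖u‖ ^ 2 + 2 * ‖w‖ ^ 2) ∂ρ := by
    refine integral_mono (integrable_norm_sub_sq h w) ((h.const_mul 2).add (integrable_const _))
      fun u => ?_
    have := norm_sub_le u w
    have h2 : ‖u - w‖ ^ 2 ≤ (‖u‖ + ‖w‖) ^ 2 := by gcongr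
    simp only
    nlinarith [sq_nonneg (‖u‖ - ‖w‖)]
  rw [integral_add (h.const_mul 2) (integrable_const _), integral_const_mul] at h1
  simpa using h1

lemma continuous_rate {T : ℝ} {φ : ℝ → Torus d → Vec d} (hφ : IsCn 1 T φ) {t : ℝ}
    (ht : t ∈ Set.Ico 0 T) : Continuous (rate T φ t) := by
  rw [← continuousOn_univ]
  exact ContinuousOn.comp (g := fun p : ℝ × L2 d => rate T φ p.1 p.2) (f := fun w => (t, w))
    (continuousOn_rate hφ) (by fun_prop) fun _ _ => ⟨ht, trivial⟩

lemma integrable_rate (h : Integrable (fun u : L2 d => ‖u‖ ^ 2) ρ) {T : ℝ}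
    {φ : ℝ → Torus d → Vec d} (hφ : IsCn 1 T φ) {t : ℝ} (ht : t ∈ Set.Ico 0 T) :
    Integrable (rate T φ t) ρ := by
  obtain ⟨K, hK0, hK⟩ := exists_rate_bound hφ ht.2
  refine (((integrable_norm_of_sq h).add h).const_mul K).mono
    (continuous_rate hφ ht).aestronglyMeasurable (.of_forall fun u => ?_)
  refine (hK t ⟨ht.1, le_rfl⟩ u).trans (le_abs_self _)

end Moments

/-- Weak-strong stability for families of probability measures: a solution of the first moment
equation that dissipates energy and is carried by divergence-free fields does not drift away from a
classical solution faster than exponentially. -/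
lemma ae_integral_norm_sub_sq_le {T : ℝ} (hT : 0 < T) {κ : Kernel ℝ (L2 d)} [IsMarkovKernel κ]
    {ρ₀ : Measure (L2 d)} [IsProbabilityMeasure ρ₀]
    (h₀ : Integrable (fun u : L2 d => ‖u‖ ^ 2) ρ₀)
    (hen : ∀ᵐ t ∂(volume.restrict (Set.Ico 0 T)), Integrable (fun u : L2 d => ‖u‖ ^ 2) (κ t) ∧
      ∫ u, ‖u‖ ^ 2 ∂(κ t) ≤ ∫ u, ‖u‖ ^ 2 ∂ρ₀)
    (hdiv : ∀ᵐ t ∂(volume.restrict (Set.Ico 0 T)), ∀ᵐ u ∂(κ t), IsDivFree u)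
    (hweak : ∀ φ, IsTestField T φ → ∫ t in Set.Ico 0 T, (∫ u, rate T φ t u ∂(κ t)) =
      -∫ u : L2 d, (inner ℝ u (contL2 (φ 0)) : ℝ) ∂ρ₀)
    {v : ℝ → Torus d → Vec d} {C : ℝ} (hv : IsLipschitzSolution T v C) :
    ∀ᵐ t ∂(volume.restrict (Set.Ico 0 T)), ∫ u : L2 d, ‖u - contL2 (v t)‖ ^ 2 ∂(κ t) ≤
      Real.exp (2 * (C * T)) * ∫ u : L2 d, ‖u - contL2 (v 0)‖ ^ 2 ∂ρ₀ := by
  obtain ⟨p, hp⟩ := hv.classical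
  have hC := hv.nonneg hT
  have hvC := hp.velocity_C1
  have hvt := hp.isWeakTrajectory
  have h0 : (0 : ℝ) ∈ Set.Ico 0 T := ⟨le_rfl, hT⟩
  let 𝕋 : Measure ℝ := volume.restrict (Set.Ico 0 T)
  have hmem : ∀ᵐ t ∂𝕋, t ∈ Set.Ico 0 T := ae_restrict_mem measurableSet_Ico
  let M := ∫ u, ‖u‖ ^ 2 ∂ρ₀
  have hM : 0 ≤ M := integral_nonneg fun u => by positivity
  let V := ‖contL2 (v 0)‖
  have hVt : ∀ t ∈ Set.Ico 0 T, ‖contL2 (v t)‖ = V := hvt.energy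
  -- the relative energy `R` is controlled through the mixed term `G`, whose weak derivative is `H`
  let G : ℝ → ℝ := fun t => ∫ u : L2 d, (inner ℝ u (contL2 (v t)) : ℝ) ∂(κ t)
  let H : ℝ → ℝ := fun t => ∫ u, rate T v t u ∂(κ t)
  let R : ℝ → ℝ := fun t => ∫ u : L2 d, ‖u - contL2 (v t)‖ ^ 2 ∂(κ t)
  let G₀ : ℝ := ∫ u : L2 d, (inner ℝ u (contL2 (v 0)) : ℝ) ∂ρ₀
  let R₀ : ℝ := ∫ u : L2 d, ‖u - contL2 (v 0)‖ ^ 2 ∂ρ₀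
  have hcv : ContinuousOn (fun p : ℝ × L2 d => contL2 (v p.1)) (Set.Ico 0 T ×ˢ Set.univ) :=
    hvC.continuousOn_contL2.comp continuousOn_fst fun p hp => hp.1
  have mG : AEStronglyMeasurable G 𝕋 :=
    aestronglyMeasurable_integral_kernel (continuousOn_snd.inner hcv) κ
  have mH : AEStronglyMeasurable H 𝕋 :=
    aestronglyMeasurable_integral_kernel (continuousOn_rate hvC) κ
  have mR : AEStronglyMeasurable R 𝕋 :=
    aestronglyMeasurable_integral_kernel (f := fun t u => ‖u - contL2 (v t)‖ ^ 2)
      ((continuousOn_snd.sub hcv).norm.pow 2) κ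
  have bR : ∀ᵐ t ∂𝕋, ‖R t‖ ≤ 2 * M + 2 * V ^ 2 := by
    filter_upwards [hen, hmem] with t ht htm
    rw [Real.norm_of_nonneg (integral_nonneg fun u => by positivity)]
    refine (integral_norm_sub_sq_le ht.1 _).trans ?_
    rw [hVt t htm]
    linarith [ht.2]
  have bG : ∀ᵐ t ∂𝕋, ‖G t‖ ≤ V * (1 + M) := by
    filter_upwards [hen, hmem] with t ht htm
    refine (abs_integral_inner_le ht.1 _).trans ?_
    rw [hVt t htm]
    exact mul_le_mul_of_nonneg_left (by linarith [ht.2]) (norm_nonneg _)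
  have bHR : ∀ᵐ t ∂𝕋, |H t| ≤ C * R t := by
    filter_upwards [hen, hdiv, hmem] with t ht htd htm
    have : |H t| ≤ ∫ u : L2 d, C * ‖u - contL2 (v t)‖ ^ 2 ∂(κ t) := by
      rw [← Real.norm_eq_abs]
      refine norm_integral_le_of_norm_le ((integrable_norm_sub_sq ht.1 _).const_mul C) ?_
      filter_upwards [htd] with u hu
      exact hp.abs_rate_le htm hu (hv.bound t htm)
    rwa [integral_const_mul] at this
  have bH : ∀ᵐ t ∂𝕋, ‖H t‖ ≤ C * (2 * M + 2 * V ^ 2) := by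
    filter_upwards [bHR, bR] with t h1 h2
    exact h1.trans (mul_le_mul_of_nonneg_left ((le_abs_self _).trans h2) hC)
  have iG : Integrable G 𝕋 := .of_bound mG _ bG
  have iH : Integrable H 𝕋 := .of_bound mH _ bH
  have iR : Integrable R 𝕋 := .of_bound mR _ bR
  -- the first moment equation, tested with `χ v`
  have hA : ∀ χ : ℝ → ℝ, ContDiff ℝ ∞ χ → ∀ T', 0 ≤ T' → T' < T → (∀ t, T' ≤ t → χ t = 0) →
      ∫ t in Set.Ico 0 T, (χ t * H t + deriv χ t * G t) = -(χ 0 * G₀) := by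
    intro χ hχ T' hT'0 hT' hχ0
    have hχ' : Continuous (deriv χ) := hχ.continuous_deriv (mod_cast le_top)
    have iχ : ∀ {f g : ℝ → ℝ}, Continuous f → Integrable g 𝕋 →
        Integrable (fun t => f t * g t) 𝕋 := by
      intro f g hf hg
      obtain ⟨c, hc⟩ := (isCompact_Icc (a := 0) (b := T)).exists_bound_of_continuousOn
        hf.continuousOn
      refine hg.bdd_mul (c := c) hf.aestronglyMeasurable ?_
      filter_upwards [hmem] with t ht
      exact hc t ⟨ht.1, ht.2.le⟩
    have i1 : Integrable (fun t => χ t * H t + deriv χ t * G t) 𝕋 :=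
      (iχ hχ.continuous iH).add (iχ hχ' iG)
    let X : ℝ := ∫ t in Set.Ico 0 T, (χ t * H t + deriv χ t * G t)
    have key : ∀ ε > 0, |X + χ 0 * G₀| ≤ ε * ((1 + 2 * M) * T + (1 + M)) := by
      intro ε hε
      obtain ⟨φ, hφ, hφ0, hφr⟩ :=
        exists_testField_approx hvC hp.divFree hχ hT'0 hT' hχ0 hε
      have hφ1 : IsCn 1 T φ := hφ.smooth.mono (mod_cast le_top)
      let F : ℝ → ℝ := fun t => ∫ u, rate T φ t u ∂(κ t)
      have mF : AEStronglyMeasurable F 𝕋 :=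
        aestronglyMeasurable_integral_kernel (continuousOn_rate hφ1) κ
      let D : ℝ → ℝ := fun t => F t - (χ t * H t + deriv χ t * G t)
      have bD : ∀ᵐ t ∂𝕋, ‖D t‖ ≤ ε * (1 + 2 * M) := by
        filter_upwards [hen, hmem] with t ht htm
        have e1 : D t = ∫ u : L2 d, (rate T φ t u -
            (χ t * rate T v t u + deriv χ t * inner ℝ u (contL2 (v t)))) ∂(κ t) := by
          have j1 := (integrable_rate ht.1 hvC htm).const_mul (χ t)
          have j2 := (integrable_inner_const ht.1 (contL2 (v t))).const_mul (deriv χ t)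
          have j12 : Integrable (fun u => χ t * rate T v t u +
              deriv χ t * inner ℝ u (contL2 (v t))) (κ t) := j1.add j2
          rw [integral_sub (integrable_rate ht.1 hφ1 htm) j12, integral_add j1 j2,
            integral_const_mul, integral_const_mul]
        rw [e1]
        have j3 := (integrable_norm_of_sq ht.1).add ht.1
        refine (norm_integral_le_of_norm_le (j3.const_mul ε) (.of_forall fun u => ?_)).trans ?_
        · exact hφr t htm u
        · rw [integral_const_mul]
          refine mul_le_mul_of_nonneg_left ?_ hε.le
          simp only [Pi.add_apply]
          rw [integral_add (integrable_norm_of_sq ht.1) ht.1]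
          linarith [integral_norm_le_of_sq ht.1, ht.2]
      have iD : Integrable D 𝕋 := .of_bound (mF.sub i1.aestronglyMeasurable) _ bD
      have e2 : ∫ t in Set.Ico 0 T, F t = (∫ t, D t ∂𝕋) + X := by
        rw [← integral_add iD i1]
        refine integral_congr_ae (.of_forall fun t => ?_)
        simp only [D]
        ring
      have e3 : |∫ t, D t ∂𝕋| ≤ ε * (1 + 2 * M) * T := by
        refine (norm_integral_le_of_norm_le_const bD).trans (le_of_eq ?_)
        simp [𝕋, Measure.real, hT.le]
      have e4 : |(∫ u : L2 d, (inner ℝ u (contL2 (φ 0)) : ℝ) ∂ρ₀) - χ 0 * G₀| ≤ ε * (1 + M) := by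
        have : (∫ u : L2 d, (inner ℝ u (contL2 (φ 0)) : ℝ) ∂ρ₀) - χ 0 * G₀ =
            ∫ u : L2 d, (inner ℝ u (contL2 (φ 0) - χ 0 • contL2 (v 0)) : ℝ) ∂ρ₀ := by
          simp only [inner_sub_right, inner_smul_right]
          rw [integral_sub (integrable_inner_const h₀ _)
            ((integrable_inner_const h₀ _).const_mul _), integral_const_mul]
        rw [this]
        refine (abs_integral_inner_le h₀ _).trans (mul_le_mul_of_nonneg_right hφ0 (by positivity))
      have e5 := hweak φ hφ
      change ∫ t in Set.Ico 0 T, F t = _ at e5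
      rw [e2] at e5
      have e6 : X + χ 0 * G₀ = -(∫ t, D t ∂𝕋) -
          ((∫ u : L2 d, (inner ℝ u (contL2 (φ 0)) : ℝ) ∂ρ₀) - χ 0 * G₀) := by linarith
      rw [e6]
      refine (abs_sub _ _).trans ?_
      rw [abs_neg]
      linarith
    have hc : 0 < (1 + 2 * M) * T + (1 + M) := by positivity
    have hX : |X + χ 0 * G₀| ≤ 0 := by
      refine le_of_forall_pos_le_add fun ε hε => ?_
      have := key (ε / ((1 + 2 * M) * T + (1 + M))) (by positivity)
      rw [div_mul_cancel₀ _ hc.ne'] at this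
      linarith
    have := abs_nonpos_iff.1 hX
    change X = _
    linarith
  have hGH := ae_eq_add_integral_of_weak_deriv hT iG iH hA
  have hsub : ∀ {f : ℝ → ℝ} {t : ℝ}, Integrable f 𝕋 → t ∈ Set.Ico 0 T →
      IntervalIntegrable f volume 0 t := by
    intro f t hf ht
    rw [intervalIntegrable_iff_integrableOn_Ioc_of_le ht.1]
    exact hf.mono_measure (Measure.restrict_mono
      (show Set.Ioc 0 t ⊆ Set.Ico 0 T from fun s hs => ⟨hs.1.le, hs.2.trans_lt ht.2⟩) le_rfl)
  -- the energy inequality bounds the first term of `R`, and `|H| ≤ C R` the growth of the mixed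
  -- term
  have hR : ∀ᵐ t ∂𝕋, R t ≤ R₀ + (2 * C) * ∫ s in (0 : ℝ)..t, R s := by
    filter_upwards [hen, hmem, hGH] with t ht htm hG
    have e1 : R t = ∫ u, ‖u‖ ^ 2 ∂(κ t) - 2 * G t + V ^ 2 := by
      rw [← hVt t htm]
      exact integral_norm_sub_sq ht.1 _
    have e2 : R₀ = M - 2 * G₀ + V ^ 2 := integral_norm_sub_sq h₀ _
    have e3 : -(∫ s in (0 : ℝ)..t, H s) ≤ C * ∫ s in (0 : ℝ)..t, R s := by
      rw [← intervalIntegral.integral_neg, ← intervalIntegral.integral_const_mul]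
      refine intervalIntegral.integral_mono_ae_restrict htm.1 (hsub iH htm).neg
        ((hsub iR htm).const_mul C) ?_
      have : ∀ᵐ s ∂(volume.restrict (Set.Icc 0 t)), |H s| ≤ C * R s :=
        ae_mono (Measure.restrict_mono
          (show Set.Icc 0 t ⊆ Set.Ico 0 T from fun s hs => ⟨hs.1, hs.2.trans_lt htm.2⟩) le_rfl) bHR
      filter_upwards [this] with s hs
      exact (neg_le_abs _).trans hs
    rw [e1, e2, hG]
    linarith [ht.2]
  filter_upwards [hR, hmem] with t ht htm
  have hgr := gronwall_integral (R := R) (R₀ := R₀) (K := 2 * C) (b := t) (by positivity) htm.1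
    (hsub iR htm) (ae_mono (Measure.restrict_mono
      (show Set.Icc 0 t ⊆ Set.Ico 0 T from fun s hs => ⟨hs.1, hs.2.trans_lt htm.2⟩) le_rfl) hR)
  refine (ht.trans hgr).trans ?_
  rw [mul_comm]
  refine mul_le_mul_of_nonneg_right (Real.exp_le_exp.2 ?_) (integral_nonneg fun u => by positivity)
  nlinarith [mul_le_mul_of_nonneg_left htm.2.le hC]

end

section

variable {d : ℕ}

/-! ### A jointly measurable representative and correlation measures -/

lemma exists_denseSeq_near (n : ℕ) (u : L2 d) :
    ∃ j, ‖TopologicalSpace.denseSeq (L2 d) j - u‖ < (1 / 2) ^ n := by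
  obtain ⟨j, hj⟩ := (TopologicalSpace.denseRange_denseSeq (L2 d)).exists_dist_lt u
    (show (0 : ℝ) < (1 / 2) ^ n by positivity)
  exact ⟨j, by rwa [← dist_eq_norm, dist_comm]⟩

open Classical in
/-- The index of the first member of a fixed dense sequence that is `2⁻ⁿ`-close to `u`. -/
def nearIndex (n : ℕ) (u : L2 d) : ℕ := Nat.find (exists_denseSeq_near n u)

/-- The first member of a fixed dense sequence that is `2⁻ⁿ`-close to `u`. -/
def nearPoint (n : ℕ) (u : L2 d) : L2 d := TopologicalSpace.denseSeq (L2 d) (nearIndex n u)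

open Classical in
lemma norm_nearPoint_sub_lt (n : ℕ) (u : L2 d) : ‖nearPoint n u - u‖ < (1 / 2) ^ n :=
  Nat.find_spec (exists_denseSeq_near n u)

open Classical in
lemma measurable_nearIndex (n : ℕ) : Measurable (nearIndex (d := d) n) := by
  refine measurable_find _ fun j => ?_
  exact (isOpen_lt (by fun_prop) continuous_const).measurableSet

/-- A representative of `u ∈ L²ₓ` that depends measurably on `(u, x)`, as the pointwise limit of
countably-valued approximations of `u`. -/
def rep (u : L2 d) (x : Torus d) : Vec d := limUnder atTop fun n => nearPoint n u x

lemma measurable_rep : Measurable fun q : L2 d × Torus d => rep q.1 q.2 := by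
  refine (StronglyMeasurable.limUnder (f := fun n (q : L2 d × Torus d) => nearPoint n q.1 q.2)
    fun n => ?_).measurable
  have h1 : Measurable fun q : ℕ × Torus d => TopologicalSpace.denseSeq (L2 d) q.1 q.2 :=
    measurable_from_prod_countable_right fun j =>
      (Lp.stronglyMeasurable (TopologicalSpace.denseSeq (L2 d) j)).measurable
  exact (h1.comp (((measurable_nearIndex n).comp measurable_fst).prodMk
    measurable_snd)).stronglyMeasurable

lemma rep_ae_eq (u : L2 d) : rep u =ᵐ[volume] u := by
  have hlim : Tendsto (fun n => nearPoint n u) atTop (𝓝 u) := by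
    rw [tendsto_iff_norm_sub_tendsto_zero]
    exact squeeze_zero (fun n => norm_nonneg _) (fun n => (norm_nearPoint_sub_lt n u).le)
      (tendsto_pow_atTop_nhds_zero_of_lt_one (by norm_num) (by norm_num))
  have hae : ∀ᵐ x : Torus d, ∃ l, Tendsto (fun n => nearPoint n u x) atTop (𝓝 l) := by
    refine Lp.ae_tendsto_of_cauchy_eLpNorm (p := 2) (f := fun n => nearPoint n u)
      (fun n => Lp.aestronglyMeasurable _) (by norm_num)
      (B := fun n => ENNReal.ofReal (2 * (1 / 2) ^ n)) ?_ fun N n m hn hm => ?_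
    · rw [← ENNReal.ofReal_tsum_of_nonneg (fun n => by positivity)
        ((summable_geometric_of_lt_one (by norm_num) (by norm_num)).mul_left 2)]
      exact ENNReal.ofReal_ne_top
    · rw [← eLpNorm_congr_ae (Lp.coeFn_sub (nearPoint n u) (nearPoint m u)), ← Lp.enorm_def,
        ← ofReal_norm]
      refine (ENNReal.ofReal_lt_ofReal_iff (by positivity)).2 ?_
      have h1 : ∀ {n}, N ≤ n → ‖nearPoint n u - u‖ < (1 / 2) ^ N := fun {n} h =>
        (norm_nearPoint_sub_lt n u).trans_le (pow_le_pow_of_le_one (by norm_num) (by norm_num) h)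
      calc ‖nearPoint n u - nearPoint m u‖
          = ‖(nearPoint n u - u) - (nearPoint m u - u)‖ := by congr 1; abel
        _ ≤ ‖nearPoint n u - u‖ + ‖nearPoint m u - u‖ := norm_sub_le _ _
        _ < 2 * (1 / 2) ^ N := by linarith [h1 hn, h1 hm]
  -- the almost everywhere limit of the fast Cauchy sequence agrees with the limit in `L²`
  obtain ⟨ns, hns, hsub⟩ := (tendstoInMeasure_of_tendsto_Lp hlim).exists_seq_tendsto_ae
  filter_upwards [hae, hsub] with x ⟨l, hl⟩ h2
  rw [rep, hl.limUnder_eq]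
  exact tendsto_nhds_unique (hl.comp hns.tendsto_atTop) h2

-- From here on only measurability and `rep_ae_eq` matter, not the choice of the representative.
attribute [irreducible] rep

lemma measurable_rep_comp {α : Type*} [MeasurableSpace α] {f : α → L2 d} {g : α → Torus d}
    (hf : Measurable f) (hg : Measurable g) : Measurable fun a => rep (f a) (g a) :=
  measurable_rep.comp (hf.prodMk hg)

lemma measurable_rep_pi (k : ℕ) :
    Measurable fun q : (Fin k → Torus d) × L2 d => fun i => rep q.2 (q.1 i) := by
  refine measurable_pi_lambda _ fun i => ?_
  have h : Measurable fun q : (Fin k → Torus d) × L2 d => q.1 i :=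
    (measurable_pi_apply i).comp measurable_fst
  exact measurable_rep_comp measurable_snd h

lemma rep_pi_ae_eq (k : ℕ) (u : L2 d) :
    ∀ᵐ x : Fin k → Torus d, (fun i => rep u (x i)) = fun i => u (x i) := by
  have : ∀ i : Fin k, ∀ᵐ x : Fin k → Torus d, rep u (x i) = u (x i) := fun i =>
    (Measure.tendsto_eval_ae_ae (μ := fun _ : Fin k => (volume : Measure (Torus d)))
      (i := i)).eventually (rep_ae_eq u)
  filter_upwards [ae_all_iff.2 this] with x hx
  exact funext hx

/-- The law of `(u(x₁), …, u(x_k))` under `μ`. -/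
def correlationMeasure (μ : Measure (L2 d)) [IsProbabilityMeasure μ] : Hierarchy d := fun k =>
  (Kernel.id ×ₖ Kernel.const (Fin k → Torus d) μ).map fun q i => rep q.2 (q.1 i)

section Correlation

variable (μ : Measure (L2 d)) [IsProbabilityMeasure μ]

lemma measurable_rep_right (k : ℕ) (x : Fin k → Torus d) :
    Measurable fun (u : L2 d) i => rep u (x i) :=
  (measurable_rep_pi k).comp measurable_prodMk_left

lemma correlationMeasure_apply (k : ℕ) (x : Fin k → Torus d) :
    correlationMeasure μ k x = μ.map fun u i => rep u (x i) := by
  rw [correlationMeasure, Kernel.map_apply _ (measurable_rep_pi k), Kernel.prod_apply,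
    Kernel.id_apply, Kernel.const_apply, Measure.dirac_prod,
    Measure.map_map (measurable_rep_pi k) measurable_prodMk_left]
  rfl

instance (k : ℕ) : IsMarkovKernel (correlationMeasure μ k) :=
  Kernel.IsMarkovKernel.map _ (measurable_rep_pi k)

/-- Tonelli's theorem, which the joint measurability of the representative makes available. -/
lemma lintegral_correlationMeasure {k : ℕ} {f : (Fin k → Torus d) → (Fin k → Vec d) → ℝ≥0∞}
    (hf : Measurable (Function.uncurry f)) :
    ∫⁻ x, ∫⁻ ξ, f x ξ ∂(correlationMeasure μ k x) =
      ∫⁻ u : L2 d, (∫⁻ x, f x (fun i => u (x i))) ∂μ := by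
  have h1 : ∀ x, ∫⁻ ξ, f x ξ ∂(correlationMeasure μ k x) =
      ∫⁻ u, f x (fun i => rep u (x i)) ∂μ := fun x => by
    rw [correlationMeasure_apply, lintegral_map (f := f x) (hf.comp measurable_prodMk_left)
      (measurable_rep_right k x)]
  simp only [h1]
  rw [lintegral_lintegral_swap]
  · refine lintegral_congr fun u => lintegral_congr_ae ?_
    filter_upwards [rep_pi_ae_eq k u] with x hx
    rw [hx]
  · exact (hf.comp (measurable_fst.prodMk (measurable_rep_pi k))).aemeasurable

lemma integral_correlationMeasure {k : ℕ} {f : (Fin k → Torus d) → (Fin k → Vec d) → ℝ}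
    (hf : Measurable (Function.uncurry f))
    (hfin : ∫⁻ u : L2 d, (∫⁻ x, ‖f x (fun i => u (x i))‖ₑ) ∂μ < ⊤) :
    ∫ x, ∫ ξ, f x ξ ∂(correlationMeasure μ k x) = ∫ u : L2 d, (∫ x, f x (fun i => u (x i))) ∂μ := by
  have h1 : ∀ x, ∫ ξ, f x ξ ∂(correlationMeasure μ k x) =
      ∫ u, f x (fun i => rep u (x i)) ∂μ := fun x => by
    rw [correlationMeasure_apply, integral_map (measurable_rep_right k x).aemeasurable]
    exact (hf.comp measurable_prodMk_left).aestronglyMeasurable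
  simp only [h1]
  have hm : Measurable fun q : (Fin k → Torus d) × L2 d => f q.1 (fun i => rep q.2 (q.1 i)) :=
    hf.comp (measurable_fst.prodMk (measurable_rep_pi k))
  have hswap : ∀ u : L2 d, ∀ᵐ x : Fin k → Torus d,
      f x (fun i => rep u (x i)) = f x (fun i => u (x i)) := fun u => by
    filter_upwards [rep_pi_ae_eq k u] with x hx
    rw [hx]
  rw [integral_integral_swap]
  · exact integral_congr_ae (.of_forall fun u => integral_congr_ae (hswap u))
  · refine ⟨hm.aestronglyMeasurable, ?_⟩
    change ∫⁻ q : (Fin k → Torus d) × L2 d, ‖f q.1 (fun i => rep q.2 (q.1 i))‖ₑ ∂_ < ⊤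
    rw [lintegral_prod_symm (fun q : (Fin k → Torus d) × L2 d =>
      ‖f q.1 (fun i => rep q.2 (q.1 i))‖ₑ) hm.enorm.aemeasurable]
    refine lt_of_le_of_lt (le_of_eq ?_) hfin
    refine lintegral_congr fun u => lintegral_congr_ae ?_
    filter_upwards [hswap u] with x hx
    rw [hx]

end Correlation

lemma enorm_sq_eq_lintegral (u : L2 d) : ‖u‖ₑ ^ 2 = ∫⁻ x, ‖u x‖ₑ ^ 2 := by
  have := eLpNorm_nnreal_pow_eq_lintegral (f := u) (μ := volume) (p := 2) (by norm_num)
  rw [Lp.enorm_def]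
  simpa using this

lemma torusBall_eq (x : Torus d) (r : ℝ) : torusBall x r = (fun y => y - x) ⁻¹' torusBall 0 r := by
  ext y; simp [torusBall]

lemma isOpen_torusBall (x : Torus d) (r : ℝ) : IsOpen (torusBall x r) :=
  isOpen_lt (by fun_prop) continuous_const

lemma norm_lt_of_mem_torusBall {z : Torus d} {r : ℝ} (hr : 0 < r) (hz : z ∈ torusBall 0 r) :
    ‖z‖ < r := by
  refine (pi_norm_lt_iff hr).2 fun i => lt_of_le_of_lt ?_ hz
  refine Real.le_sqrt_of_sq_le ?_
  simp only [Pi.zero_apply, sub_zero]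
  exact Finset.single_le_sum (f := fun i => ‖z i‖ ^ 2) (fun i _ => by positivity)
    (Finset.mem_univ i)

/-- The mean square increment of a field distributed according to `μ`. -/
def increment (μ : Measure (L2 d)) (z : Torus d) : ℝ≥0∞ :=
  ∫⁻ u, (∫⁻ x, ‖rep u x - rep u (x + z)‖ₑ ^ 2) ∂μ

open scoped DomAddAct in
lemma lintegral_increment_eq (u : L2 d) (z : Torus d) :
    ∫⁻ x, ‖rep u x - rep u (x + z)‖ₑ ^ 2 = ‖u - (DomAddAct.mk z +ᵥ u : L2 d)‖ₑ ^ 2 := by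
  rw [enorm_sq_eq_lintegral]
  refine lintegral_congr_ae ?_
  have h1 : ∀ᵐ x : Torus d, rep u (x + z) = u (x + z) :=
    (measurePreserving_add_right volume z).quasiMeasurePreserving.ae (rep_ae_eq u)
  filter_upwards [Lp.coeFn_sub u (DomAddAct.mk z +ᵥ u : L2 d),
    DomAddAct.vadd_Lp_ae_eq (DomAddAct.mk z) u, rep_ae_eq u, h1] with x e1 e2 e3 e4
  rw [e1, e3, e4, Pi.sub_apply, e2, Equiv.symm_apply_apply, vadd_eq_add, add_comm]

open scoped DomAddAct in
/-- Continuity of translations in `L²`, averaged over `μ`. -/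
lemma tendsto_increment {μ : Measure (L2 d)} (hμ : ∫⁻ u, ‖u‖ₑ ^ 2 ∂μ < ⊤) :
    Tendsto (increment μ) (𝓝 0) (𝓝 0) := by
  have hfact : Fact ((2 : ℝ≥0∞) ≠ ⊤) := ⟨by norm_num⟩
  have hvadd : ContinuousVAdd (Torus d)ᵈᵃᵃ (L2 d) := Lp.instContinuousVAddDomAddAct
  have hc : ∀ u : L2 d, Continuous fun z : Torus d =>
      ‖u - (DomAddAct.mk z +ᵥ u : L2 d)‖ₑ ^ 2 := fun u => by
    have : Continuous fun z : Torus d => (DomAddAct.mk z +ᵥ u : L2 d) :=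
      DomAddAct.continuous_mk.vadd continuous_const
    exact ENNReal.continuous_pow 2 |>.comp (continuous_enorm.comp (continuous_const.sub this))
  have h0 : increment μ = fun z => ∫⁻ u, ‖u - (DomAddAct.mk z +ᵥ u : L2 d)‖ₑ ^ 2 ∂μ := by
    funext z
    simp only [increment, lintegral_increment_eq]
  have hz : (∫⁻ u, ‖u - (DomAddAct.mk (0 : Torus d) +ᵥ u : L2 d)‖ₑ ^ 2 ∂μ) = 0 := by
    simp
  rw [h0, ← hz]
  refine tendsto_lintegral_filter_of_dominated_convergence (fun u => 4 * ‖u‖ₑ ^ 2)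
    (.of_forall fun z => ?_) (.of_forall fun z => .of_forall fun u => ?_) ?_
    (.of_forall fun u => (hc u).tendsto 0)
  · have : Continuous fun u : L2 d => (DomAddAct.mk z +ᵥ u : L2 d) :=
      continuous_const_vadd (DomAddAct.mk z)
    exact (ENNReal.continuous_pow 2 |>.comp
      (continuous_enorm.comp (continuous_id.sub this))).measurable
  · have : ‖u - (DomAddAct.mk z +ᵥ u : L2 d)‖ₑ ≤ 2 * ‖u‖ₑ := by
      refine enorm_sub_le.trans ((add_le_add le_rfl (le_of_eq ?_)).trans_eq (two_mul _).symm)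
      rw [← ofReal_norm, DomAddAct.norm_vadd_Lp, ofReal_norm]
    calc _ ≤ (2 * ‖u‖ₑ) ^ 2 := by gcongr
      _ = 4 * ‖u‖ₑ ^ 2 := by rw [mul_pow]; norm_num
  · rw [lintegral_const_mul _ (by fun_prop)]
    exact (ENNReal.mul_lt_top (by norm_num) hμ).ne

/-- The average of the increments over a ball, by translation invariance. -/
lemma lintegral_setLAverage_correlationMeasure (μ : Measure (L2 d)) [IsProbabilityMeasure μ]
    (r : ℝ) :
    ∫⁻ x : Torus d, ⨍⁻ y in torusBall x r,
      (∫⁻ ξ, ‖ξ 0 - ξ 1‖ₑ ^ 2 ∂(correlationMeasure μ 2 ![x, y])) ∂volume =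
    (∫⁻ z in torusBall 0 r, increment μ z) / volume (torusBall (0 : Torus d) r) := by
  have hB : MeasurableSet (torusBall (0 : Torus d) r) := (isOpen_torusBall 0 r).measurableSet
  let f : Torus d → Torus d → L2 d → ℝ≥0∞ := fun x z u => ‖rep u x - rep u (x + z)‖ₑ ^ 2
  have hf : Measurable fun q : (Torus d × Torus d) × L2 d => f q.1.1 q.1.2 q.2 := by
    have h1 : Measurable fun q : (Torus d × Torus d) × L2 d => rep q.2 q.1.1 :=
      measurable_rep_comp measurable_snd (measurable_fst.comp measurable_fst)
    have h2 : Measurable fun q : (Torus d × Torus d) × L2 d => rep q.2 (q.1.1 + q.1.2) :=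
      measurable_rep_comp measurable_snd
        ((measurable_fst.comp measurable_fst).add (measurable_snd.comp measurable_fst))
    exact (h1.sub h2).enorm.pow_const 2
  have hν : ∀ x y : Torus d, ∫⁻ ξ, ‖ξ 0 - ξ 1‖ₑ ^ 2 ∂(correlationMeasure μ 2 ![x, y]) =
      ∫⁻ u, f x (y - x) u ∂μ := fun x y => by
    rw [correlationMeasure_apply, lintegral_map (by fun_prop) (measurable_rep_right 2 _)]
    simp [f]
  have hav : ∀ x : Torus d, ⨍⁻ y in torusBall x r,
      (∫⁻ ξ, ‖ξ 0 - ξ 1‖ₑ ^ 2 ∂(correlationMeasure μ 2 ![x, y])) ∂volume =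
      (volume (torusBall (0 : Torus d) r))⁻¹ *
        ∫⁻ z in torusBall 0 r, ∫⁻ u, f x z u ∂μ := fun x => by
    have mp := measurePreserving_sub_right (volume : Measure (Torus d)) x
    rw [setLAverage_eq, ENNReal.div_eq_inv_mul, torusBall_eq, mp.measure_preimage
      hB.nullMeasurableSet]
    simp only [hν]
    congr 1
    exact mp.setLIntegral_comp_preimage hB
      (hf.lintegral_prod_right'.comp measurable_prodMk_left)
  simp only [hav]
  have hm : Measurable fun q : Torus d × Torus d => ∫⁻ u, f q.1 q.2 u ∂μ :=
    hf.lintegral_prod_right'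
  rw [lintegral_const_mul _ hm.lintegral_prod_right', ENNReal.div_eq_inv_mul,
    lintegral_lintegral_swap hm.aemeasurable]
  congr 1
  refine lintegral_congr fun z => ?_
  rw [increment, lintegral_lintegral_swap]
  exact (hf.comp ((measurable_fst.prodMk measurable_const).prodMk measurable_snd)).aemeasurable

/-- Existence of the correlation measures of a measure with finite second moment. Symmetry and
consistency hold at every point; diagonal continuity is the continuity of translations in `L²`. -/
lemma isAssociated_correlationMeasure (μ : ProbabilityMeasure (L2 d))
    (hμ : ∫⁻ u, ‖u‖ₑ ^ 2 ∂(μ : Measure (L2 d)) < ⊤) :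
    IsAssociated (correlationMeasure (μ : Measure (L2 d))) μ where
  correlation :=
    { markov := fun k => inferInstance
      l2Bounded := by
        have h1 : ∀ x : Torus d, ∫⁻ ξ, ‖ξ 0‖ₑ ^ 2
            ∂(correlationMeasure (μ : Measure (L2 d)) 1 (fun _ => x)) =
            ∫⁻ u, ‖rep u x‖ₑ ^ 2 ∂(μ : Measure (L2 d)) := fun x => by
          rw [correlationMeasure_apply, lintegral_map (by fun_prop) (measurable_rep_right 1 _)]
        simp only [h1]
        rw [lintegral_lintegral_swap]
        · refine lt_of_le_of_lt (le_of_eq ?_) hμ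
          refine lintegral_congr fun u => ?_
          rw [enorm_sq_eq_lintegral]
          refine lintegral_congr_ae ?_
          filter_upwards [rep_ae_eq u] with x hx
          rw [hx]
        · exact ((measurable_rep.comp measurable_swap).enorm.pow_const 2).aemeasurable
      symmetric := fun k σ => .of_forall fun x => by
        rw [correlationMeasure_apply, correlationMeasure_apply,
          Measure.map_map (by fun_prop) (measurable_rep_right k x)]
        rfl
      consistent := fun k => .of_forall fun x => by
        rw [correlationMeasure_apply, correlationMeasure_apply,
          Measure.map_map (by fun_prop) (measurable_rep_right _ x)]
        rfl
      diagonalContinuity := by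
        simp only [lintegral_setLAverage_correlationMeasure]
        rw [ENNReal.tendsto_nhds_zero]
        intro ε hε
        have h1 := (ENNReal.tendsto_nhds_zero.1 (tendsto_increment hμ)) ε hε
        obtain ⟨δ, hδ, h2⟩ := Metric.eventually_nhds_iff.1 h1
        filter_upwards [Ioo_mem_nhdsGT hδ] with r hr
        have h3 : ∫⁻ z in torusBall 0 r, increment (μ : Measure (L2 d)) z ≤
            ∫⁻ z in torusBall (0 : Torus d) r, ε := by
          refine setLIntegral_mono measurable_const fun z hz => h2 ?_
          rw [dist_zero_right]
          exact (norm_lt_of_mem_torusBall hr.1 hz).trans hr.2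
        rw [setLIntegral_const] at h3
        exact (ENNReal.div_le_div_right h3 _).trans
          (ENNReal.div_le_of_le_mul (le_refl _)) }
  duality := fun k g => by
    refine integral_correlationMeasure _ (f := fun x ξ => g (x, ξ))
      (map_continuous g).measurable ?_
    have hb : ∀ p, ‖g p‖ₑ ≤ ENNReal.ofReal ‖g.toBCF‖ := fun p => by
      rw [← ofReal_norm]
      exact ENNReal.ofReal_le_ofReal (g.toBCF.norm_coe_le_norm p)
    refine lt_of_le_of_lt (lintegral_mono fun u => lintegral_mono fun x => hb _) ?_
    simp only [lintegral_const, measure_univ, mul_one]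
    exact ENNReal.mul_lt_top ENNReal.ofReal_lt_top (measure_lt_top _ _)

end

section

variable {d : ℕ}

/-! ### Correlation measures determine the observables of the measure -/

/-- Not found by instance search, which does not see the family of factors as constant. -/
instance (k : ℕ) : BorelSpace (Fin k → Torus d) :=
  @Pi.borelSpace (Fin k) (fun _ => Torus d) _ _ _ _ _

/-- The duality relation determines the correlation measures almost everywhere. -/
lemma IsAssociated.compProd_eq {ν : Hierarchy d} {μ : ProbabilityMeasure (L2 d)}
    (h : IsAssociated ν μ) (k : ℕ) :
    (volume : Measure (Fin k → Torus d)) ⊗ₘ ν k =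
      volume ⊗ₘ correlationMeasure (μ : Measure (L2 d)) k := by
  have := h.correlation.markov k
  have hreg : ∀ (ρ : Measure ((Fin k → Torus d) × (Fin k → Vec d))) [IsFiniteMeasure ρ],
      ρ.Regular := fun ρ _ => Measure.Regular.of_sigmaCompactSpace_of_isLocallyFiniteMeasure ρ
  have := hreg (volume ⊗ₘ ν k)
  have := hreg (volume ⊗ₘ correlationMeasure (μ : Measure (L2 d)) k)
  refine Measure.ext_of_integral_eq_on_compactlySupported fun g => ?_
  let g₀ : ZeroAtInftyContinuousMap ((Fin k → Torus d) × (Fin k → Vec d)) ℝ :=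
    ⟨g.toContinuousMap, zero_at_infty g⟩
  have hb : ∀ p, ‖g p‖ ≤ ‖g₀.toBCF‖ := g₀.toBCF.norm_coe_le_norm
  have hint : ∀ (ρ : Measure ((Fin k → Torus d) × (Fin k → Vec d))) [IsFiniteMeasure ρ],
      Integrable (fun p => g p) ρ := fun ρ _ =>
    .of_bound (map_continuous g).aestronglyMeasurable _ (.of_forall hb)
  rw [Measure.integral_compProd (hint _), Measure.integral_compProd (hint _)]
  refine (h.duality k g₀).trans (Eq.symm ?_)
  refine integral_correlationMeasure _ (f := fun x ξ => g (x, ξ)) (map_continuous g).measurable ?_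
  have hb' : ∀ p, ‖g p‖ₑ ≤ ENNReal.ofReal ‖g₀.toBCF‖ := fun p => by
    rw [← ofReal_norm]
    exact ENNReal.ofReal_le_ofReal (hb p)
  refine lt_of_le_of_lt (lintegral_mono fun u => lintegral_mono fun x => hb' _) ?_
  simp only [lintegral_const, measure_univ, mul_one]
  exact ENNReal.mul_lt_top ENNReal.ofReal_lt_top (measure_lt_top _ _)

/-- The duality relation, extended from `C₀` to all integrable observables. -/
lemma IsAssociated.integral_eq {ν : Hierarchy d} {μ : ProbabilityMeasure (L2 d)}
    (h : IsAssociated ν μ) {k : ℕ} {f : (Fin k → Torus d) → (Fin k → Vec d) → ℝ}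
    (hf : Measurable (Function.uncurry f))
    (hfin : ∫⁻ u : L2 d, (∫⁻ x, ‖f x (fun i => u (x i))‖ₑ) ∂(μ : Measure (L2 d)) < ⊤) :
    ∫ x, ∫ ξ, f x ξ ∂(ν k x) = ∫ u : L2 d, (∫ x, f x (fun i => u (x i))) ∂(μ : Measure (L2 d)) := by
  have := h.correlation.markov k
  rw [← integral_correlationMeasure _ hf hfin]
  have hint : Integrable (Function.uncurry f)
      (volume ⊗ₘ correlationMeasure (μ : Measure (L2 d)) k) := by
    refine ⟨hf.aestronglyMeasurable, ?_⟩
    rw [HasFiniteIntegral, Measure.lintegral_compProd hf.enorm]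
    exact (lintegral_correlationMeasure (μ : Measure (L2 d)) (f := fun x ξ => ‖f x ξ‖ₑ)
      hf.enorm).trans_lt hfin
  have hint' := hint
  rw [← h.compProd_eq k] at hint'
  have h1 := Measure.integral_compProd hint
  have h2 := Measure.integral_compProd hint'
  rw [h.compProd_eq k] at h2
  exact h2.symm.trans h1

lemma lintegral_prod_two {f g : Torus d → ℝ≥0∞} (hf : AEMeasurable f) (hg : AEMeasurable g) :
    ∫⁻ x : Fin 2 → Torus d, f (x 0) * g (x 1) = (∫⁻ x, f x) * ∫⁻ x, g x := by
  rw [← lintegral_prod_mul hf hg]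
  exact (measurePreserving_finTwoArrow (volume : Measure (Torus d))).lintegral_comp_emb
    (MeasurableEquiv.measurableEmbedding _) (fun q : Torus d × Torus d => f q.1 * g q.2)

lemma lintegral_enorm_dot_le (u : L2 d) {g : Torus d → Vec d} (hg : Continuous g) :
    ∫⁻ x, ‖dot (u x) (g x)‖ₑ ≤ ‖u‖ₑ * ‖contL2 g‖ₑ := by
  have h1 : ∫⁻ x, ‖dot (u x) (g x)‖ₑ ≤ ∫⁻ x, ‖u x‖ₑ * ‖contL2 g x‖ₑ := by
    refine lintegral_mono_ae ?_
    filter_upwards [coeFn_contL2 hg] with x hx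
    rw [hx, dot, ← ofReal_norm, ← ofReal_norm, ← ofReal_norm,
      ← ENNReal.ofReal_mul (norm_nonneg _)]
    exact ENNReal.ofReal_le_ofReal (norm_inner_le_norm _ _)
  refine h1.trans ?_
  have h2 := ENNReal.lintegral_mul_le_Lp_mul_Lq (volume : Measure (Torus d))
    (Real.HolderConjugate.two_two) (f := fun x => ‖u x‖ₑ) (g := fun x => ‖contL2 g x‖ₑ)
    (Lp.aestronglyMeasurable u).enorm (Lp.aestronglyMeasurable (contL2 g)).enorm
  refine h2.trans (le_of_eq ?_)
  rw [Lp.enorm_def u, Lp.enorm_def (contL2 g),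
    eLpNorm_eq_lintegral_rpow_enorm_toReal (by norm_num) (by norm_num),
    eLpNorm_eq_lintegral_rpow_enorm_toReal (by norm_num) (by norm_num)]
  rfl

/-- The two-point correlations evaluated on a pair of identical gradients give the second moment of
the corresponding observable. -/
lemma IsAssociated.integral_two_point {ν : Hierarchy d} {μ : ProbabilityMeasure (L2 d)}
    (h : IsAssociated ν μ) (hμ : ∫⁻ u, ‖u‖ₑ ^ 2 ∂(μ : Measure (L2 d)) < ⊤)
    {g : Torus d → Vec d} (hg : Continuous g) :
    ∫ x : Fin 2 → Torus d, (∫ ξ, dot (ξ 0) (g (x 0)) * dot (ξ 1) (g (x 1)) ∂(ν 2 x)) =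
      ∫ u : L2 d, (inner ℝ u (contL2 g)) ^ 2 ∂(μ : Measure (L2 d)) := by
  have hm : Measurable (Function.uncurry fun (x : Fin 2 → Torus d) (ξ : Fin 2 → Vec d) =>
      dot (ξ 0) (g (x 0)) * dot (ξ 1) (g (x 1))) := by
    unfold Function.uncurry dot
    have : Continuous fun a : (Fin 2 → Torus d) × (Fin 2 → Vec d) =>
        (inner ℝ (a.2 0) (g (a.1 0)) * inner ℝ (a.2 1) (g (a.1 1)) : ℝ) := by fun_prop
    exact this.measurable
  rw [h.integral_eq hm]
  · refine integral_congr_ae (.of_forall fun u => ?_)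
    have := integral_fintype_prod_volume_eq_prod (𝕜 := ℝ)
      (fun (_ : Fin 2) x => dot (u x) (g x))
    simp only [Fin.prod_univ_two] at this
    simp only [this, inner_contL2 u hg, sq]
  · have hd : ∀ u : L2 d, AEMeasurable fun x => ‖dot (u x) (g x)‖ₑ := fun u =>
      ((Lp.aestronglyMeasurable u).inner hg.aestronglyMeasurable).enorm
    have hle : ∀ u : L2 d, ∫⁻ x : Fin 2 → Torus d,
        ‖dot (u (x 0)) (g (x 0)) * dot (u (x 1)) (g (x 1))‖ₑ ≤ ‖contL2 g‖ₑ ^ 2 * ‖u‖ₑ ^ 2 := by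
      intro u
      simp only [enorm_mul]
      rw [lintegral_prod_two (hd u) (hd u)]
      refine (mul_le_mul' (lintegral_enorm_dot_le u hg) (lintegral_enorm_dot_le u hg)).trans
        (le_of_eq (by ring))
    refine (lintegral_mono hle).trans_lt ?_
    rw [lintegral_const_mul _ (by fun_prop)]
    exact ENNReal.mul_lt_top (by simp) hμ

/-- The divergence constraint on the two-point correlations forces almost every field to be
weakly divergence-free. -/
lemma ae_isDivFree {T : ℝ} {μ : ℝ → ProbabilityMeasure (L2 d)} {ν : ℝ → Hierarchy d}
    (hν : ∀ᵐ t ∂(volume.restrict (Set.Ico 0 T)), IsAssociated (ν t) (μ t))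
    (hμ : ∀ᵐ t ∂(volume.restrict (Set.Ico 0 T)), ∫⁻ u, ‖u‖ₑ ^ 2 ∂(μ t : Measure (L2 d)) < ⊤)
    (hdiv : ∀ ψ : Torus d → ℝ, ContDiff ℝ ∞ (fun y : Vec d => ψ (toTorus y)) →
      ∀ᵐ t ∂(volume.restrict (Set.Ico 0 T)),
        ∫ x : Fin 2 → Torus d,
          (∫ ξ, dot (ξ 0) (grad ψ (x 0)) * dot (ξ 1) (grad ψ (x 1)) ∂(ν t 2 x)) = 0) :
    ∀ᵐ t ∂(volume.restrict (Set.Ico 0 T)), ∀ᵐ u ∂(μ t : Measure (L2 d)), IsDivFree u := by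
  let S : Set (L2 d) := {w | ∃ ψ : Torus d → ℝ, ContDiff ℝ ∞ (fun y : Vec d => ψ (toTorus y)) ∧
    w = contL2 (grad ψ)}
  -- `L²` is separable: countably many gradients suffice, which gives one null set of times
  obtain ⟨c, hc, hcc, hSc⟩ : ∃ c ⊆ S, c.Countable ∧ S ⊆ closure c :=
    (TopologicalSpace.IsSeparable.of_separableSpace S).exists_countable_dense_subset
  have key : ∀ w ∈ c, ∀ᵐ t ∂(volume.restrict (Set.Ico 0 T)),
      ∀ᵐ u ∂(μ t : Measure (L2 d)), inner ℝ u w = (0 : ℝ) := by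
    intro w hw
    obtain ⟨ψ, hψ, rfl⟩ := hc hw
    have hg : Continuous (grad ψ) := continuous_grad (hψ.of_le (mod_cast le_top))
    filter_upwards [hν, hμ, hdiv ψ hψ] with t h1 h2 h3
    rw [h1.integral_two_point h2 hg] at h3
    have hint : Integrable (fun u : L2 d => (inner ℝ u (contL2 (grad ψ)) : ℝ) ^ 2)
        (μ t : Measure (L2 d)) := by
      have hcont : Continuous fun u : L2 d => (inner ℝ u (contL2 (grad ψ)) : ℝ) ^ 2 := by fun_prop
      refine ⟨hcont.aestronglyMeasurable, ?_⟩
      have hle : ∀ u : L2 d, ‖(inner ℝ u (contL2 (grad ψ)) : ℝ) ^ 2‖ₑ ≤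
          ‖contL2 (grad ψ)‖ₑ ^ 2 * ‖u‖ₑ ^ 2 := fun u => by
        rw [enorm_pow, ← mul_pow]
        gcongr
        rw [← ofReal_norm, ← ofReal_norm, ← ofReal_norm, ← ENNReal.ofReal_mul (norm_nonneg _)]
        exact ENNReal.ofReal_le_ofReal ((norm_inner_le_norm _ _).trans_eq (mul_comm _ _))
      refine (lintegral_mono hle).trans_lt ?_
      rw [lintegral_const_mul _ (by fun_prop)]
      exact ENNReal.mul_lt_top (by simp) h2
    rw [integral_eq_zero_iff_of_nonneg (fun u => by positivity) hint] at h3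
    filter_upwards [h3] with u hu
    exact pow_eq_zero_iff (two_ne_zero) |>.1 hu
  filter_upwards [(ae_ball_iff hcc).2 key] with t ht
  filter_upwards [(ae_ball_iff hcc).2 ht] with u hu ψ hψ
  have hcl : IsClosed {w : L2 d | inner ℝ u w = (0 : ℝ)} :=
    isClosed_eq (by fun_prop) continuous_const
  exact closure_minimal hu hcl (hSc ⟨ψ, hψ, rfl⟩)

end

section

variable {d : ℕ}

/-! ### Decompositions and stability of their components -/

section Decomposition

variable {M : ℕ} {α : Fin M → ℝ≥0} {μ : ProbabilityMeasure (L2 d)}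
  {μs : Fin M → ProbabilityMeasure (L2 d)}

lemma IsDecomposition.lintegral_eq (h : IsDecomposition α μ μs) (f : L2 d → ℝ≥0∞) :
    ∑ i, (α i : ℝ≥0∞) * ∫⁻ u, f u ∂(μs i : Measure (L2 d)) = ∫⁻ u, f u ∂(μ : Measure (L2 d)) := by
  rw [← h, lintegral_finsetSum_measure]
  refine Finset.sum_congr rfl fun i _ => ?_
  rw [lintegral_smul_measure]
  rfl

lemma IsDecomposition.lintegral_lt_top (h : IsDecomposition α μ μs) {i : Fin M} (hα : 0 < α i)
    {f : L2 d → ℝ≥0∞} (hf : ∫⁻ u, f u ∂(μ : Measure (L2 d)) < ⊤) :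
    ∫⁻ u, f u ∂(μs i : Measure (L2 d)) < ⊤ := by
  rw [← h.lintegral_eq] at hf
  have h1 := (ENNReal.sum_lt_top.1 hf) i (Finset.mem_univ i)
  refine lt_top_iff_ne_top.2 fun h2 => ?_
  rw [h2, ENNReal.mul_top (by simpa using hα.ne')] at h1
  exact lt_irrefl _ h1

/-- Almost sure properties of a measure, such as being divergence-free, pass to its components. -/
lemma IsDecomposition.absolutelyContinuous (h : IsDecomposition α μ μs) {i : Fin M}
    (hα : 0 < α i) : (μs i : Measure (L2 d)) ≪ (μ : Measure (L2 d)) := by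
  intro s hs
  rw [← h, Measure.finsetSum_apply] at hs
  have h1 := (Finset.sum_eq_zero_iff.1 hs) i (Finset.mem_univ i)
  rw [Measure.smul_apply, smul_eq_zero] at h1
  exact h1.resolve_left hα.ne'

end Decomposition

lemma integrable_norm_sq_iff {ρ : Measure (L2 d)} :
    Integrable (fun u : L2 d => ‖u‖ ^ 2) ρ ↔ ∫⁻ u, ‖u‖ₑ ^ 2 ∂ρ < ⊤ := by
  have hc : Continuous fun u : L2 d => ‖u‖ ^ 2 := by fun_prop
  have he : ∀ u : L2 d, ‖‖u‖ ^ 2‖ₑ = ‖u‖ₑ ^ 2 := fun u => by rw [enorm_pow, enorm_norm]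
  simp only [Integrable, hc.aestronglyMeasurable, true_and, HasFiniteIntegral, he]

lemma lintegral_norm_sub_sq {ρ : Measure (L2 d)} (w : L2 d)
    (h : Integrable (fun u : L2 d => ‖u - w‖ ^ 2) ρ) :
    ∫⁻ u, ‖u - w‖ₑ ^ 2 ∂ρ = ENNReal.ofReal (∫ u, ‖u - w‖ ^ 2 ∂ρ) := by
  rw [ofReal_integral_eq_lintegral_ofReal h (.of_forall fun u => by positivity)]
  refine lintegral_congr fun u => ?_
  rw [ENNReal.ofReal_pow (norm_nonneg _), ofReal_norm]

lemma integral_norm_sq_le_of_lintegral_le {ρ ρ' : Measure (L2 d)}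
    (h' : Integrable (fun u : L2 d => ‖u‖ ^ 2) ρ')
    (hle : ∫⁻ u, ‖u‖ₑ ^ 2 ∂ρ ≤ ∫⁻ u, ‖u‖ₑ ^ 2 ∂ρ') :
    Integrable (fun u : L2 d => ‖u‖ ^ 2) ρ ∧ ∫ u, ‖u‖ ^ 2 ∂ρ ≤ ∫ u, ‖u‖ ^ 2 ∂ρ' := by
  have h : Integrable (fun u : L2 d => ‖u‖ ^ 2) ρ :=
    integrable_norm_sq_iff.2 (hle.trans_lt (integrable_norm_sq_iff.1 h'))
  refine ⟨h, ?_⟩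
  have e : ∀ {ρ : Measure (L2 d)}, Integrable (fun u : L2 d => ‖u‖ ^ 2) ρ →
      ∫⁻ u, ‖u‖ₑ ^ 2 ∂ρ = ENNReal.ofReal (∫ u, ‖u‖ ^ 2 ∂ρ) := fun {ρ} h => by
    simpa using lintegral_norm_sub_sq (ρ := ρ) 0 (by simpa using h)
  rw [e h, e h'] at hle
  exact (ENNReal.ofReal_le_ofReal_iff (integral_nonneg fun u => by positivity)).1 hle

/-- The trivial decomposition into a single component yields the energy inequality for the solution
itself. -/
lemma IsDissipativeSolution.ae_lintegral_sq_lt_top {T : ℝ} {μbar : ProbabilityMeasure (L2 d)}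
    {μ : ℝ → ProbabilityMeasure (L2 d)} (h : IsDissipativeSolution T μbar μ)
    (h2 : ∫⁻ u, ‖u‖ₑ ^ 2 ∂(μbar : Measure (L2 d)) < ⊤) :
    ∀ᵐ t ∂(volume.restrict (Set.Ico 0 T)), ∫⁻ u, ‖u‖ₑ ^ 2 ∂(μ t : Measure (L2 d)) < ⊤ := by
  obtain ⟨μs, hdec, hμs⟩ := h.dissipative 1 (fun _ => 1) (fun _ => one_pos) (by simp)
    (fun _ => μbar) (by simp [IsDecomposition])
  filter_upwards [(hμs 0).2.2.2, ae_restrict_mem measurableSet_Ico] with t ht htm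
  have := (hdec t htm).lintegral_eq (fun u => ‖u‖ₑ ^ 2)
  rw [← this]
  simpa using ht.trans_lt h2

/-- The components of a dissipative solution that correspond to a decomposition of the initial
measure stay close to classical solutions that start close to the components of the initial
measure. -/
lemma IsDissipativeSolution.ae_exists_decomposition {T : ℝ} (hT : 0 < T)
    {μbar : ProbabilityMeasure (L2 d)} {μ : ℝ → ProbabilityMeasure (L2 d)}
    (h : IsDissipativeSolution T μbar μ) (h2 : ∫⁻ u, ‖u‖ₑ ^ 2 ∂(μbar : Measure (L2 d)) < ⊤)
    {M : ℕ} {α : Fin M → ℝ≥0} (hα : ∀ i, 0 < α i) (hsum : ∑ i, α i = 1)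
    {μbars : Fin M → ProbabilityMeasure (L2 d)} (hdec : IsDecomposition α μbar μbars)
    {v : Fin M → ℝ → Torus d → Vec d} {C : Fin M → ℝ}
    (hv : ∀ i, IsLipschitzSolution T (v i) (C i)) :
    ∀ᵐ t ∂(volume.restrict (Set.Ico 0 T)), ∃ m : Fin M → ProbabilityMeasure (L2 d),
      IsDecomposition α (μ t) m ∧ ∀ i,
        ∫⁻ u, ‖u - contL2 (v i t)‖ₑ ^ 2 ∂(m i : Measure (L2 d)) ≤
          ENNReal.ofReal (Real.exp (2 * (C i * T))) *
            ∫⁻ u, ‖u - contL2 (v i 0)‖ₑ ^ 2 ∂(μbars i : Measure (L2 d)) := by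
  obtain ⟨ν, νbar, hν, -, -, hdiv⟩ := h.statistical.equations
  have hdf := ae_isDivFree hν (h.ae_lintegral_sq_lt_top h2) hdiv
  obtain ⟨μs, hdect, hμs⟩ := h.dissipative M α hα hsum μbars hdec
  have hmem : ∀ᵐ t ∂(volume.restrict (Set.Ico 0 T)), t ∈ Set.Ico 0 T :=
    ae_restrict_mem measurableSet_Ico
  have key : ∀ i, ∀ᵐ t ∂(volume.restrict (Set.Ico 0 T)),
      ∫⁻ u, ‖u - contL2 (v i t)‖ₑ ^ 2 ∂(μs i t : Measure (L2 d)) ≤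
        ENNReal.ofReal (Real.exp (2 * (C i * T))) *
          ∫⁻ u, ‖u - contL2 (v i 0)‖ₑ ^ 2 ∂(μbars i : Measure (L2 d)) := by
    intro i
    obtain ⟨hw, -, hE, hen⟩ := hμs i
    obtain ⟨κ, hκm, hκ⟩ := hw.exists_kernel
    have h₀ : Integrable (fun u : L2 d => ‖u‖ ^ 2) (μbars i : Measure (L2 d)) :=
      integrable_norm_sq_iff.2 (hdec.lintegral_lt_top (hα i) h2)
    have hen' : ∀ᵐ t ∂(volume.restrict (Set.Ico 0 T)),
        Integrable (fun u : L2 d => ‖u‖ ^ 2) (κ t) ∧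
          ∫ u, ‖u‖ ^ 2 ∂(κ t) ≤ ∫ u, ‖u‖ ^ 2 ∂(μbars i : Measure (L2 d)) := by
      filter_upwards [hκ, hen] with t h1 h2
      rw [h1]
      exact integral_norm_sq_le_of_lintegral_le h₀ h2
    have hdiv' : ∀ᵐ t ∂(volume.restrict (Set.Ico 0 T)), ∀ᵐ u ∂(κ t), IsDivFree u := by
      filter_upwards [hκ, hdf, hmem] with t h1 h2 htm
      rw [h1]
      exact ((hdect t htm).absolutelyContinuous (hα i)).ae_le h2
    have hweak : ∀ φ, IsTestField T φ → ∫ t in Set.Ico 0 T, (∫ u, rate T φ t u ∂(κ t)) =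
        -∫ u : L2 d, (inner ℝ u (contL2 (φ 0)) : ℝ) ∂(μbars i : Measure (L2 d)) := by
      intro φ hφ
      have hφ1 : IsCn 1 T φ := hφ.smooth.mono (mod_cast le_top)
      have h3 := hE φ hφ
      have hc0 : Continuous (φ 0) := hφ1.jointlyContinuous.slice ⟨le_rfl, hT⟩
      simp only [← inner_contL2 _ hc0] at h3
      rw [← h3]
      refine integral_congr_ae ?_
      filter_upwards [hκ, hmem] with t h1 htm
      simp only [h1, rate_eq_integral hφ1 htm]
    filter_upwards [ae_integral_norm_sub_sq_le hT h₀ hen' hdiv' hweak (hv i), hκ, hen'] with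
      t h1 h2 h3
    rw [← h2, lintegral_norm_sub_sq _ (integrable_norm_sub_sq h3.1 _),
      lintegral_norm_sub_sq _ (integrable_norm_sub_sq h₀ _), ← ENNReal.ofReal_mul (by positivity)]
    exact ENNReal.ofReal_le_ofReal h1
  filter_upwards [ae_all_iff.2 key, hmem] with t ht htm
  exact ⟨fun i => μs i t, hdect t htm, ht⟩

/-- The same stability statement for the pieces into which a measurable map with finitely many
values splits the initial measure; pieces of measure zero are allowed. -/
lemma IsDissipativeSolution.ae_exists_pieces {T : ℝ} (hT : 0 < T)
    {μbar : ProbabilityMeasure (L2 d)} {μ : ℝ → ProbabilityMeasure (L2 d)}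
    (h : IsDissipativeSolution T μbar μ) (h2 : ∫⁻ u, ‖u‖ₑ ^ 2 ∂(μbar : Measure (L2 d)) < ⊤)
    {ι : Type} [Fintype ι] {f : L2 d → ι} (hf : ∀ i, MeasurableSet (f ⁻¹' {i}))
    {v : ι → ℝ → Torus d → Vec d} {C : ι → ℝ} (hv : ∀ i, IsLipschitzSolution T (v i) (C i)) :
    ∀ᵐ t ∂(volume.restrict (Set.Ico 0 T)), ∃ m : ι → Measure (L2 d),
      ∑ i, m i = (μ t : Measure (L2 d)) ∧ ∀ i, m i Set.univ = (μbar : Measure (L2 d)) (f ⁻¹' {i}) ∧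
        ∫⁻ u, ‖u - contL2 (v i t)‖ₑ ^ 2 ∂(m i) ≤
          ENNReal.ofReal (Real.exp (2 * (C i * T))) *
            ∫⁻ u in f ⁻¹' {i}, ‖u - contL2 (v i 0)‖ₑ ^ 2 ∂(μbar : Measure (L2 d)) := by
  classical
  let P : Measure (L2 d) := μbar
  -- the components are the conditional measures on the pieces of positive measure
  let J : Type := {i : ι // P (f ⁻¹' {i}) ≠ 0}
  let e : J ≃ Fin (Fintype.card J) := Fintype.equivFin J
  let α : Fin (Fintype.card J) → ℝ≥0 := fun k => (P (f ⁻¹' {(e.symm k).1})).toNNReal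
  let μbars : Fin (Fintype.card J) → ProbabilityMeasure (L2 d) := fun k =>
    ⟨P[|f ⁻¹' {(e.symm k).1}], cond_isProbabilityMeasure (e.symm k).2⟩
  have hα' : ∀ k, (α k : ℝ≥0∞) = P (f ⁻¹' {(e.symm k).1}) := fun k =>
    ENNReal.coe_toNNReal (measure_ne_top _ _)
  have hα : ∀ k, 0 < α k := fun k =>
    ENNReal.toNNReal_pos (e.symm k).2 (measure_ne_top _ _)
  have hres : ∀ k, α k • (μbars k : Measure (L2 d)) = P.restrict (f ⁻¹' {(e.symm k).1}) := by
    intro k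
    have : α k • (μbars k : Measure (L2 d)) = (α k : ℝ≥0∞) • P[|f ⁻¹' {(e.symm k).1}] := rfl
    rw [this, ProbabilityTheory.cond, smul_smul, hα',
      ENNReal.mul_inv_cancel (e.symm k).2 (measure_ne_top _ _), one_smul]
  have hsumJ : ∀ {N : Type} [AddCommMonoid N] (g : ι → N), (∀ i, P (f ⁻¹' {i}) = 0 → g i = 0) →
      ∑ k, g (e.symm k).1 = ∑ i, g i := by
    intro N _ g hg
    rw [Equiv.sum_comp e.symm (fun j : J => g j.1),
      ← Finset.sum_subtype (Finset.univ.filter fun i => P (f ⁻¹' {i}) ≠ 0) (by simp) g]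
    exact Finset.sum_filter_of_ne fun i _ hi hP => hi (hg i hP)
  have hdec : IsDecomposition α μbar μbars := by
    rw [IsDecomposition]
    simp only [hres]
    rw [hsumJ (fun i => P.restrict (f ⁻¹' {i})) fun i hi => Measure.restrict_eq_zero.2 hi]
    have h1 := Measure.restrict_iUnion (μ := P) (s := fun i => f ⁻¹' {i})
      (fun i j hij => Disjoint.preimage f (Set.disjoint_singleton.2 hij)) hf
    have h3 : (⋃ i, f ⁻¹' {i}) = Set.univ := by
      ext u; simp
    rw [h3, Measure.restrict_univ, Measure.sum_fintype] at h1
    exact h1.symm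
  have hsum : ∑ k, α k = 1 := by
    have := hdec.lintegral_eq (fun _ => 1)
    simp only [lintegral_const, measure_univ, mul_one] at this
    exact_mod_cast this
  filter_upwards [h.ae_exists_decomposition hT h2 hα hsum hdec
    (v := fun k => v (e.symm k).1) (C := fun k => C (e.symm k).1) fun k => hv _] with
    t ⟨m, hm, hle⟩
  refine ⟨fun i => if hi : P (f ⁻¹' {i}) ≠ 0 then P (f ⁻¹' {i}) • (m (e ⟨i, hi⟩) : Measure (L2 d))
    else 0, ?_, fun i => ?_⟩
  · rw [← hsumJ _ fun i hi => by simp [hi]]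
    rw [← show _ = _ from hm]
    refine Finset.sum_congr rfl fun k _ => ?_
    rw [dif_pos (e.symm k).2, ← hα']
    simp only [Subtype.coe_eta, Equiv.apply_symm_apply]
    rfl
  · by_cases hi : P (f ⁻¹' {i}) = 0
    · beta_reduce
      rw [dif_neg (not_not.2 hi)]
      exact ⟨by simpa using hi.symm, by simp⟩
    · beta_reduce
      rw [dif_pos hi]
      refine ⟨by simp [P], ?_⟩
      have h3 := hle (e ⟨i, hi⟩)
      have h4 := hres (e ⟨i, hi⟩)
      simp only [Equiv.symm_apply_apply] at h3 h4
      rw [lintegral_smul_measure, smul_eq_mul]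
      change _ ≤ _ * ∫⁻ u, _ ∂(P.restrict (f ⁻¹' {i}))
      rw [← h4]
      have h5 : ∫⁻ u, ‖u - contL2 (v i 0)‖ₑ ^ 2 ∂(α (e ⟨i, hi⟩) •
          (μbars (e ⟨i, hi⟩) : Measure (L2 d))) = (α (e ⟨i, hi⟩) : ℝ≥0∞) *
            ∫⁻ u, ‖u - contL2 (v i 0)‖ₑ ^ 2 ∂(μbars (e ⟨i, hi⟩) : Measure (L2 d)) := by
        rw [lintegral_smul_measure]; rfl
      rw [h5, hα', Equiv.symm_apply_apply, mul_left_comm]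
      gcongr

end

section

variable {d : ℕ}

/-! ### Uniqueness -/

/-- By the Lindelöf property, countably many balls around classical data, with radii adapted to the
stability constants, cover the generic set. -/
lemma exists_lipschitzSolution_cover {T : ℝ} (hT : 0 < T) (hne : (genericSet d T).Nonempty)
    {δ : ℝ} (hδ : 0 < δ) : ∃ (v : ℕ → ℝ → Torus d → Vec d) (C : ℕ → ℝ),
      (∀ j, IsLipschitzSolution T (v j) (C j)) ∧
        genericSet d T ⊆ ⋃ j, Metric.ball (contL2 (v j 0)) (δ * Real.exp (-(C j * T))) := by
  obtain ⟨n, hn⟩ := exists_nat_one_div_lt hδ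
  choose v C hv hvC using fun u : genericSet d T => exists_lipschitzSolution_near hT u.2 n
  let B : genericSet d T → Set (L2 d) := fun u =>
    Metric.ball (contL2 (v u 0)) (δ * Real.exp (-(C u * T)))
  have hmem : ∀ u : genericSet d T, (u : L2 d) ∈ B u := fun u => by
    rw [Metric.mem_ball, dist_eq_norm]
    exact (hvC u).trans_le (mul_le_mul_of_nonneg_right hn.le (Real.exp_nonneg _))
  obtain ⟨S, hS, hSB⟩ := TopologicalSpace.isOpen_iUnion_countable B fun u => Metric.isOpen_ball
  have hSne : S.Nonempty := by
    obtain ⟨u, hu⟩ := hne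
    have : u ∈ ⋃ i ∈ S, B i := hSB ▸ Set.mem_iUnion.2 ⟨⟨u, hu⟩, hmem ⟨u, hu⟩⟩
    obtain ⟨i, hi, -⟩ := Set.mem_iUnion₂.1 this
    exact ⟨i, hi⟩
  obtain ⟨g, hg⟩ := hS.exists_eq_range hSne
  refine ⟨fun j => v (g j), fun j => C (g j), fun j => hv _, fun u hu => ?_⟩
  have : u ∈ ⋃ i ∈ S, B i := hSB ▸ Set.mem_iUnion.2 ⟨⟨u, hu⟩, hmem ⟨u, hu⟩⟩
  obtain ⟨i, hi, hui⟩ := Set.mem_iUnion₂.1 this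
  rw [hg] at hi
  obtain ⟨j, rfl⟩ := hi
  exact Set.mem_iUnion.2 ⟨j, hui⟩

section Lipschitz

variable {m : Measure (L2 d)} [IsFiniteMeasure m] {F : L2 d → ℝ} {B : ℝ} {L : ℝ≥0}

lemma integrable_of_lipschitz (hF : ∀ x y, dist (F x) (F y) ≤ B) (hL : LipschitzWith L F) :
    Integrable F m := by
  refine .of_bound hL.continuous.aestronglyMeasurable (|F 0| + B) (.of_forall fun u => ?_)
  have h1 := hF u 0
  rw [Real.dist_eq] at h1
  have h2 := abs_sub_abs_le_abs_sub (F u) (F 0)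
  rw [Real.norm_eq_abs]
  linarith

/-- A measure of small mass contributes little. -/
lemma abs_integral_sub_le_of_oscillation (hF : ∀ x y, dist (F x) (F y) ≤ B)
    (hL : LipschitzWith L F) (w : L2 d) :
    |∫ u, F u ∂m - m.real Set.univ * F w| ≤ B * m.real Set.univ := by
  have h1 : ∫ u, F u ∂m - m.real Set.univ * F w = ∫ u, (F u - F w) ∂m := by
    rw [integral_sub (integrable_of_lipschitz hF hL) (integrable_const _)]
    simp
  rw [h1, ← Real.norm_eq_abs]
  refine norm_integral_le_of_norm_le_const (.of_forall fun u => ?_)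
  rw [← dist_eq_norm]
  exact hF u w

/-- A measure that is concentrated near `w` in mean square acts on Lipschitz functions almost like a
point mass. -/
lemma abs_integral_sub_le_of_sq (hF : ∀ x y, dist (F x) (F y) ≤ B) (hL : LipschitzWith L F)
    {w : L2 d} {δ : ℝ} (hδ : 0 < δ)
    (hsq : ∫⁻ u, ‖u - w‖ₑ ^ 2 ∂m ≤ ENNReal.ofReal (δ ^ 2 * m.real Set.univ)) :
    |∫ u, F u ∂m - m.real Set.univ * F w| ≤ L * δ * m.real Set.univ := by
  have h1 : ∫ u, F u ∂m - m.real Set.univ * F w = ∫ u, (F u - F w) ∂m := by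
    rw [integral_sub (integrable_of_lipschitz hF hL) (integrable_const _)]
    simp
  have hint : Integrable (fun u : L2 d => ‖u - w‖ ^ 2) m := by
    have hc : Continuous fun u : L2 d => ‖u - w‖ ^ 2 := by fun_prop
    refine ⟨hc.aestronglyMeasurable, ?_⟩
    have he : ∀ u : L2 d, ‖‖u - w‖ ^ 2‖ₑ = ‖u - w‖ₑ ^ 2 := fun u => by
      rw [enorm_pow, enorm_norm]
    simp only [HasFiniteIntegral, he]
    exact hsq.trans_lt ENNReal.ofReal_lt_top
  rw [lintegral_norm_sub_sq w hint, ENNReal.ofReal_le_ofReal_iff (by positivity)] at hsq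
  rw [h1, ← Real.norm_eq_abs]
  -- Young's inequality `a ≤ (a² / δ + δ) / 2`
  have hpt : ∀ u : L2 d, ‖F u - F w‖ ≤ L / (2 * δ) * ‖u - w‖ ^ 2 + L * δ / 2 := fun u => by
    have h2 := hL.dist_le_mul u w
    rw [dist_eq_norm, dist_eq_norm] at h2
    have h3 : ‖u - w‖ ≤ 1 / (2 * δ) * ‖u - w‖ ^ 2 + δ / 2 := by
      have : 0 ≤ (‖u - w‖ - δ) ^ 2 / (2 * δ) := by positivity
      have e : (‖u - w‖ - δ) ^ 2 / (2 * δ) = 1 / (2 * δ) * ‖u - w‖ ^ 2 + δ / 2 - ‖u - w‖ := by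
        field_simp
        ring
      linarith
    refine h2.trans ((mul_le_mul_of_nonneg_left h3 L.coe_nonneg).trans (le_of_eq ?_))
    field_simp
  have hbd : Integrable (fun u : L2 d => L / (2 * δ) * ‖u - w‖ ^ 2 + L * δ / 2) m :=
    (hint.const_mul _).add (integrable_const _)
  refine (norm_integral_le_of_norm_le hbd (.of_forall hpt)).trans ?_
  rw [integral_add (hint.const_mul _) (integrable_const _), integral_const_mul, integral_const,
    smul_eq_mul]
  have h4 : (L : ℝ) / (2 * δ) * ∫ u, ‖u - w‖ ^ 2 ∂m ≤
      L / (2 * δ) * (δ ^ 2 * m.real Set.univ) := by gcongr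
  refine (add_le_add_left h4 _).trans (le_of_eq ?_)
  field_simp
  ring

end Lipschitz

/-- All dissipative solutions with the same generic initial measure are close to the same finite
combination of point masses on classical solutions. -/
lemma exists_approximate_integral {T : ℝ} (hT : 0 < T) {μbar : ProbabilityMeasure (L2 d)}
    (hG : (μbar : Measure (L2 d)) (genericSet d T) = 1)
    (h2 : ∫⁻ u, ‖u‖ₑ ^ 2 ∂(μbar : Measure (L2 d)) < ⊤) {δ : ℝ} (hδ : 0 < δ) :
    ∃ G : ℝ → (L2 d → ℝ) → ℝ, ∀ μ : ℝ → ProbabilityMeasure (L2 d),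
      IsDissipativeSolution T μbar μ → ∀ᵐ t ∂(volume.restrict (Set.Ico 0 T)),
        ∀ (F : L2 d → ℝ) (B : ℝ) (L : ℝ≥0), (∀ x y, dist (F x) (F y) ≤ B) → LipschitzWith L F →
          |∫ u, F u ∂(μ t : Measure (L2 d)) - G t F| ≤ (L + B) * δ := by
  classical
  let P : Measure (L2 d) := μbar
  have hne : (genericSet d T).Nonempty := by
    by_contra h
    rw [Set.not_nonempty_iff_eq_empty.1 h, measure_empty] at hG
    exact zero_ne_one hG
  obtain ⟨v, C, hv, hcov⟩ := exists_lipschitzSolution_cover hT hne hδ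
  let A : ℕ → Set (L2 d) := fun j => Metric.ball (contL2 (v j 0)) (δ * Real.exp (-(C j * T)))
  have hP : P (⋃ j, A j) = 1 :=
    le_antisymm prob_le_one (hG.symm.le.trans (measure_mono hcov))
  obtain ⟨N, hN⟩ : ∃ N, 1 - ENNReal.ofReal δ < P (Set.accumulate A N) := by
    have h := tendsto_measure_iUnion_accumulate (μ := P) (f := A)
    rw [hP] at h
    exact (h.eventually_const_lt
      (ENNReal.sub_lt_self (by simp) (by simp) (by simpa using hδ))).exists
  have hex : ∀ u : L2 d, ∃ j, u ∈ A j ∨ N < j := fun u => ⟨N + 1, .inr (by omega)⟩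
  have hle : ∀ u, Nat.find (hex u) < N + 2 := fun u =>
    (Nat.find_min' (hex u) (.inr (Nat.lt_succ_self N))).trans_lt (by omega)
  -- the first ball that contains `u`, or `N + 1` when none of the first `N + 1` balls does
  let f : L2 d → Fin (N + 2) := fun u => ⟨Nat.find (hex u), hle u⟩
  have hfm : ∀ i, MeasurableSet (f ⁻¹' {i}) := by
    intro i
    have h1 : Measurable fun u => Nat.find (hex u) := by
      refine measurable_find hex fun j => ?_
      exact (Metric.isOpen_ball.measurableSet).union (MeasurableSet.const _)
    have h3 : f ⁻¹' {i} = (fun u => Nat.find (hex u)) ⁻¹' {(i : ℕ)} := by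
      ext u
      simp [f, Fin.ext_iff]
    rw [h3]
    exact h1 (measurableSet_singleton _)
  have hin : ∀ i : Fin (N + 2), i ≠ Fin.last (N + 1) → f ⁻¹' {i} ⊆ A i := by
    intro i hi u hu
    have h1 : Nat.find (hex u) = i := congrArg Fin.val hu
    have h3 := Nat.find_spec (hex u)
    rw [h1] at h3
    refine h3.resolve_right fun h4 => hi ?_
    have := i.2
    exact Fin.ext (by simp; omega)
  have hlast : P.real (f ⁻¹' {Fin.last (N + 1)}) ≤ δ := by
    have h1 : f ⁻¹' {Fin.last (N + 1)} ⊆ (Set.accumulate A N)ᶜ := by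
      intro u hu hu'
      have h1 : Nat.find (hex u) = N + 1 := congrArg Fin.val hu
      obtain ⟨j, hj, huj⟩ := Set.mem_accumulate.1 hu'
      have := Nat.find_min' (hex u) (.inl huj)
      omega
    have hacc : MeasurableSet (Set.accumulate A N) := by
      rw [Set.accumulate_def]
      exact .biUnion (Set.to_countable _) fun j _ => Metric.isOpen_ball.measurableSet
    have h3 : P (f ⁻¹' {Fin.last (N + 1)}) ≤ ENNReal.ofReal δ := by
      refine (measure_mono h1).trans ?_
      rw [prob_compl_eq_one_sub hacc]
      exact tsub_le_iff_tsub_le.1 hN.le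
    exact ENNReal.toReal_le_of_le_ofReal hδ.le h3
  -- on the piece of index `i` the solution is compared to the point mass at `v i t`; on the last
  -- piece, of mass at most `δ`, any point will do
  refine ⟨fun t F => ∑ i : Fin (N + 2), P.real (f ⁻¹' {i}) * F (contL2 (v i t)), fun μ hμ => ?_⟩
  filter_upwards [hμ.ae_exists_pieces hT h2 hfm (v := fun i => v i) (C := fun i => C i)
    fun i => hv i] with t ⟨m, hm, hmi⟩ F B L hF hL
  have hfin : ∀ i, IsFiniteMeasure (m i) := fun i => ⟨by
    rw [(hmi i).1]; exact measure_lt_top _ _⟩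
  have hreal : ∀ i, (m i).real Set.univ = P.real (f ⁻¹' {i}) := fun i => by
    rw [Measure.real, (hmi i).1]; rfl
  have hB : 0 ≤ B := dist_nonneg.trans (hF 0 0)
  rw [← hm, integral_finsetSum_measure fun i _ => integrable_of_lipschitz hF hL,
    ← Finset.sum_sub_distrib]
  have key : ∀ i, |∫ u, F u ∂(m i) - P.real (f ⁻¹' {i}) * F (contL2 (v i t))| ≤
      L * δ * P.real (f ⁻¹' {i}) + if i = Fin.last (N + 1) then B * δ else 0 := by
    intro i
    rw [← hreal]
    split_ifs with hi
    · refine (abs_integral_sub_le_of_oscillation hF hL _).trans ?_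
      have h1 : B * (m i).real Set.univ ≤ B * δ := by
        rw [hreal, hi]
        exact mul_le_mul_of_nonneg_left hlast hB
      have h3 : 0 ≤ L * δ * (m i).real Set.univ := by positivity
      linarith
    · rw [add_zero]
      refine abs_integral_sub_le_of_sq hF hL hδ ((hmi i).2.trans ?_)
      have h3 : ∫⁻ u in f ⁻¹' {i}, ‖u - contL2 (v i 0)‖ₑ ^ 2 ∂P ≤
          ENNReal.ofReal ((δ * Real.exp (-(C i * T))) ^ 2) * P (f ⁻¹' {i}) := by
        rw [← setLIntegral_const]
        refine setLIntegral_mono measurable_const fun u hu => ?_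
        have h4 : ‖u - contL2 (v i 0)‖ < δ * Real.exp (-(C i * T)) := by
          have := hin i hi hu
          rwa [Metric.mem_ball, dist_eq_norm] at this
        rw [← ofReal_norm, ← ENNReal.ofReal_pow (norm_nonneg _)]
        exact ENNReal.ofReal_le_ofReal (pow_le_pow_left₀ (norm_nonneg _) h4.le 2)
      refine (mul_le_mul_right h3 _).trans (le_of_eq ?_)
      rw [← ofReal_measureReal, ← mul_assoc, ← ENNReal.ofReal_mul (Real.exp_nonneg _),
        ← ENNReal.ofReal_mul (by positivity), hreal]
      congr 2
      rw [mul_pow, ← Real.exp_nat_mul, mul_left_comm, ← Real.exp_add]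
      have : 2 * (C i * T) + ((2 : ℕ) : ℝ) * -(C i * T) = 0 := by push_cast; ring
      rw [this, Real.exp_zero, mul_one]
  refine (Finset.abs_sum_le_sum_abs _ _).trans ((Finset.sum_le_sum fun i _ => key i).trans ?_)
  rw [Finset.sum_add_distrib, ← Finset.mul_sum, Finset.sum_ite_eq' Finset.univ]
  have hone : ∑ i, P.real (f ⁻¹' {i}) = 1 := by
    have h1 : ((∑ i, m i : Measure (L2 d))).real Set.univ = 1 := by
      rw [hm]; simp
    rw [← h1]
    rw [Finset.sum_congr rfl fun i _ => (hreal i).symm]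
    simp only [Measure.real, Measure.finsetSum_apply]
    rw [ENNReal.toReal_sum fun i _ => measure_ne_top _ _]
  rw [hone]
  simp only [Finset.mem_univ, if_true]
  linarith

/-- Two dissipative solutions with the same generic initial measure have the same integrals against
bounded Lipschitz functions, and these separate probability measures. -/
lemma IsDissipativeSolution.ae_eq {T : ℝ} (hT : 0 < T) {μbar : ProbabilityMeasure (L2 d)}
    (hG : (μbar : Measure (L2 d)) (genericSet d T) = 1)
    (h2 : ∫⁻ u, ‖u‖ₑ ^ 2 ∂(μbar : Measure (L2 d)) < ⊤) {μ μ' : ℝ → ProbabilityMeasure (L2 d)}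
    (h : IsDissipativeSolution T μbar μ) (h' : IsDissipativeSolution T μbar μ') :
    ∀ᵐ t ∂(volume.restrict (Set.Ico 0 T)), μ' t = μ t := by
  choose G hGn using fun n : ℕ =>
    exists_approximate_integral hT hG h2 (δ := 1 / ((n : ℝ) + 1)) (by positivity)
  filter_upwards [ae_all_iff.2 fun n => hGn n μ h, ae_all_iff.2 fun n => hGn n μ' h'] with t h1 h3
  have key : Tendsto (fun _ : ℕ => μ' t) atTop (𝓝 (μ t)) := by
    rw [tendsto_iff_forall_lipschitz_integral_tendsto]
    rintro F ⟨B, hF⟩ ⟨L, hL⟩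
    have heq : ∫ u, F u ∂(μ' t : Measure (L2 d)) = ∫ u, F u ∂(μ t : Measure (L2 d)) := by
      have hlim : Tendsto (fun n : ℕ => 2 * ((L + B) * (1 / ((n : ℝ) + 1)))) atTop (𝓝 0) := by
        simpa using (tendsto_one_div_add_atTop_nhds_zero_nat.const_mul ((L : ℝ) + B)).const_mul 2
      have hle : |∫ u, F u ∂(μ' t : Measure (L2 d)) - ∫ u, F u ∂(μ t : Measure (L2 d))| ≤ 0 := by
        refine ge_of_tendsto' hlim fun n => ?_
        have e1 := h1 n F B L hF hL
        have e2 := h3 n F B L hF hL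
        rw [abs_sub_comm] at e1
        have := abs_sub_le (∫ u, F u ∂(μ' t : Measure (L2 d))) (G n t F)
          (∫ u, F u ∂(μ t : Measure (L2 d)))
        linarith
      exact sub_eq_zero.1 (abs_nonpos_iff.1 hle)
    rw [heq]
    exact tendsto_const_nhds
  exact tendsto_nhds_unique tendsto_const_nhds key

end

section

variable {d : ℕ}

/-! ### Products of observables along weak trajectories -/

/-- The rate of change of `∏ⱼ ⟨u, φⱼ⟩` along the Euler flow, at the field `u` and the time `t`. -/
def multiRate {k : ℕ} (T : ℝ) (φ : Fin k → ℝ → Torus d → Vec d) (t : ℝ) (u : L2 d) : ℝ :=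
  ∑ i, (∏ j ∈ Finset.univ.erase i, inner ℝ u (contL2 (φ j t))) * rate T (φ i) t u

lemma IsTestField.isCn_one {T : ℝ} {φ : ℝ → Torus d → Vec d} (h : IsTestField T φ) : IsCn 1 T φ :=
  h.smooth.mono (mod_cast le_top)

/-- A test field vanishes with its derivatives after a time `b < T`. -/
lemma IsTestField.exists_vanishing {T : ℝ} (hT : 0 < T) {φ : ℝ → Torus d → Vec d}
    (h : IsTestField T φ) : ∃ b, 0 ≤ b ∧ b < T ∧ ∀ t, b < t → t < T → ∀ x,
      φ t x = 0 ∧ timeDeriv T (fun s => φ s x) t = 0 ∧ spaceDeriv (φ t) x = 0 := by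
  obtain ⟨T', hT', h0⟩ := h.compactSupport
  refine ⟨max T' 0, le_max_right _ _, max_lt hT' hT, fun t hbt htT x => ?_⟩
  have ht0 : 0 < t := (le_max_right _ _).trans_lt hbt
  have hT't : T' < t := (le_max_left _ _).trans_lt hbt
  have hz : ∀ x, φ t x = 0 := h0 t ⟨ht0.le, htT⟩ hT't.le
  refine ⟨hz x, ?_, ?_⟩
  · have hev : (fun s => φ s x) =ᶠ[𝓝[Set.Ico 0 T] t] fun _ => 0 := by
      filter_upwards [self_mem_nhdsWithin, nhdsWithin_le_nhds (Ioi_mem_nhds hT't)] with s hs hs'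
      exact h0 s hs (Set.mem_Ioi.1 hs').le x
    rw [timeDeriv, hev.derivWithin_eq (hz x)]
    simp
  · simp only [spaceDeriv, hz]
    simp

lemma exists_vanishing_family {k : ℕ} {T : ℝ} (hT : 0 < T) {φ : Fin k → ℝ → Torus d → Vec d}
    (h : ∀ i, IsTestField T (φ i)) : ∃ b, 0 ≤ b ∧ b < T ∧ ∀ i t, b < t → t < T → ∀ x,
      φ i t x = 0 ∧ timeDeriv T (fun s => φ i s x) t = 0 ∧ spaceDeriv (φ i t) x = 0 := by
  choose b hb0 hbT hb using fun i => (h i).exists_vanishing hT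
  rcases isEmpty_or_nonempty (Fin k) with hk | hk
  · exact ⟨0, le_rfl, hT, fun i => hk.elim i⟩
  · obtain ⟨i₀, -, hi₀⟩ := Finset.exists_max_image Finset.univ b Finset.univ_nonempty
    exact ⟨b i₀, hb0 i₀, hbT i₀, fun i t ht => hb i t ((hi₀ i (Finset.mem_univ i)).trans_lt ht)⟩

lemma rate_eq_zero {T : ℝ} {φ : ℝ → Torus d → Vec d} (hφ : IsCn 1 T φ) {t : ℝ}
    (ht : t ∈ Set.Ico 0 T) (h1 : ∀ x, timeDeriv T (fun s => φ s x) t = 0)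
    (h2 : ∀ x, spaceDeriv (φ t) x = 0) (u : L2 d) : rate T φ t u = 0 := by
  rw [rate_eq_integral hφ ht]
  simp [h1, h2, dot]

lemma exists_multiRate_bound {k : ℕ} {T : ℝ} (hT : 0 < T) {φ : Fin k → ℝ → Torus d → Vec d}
    (h : ∀ i, IsTestField T (φ i)) (M : ℝ) :
    ∃ K, ∀ t ∈ Set.Ico 0 T, ∀ u : L2 d, ‖u‖ ≤ M → |multiRate T φ t u| ≤ K := by
  obtain ⟨b, hb0, hbT, hb⟩ := exists_vanishing_family hT h
  have hsub : Set.Icc 0 b ⊆ Set.Ico 0 T := fun s hs => ⟨hs.1, hs.2.trans_lt hbT⟩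
  choose c hc using fun i => (isCompact_Icc (a := 0) (b := b)).exists_bound_of_continuousOn
    ((h i).smooth.continuousOn_contL2.mono hsub)
  choose K hK0 hK using fun i => exists_rate_bound (h i).isCn_one hbT
  refine ⟨∑ i, (∏ j ∈ Finset.univ.erase i, |M * c j|) * (K i * (|M| + |M| ^ 2)),
    fun t ht u hu => ?_⟩
  have hM : 0 ≤ M := (norm_nonneg u).trans hu
  rcases le_or_gt t b with htb | htb
  · refine (Finset.abs_sum_le_sum_abs _ _).trans (Finset.sum_le_sum fun i _ => ?_)
    rw [abs_mul, Finset.abs_prod]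
    have h2 : |rate T (φ i) t u| ≤ K i * (|M| + |M| ^ 2) := by
      refine (hK i t ⟨ht.1, htb⟩ u).trans (mul_le_mul_of_nonneg_left ?_ (hK0 i))
      rw [abs_of_nonneg hM]
      gcongr
    refine mul_le_mul (Finset.prod_le_prod (fun _ _ => abs_nonneg _) fun j _ => ?_) h2
      (abs_nonneg _) (Finset.prod_nonneg fun _ _ => abs_nonneg _)
    refine (abs_real_inner_le_norm _ _).trans ((mul_le_mul hu (hc j t ⟨ht.1, htb⟩)
      (norm_nonneg _) hM).trans (le_abs_self _))
  · have h0 : multiRate T φ t u = 0 := Finset.sum_eq_zero fun i _ => by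
      rw [rate_eq_zero (h i).isCn_one ht (fun x => (hb i t htb ht.2 x).2.1)
        (fun x => (hb i t htb ht.2 x).2.2), mul_zero]
    rw [h0, abs_zero]
    exact Finset.sum_nonneg fun i _ => mul_nonneg (Finset.prod_nonneg fun _ _ => abs_nonneg _)
      (mul_nonneg (hK0 i) (by positivity))

lemma IsWeakTrajectory.hasDerivAt_inner {T : ℝ} {u : ℝ → L2 d} (hu : IsWeakTrajectory T u)
    {φ : ℝ → Torus d → Vec d} (hφ : IsTestField T φ) {t : ℝ} (ht : t ∈ Set.Ioo 0 T) :
    HasDerivAt (fun s => (inner ℝ (u s) (contL2 (φ s)) : ℝ)) (rate T φ t (u t)) t := by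
  have hr := continuousOn_rate_curve hφ.isCn_one hu.continuousOn
  have hnhds : Set.Ico 0 T ∈ 𝓝 t := Ico_mem_nhds ht.1 ht.2
  have h1 : HasDerivAt (fun s => ∫ r in (0 : ℝ)..s, rate T φ r (u r)) (rate T φ t (u t)) t :=
    intervalIntegral.integral_hasDerivAt_right
      (intervalIntegrable_of_continuousOn_Ico hr ⟨ht.1.le, ht.2⟩)
      (hr.stronglyMeasurableAtFilter_nhdsWithin measurableSet_Ico t |>.filter_mono
        (le_of_eq (nhdsWithin_eq_nhds.2 hnhds).symm))
      (hr.continuousAt hnhds)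
  refine (h1.add_const (inner ℝ (u 0) (contL2 (φ 0)) : ℝ)).congr_of_eventuallyEq ?_
  filter_upwards [hnhds] with s hs
  have := hu.weak φ hφ.isCn_one hφ.divFree s hs
  linarith

lemma IsWeakTrajectory.continuousOn_inner {T : ℝ} {u : ℝ → L2 d} (hu : IsWeakTrajectory T u)
    {φ : ℝ → Torus d → Vec d} (hφ : IsTestField T φ) :
    ContinuousOn (fun s => (inner ℝ (u s) (contL2 (φ s)) : ℝ)) (Set.Ico 0 T) :=
  hu.continuousOn.inner hφ.smooth.continuousOn_contL2

/-- The fundamental theorem of calculus for `∏ⱼ ⟨u(t), φⱼ(t)⟩`. -/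
lemma IsWeakTrajectory.integral_multiRate {k : ℕ} (hk : 1 ≤ k) {T : ℝ} (hT : 0 < T) {u : ℝ → L2 d}
    (hu : IsWeakTrajectory T u) {φ : Fin k → ℝ → Torus d → Vec d} (h : ∀ i, IsTestField T (φ i)) :
    ∫ t in Set.Ico 0 T, multiRate T φ t (u t) = -∏ j, inner ℝ (u 0) (contL2 (φ j 0)) := by
  obtain ⟨b, hb0, hbT, hb⟩ := exists_vanishing_family hT h
  -- all test fields vanish at `t₁`, which leaves only the boundary term at time `0`
  let t₁ : ℝ := (b + T) / 2
  have hbt : b < t₁ := by simp only [t₁]; linarith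
  have htT : t₁ < T := by simp only [t₁]; linarith
  have ht0 : 0 ≤ t₁ := hb0.trans hbt.le
  have hsub : Set.Icc 0 t₁ ⊆ Set.Ico 0 T := fun s hs => ⟨hs.1, hs.2.trans_lt htT⟩
  have hcr : ContinuousOn (fun t => multiRate T φ t (u t)) (Set.Ico 0 T) :=
    continuousOn_finsetSum _ fun i _ => (continuousOn_finsetProd _ fun j _ =>
      hu.continuousOn_inner (h j)).mul (continuousOn_rate_curve (h i).isCn_one hu.continuousOn)
  rw [setIntegral_eq_of_subset_of_forall_sdiff_eq_zero measurableSet_Ico hsub,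
    integral_Icc_eq_integral_Ioc, ← intervalIntegral.integral_of_le ht0,
    intervalIntegral.integral_eq_sub_of_hasDerivAt_of_le ht0
      (f := fun t => ∏ j, inner ℝ (u t) (contL2 (φ j t)))]
  · have hz : ∏ j, (inner ℝ (u t₁) (contL2 (φ j t₁)) : ℝ) = 0 := by
      refine Finset.prod_eq_zero (Finset.mem_univ ⟨0, hk⟩) ?_
      rw [inner_contL2 _ ((h _).smooth.jointlyContinuous.slice ⟨ht0, htT⟩)]
      simp [(hb _ t₁ hbt htT _).1, dot]
    rw [hz, zero_sub]
  · exact (continuousOn_finsetProd _ fun j _ => hu.continuousOn_inner (h j)).mono hsub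
  · intro t ht
    have := HasDerivAt.fun_finsetProd (u := Finset.univ) (x := t)
      (f := fun j s => (inner ℝ (u s) (contL2 (φ j s)) : ℝ)) fun i _ =>
        hu.hasDerivAt_inner (h i) ⟨ht.1, ht.2.trans htT⟩
    simp only [smul_eq_mul] at this
    exact this
  · exact intervalIntegrable_of_continuousOn_Ico hcr ⟨ht0, htT⟩
  · intro t ht
    have hbt' : b < t := by
      by_contra hle
      exact ht.2 ⟨ht.1.1, (not_lt.1 hle).trans hbt.le⟩
    exact Finset.sum_eq_zero fun i _ => by
      rw [rate_eq_zero (h i).isCn_one ht.1 (fun x => (hb i t hbt' ht.1.2 x).2.1)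
        (fun x => (hb i t hbt' ht.1.2 x).2.2), mul_zero]

/-! ### The image of a measure under the flow -/

/-- The image of `ρ` under the flow at time `t`. -/
def flowMeasure (T : ℝ) (ρ : ProbabilityMeasure (L2 d)) (t : ℝ) : ProbabilityMeasure (L2 d) :=
  ρ.map (measurable_flow T t).aemeasurable

/-- The measure is carried by bounded generic initial data. -/
def IsGenericMeasure (T M : ℝ) (ρ : ProbabilityMeasure (L2 d)) : Prop :=
  ∀ᵐ u ∂(ρ : Measure (L2 d)), u ∈ genericSet d T ∧ ‖u‖ ≤ M

section FlowMeasure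

variable {T M : ℝ} {ρ : ProbabilityMeasure (L2 d)}

lemma coe_flowMeasure (T : ℝ) (ρ : ProbabilityMeasure (L2 d)) (t : ℝ) :
    (flowMeasure T ρ t : Measure (L2 d)) = (ρ : Measure (L2 d)).map (flow T t) :=
  ProbabilityMeasure.toMeasure_map _ _

lemma flowMeasure_zero (hT : 0 < T) (hρ : IsGenericMeasure T M ρ) : flowMeasure T ρ 0 = ρ := by
  apply Subtype.ext
  change (flowMeasure T ρ 0 : Measure (L2 d)) = _
  have h : flow T 0 =ᵐ[(ρ : Measure (L2 d))] id := by
    filter_upwards [hρ] with u hu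
    exact (isWeakTrajectory_flow hT hu.1).2
  rw [coe_flowMeasure, Measure.map_congr h, Measure.map_id]
  rfl

lemma norm_flow (hT : 0 < T) {t : ℝ} (ht : t ∈ Set.Ico 0 T) {u : L2 d} (hu : u ∈ genericSet d T) :
    ‖flow T t u‖ = ‖u‖ := by
  obtain ⟨h1, h2⟩ := isWeakTrajectory_flow hT hu
  rw [h1.energy t ht, h2]

lemma lintegral_flowMeasure_sq (hT : 0 < T) (hρ : IsGenericMeasure T M ρ) {t : ℝ}
    (ht : t ∈ Set.Ico 0 T) : ∫⁻ u, ‖u‖ₑ ^ 2 ∂(flowMeasure T ρ t : Measure (L2 d)) =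
      ∫⁻ u, ‖u‖ₑ ^ 2 ∂(ρ : Measure (L2 d)) := by
  rw [coe_flowMeasure, lintegral_map (by fun_prop) (measurable_flow T t)]
  refine lintegral_congr_ae ?_
  filter_upwards [hρ] with u hu
  rw [← ofReal_norm, norm_flow hT ht hu.1, ofReal_norm]

lemma ae_norm_le_flowMeasure (hT : 0 < T) (hρ : IsGenericMeasure T M ρ) {t : ℝ}
    (ht : t ∈ Set.Ico 0 T) : ∀ᵐ u ∂(flowMeasure T ρ t : Measure (L2 d)), ‖u‖ ≤ M := by
  rw [coe_flowMeasure, ae_map_iff (measurable_flow T t).aemeasurable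
    (measurableSet_le (by fun_prop) measurable_const)]
  filter_upwards [hρ] with u hu
  rw [norm_flow hT ht hu.1]
  exact hu.2

lemma ae_isDivFree_flowMeasure (hT : 0 < T) (hρ : IsGenericMeasure T M ρ) {t : ℝ}
    (ht : t ∈ Set.Ico 0 T) : ∀ᵐ u ∂(flowMeasure T ρ t : Measure (L2 d)), IsDivFree u := by
  rw [coe_flowMeasure, ae_map_iff (measurable_flow T t).aemeasurable
    isClosed_isDivFree.measurableSet]
  filter_upwards [hρ] with u hu
  exact (isWeakTrajectory_flow hT hu.1).1.isDivFree t ht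

lemma lintegral_sq_lt_top_of_ae_le {ρ : Measure (L2 d)} [IsProbabilityMeasure ρ]
    (h : ∀ᵐ u ∂ρ, ‖u‖ ≤ M) : ∫⁻ u, ‖u‖ₑ ^ 2 ∂ρ < ⊤ := by
  have h1 : ∫⁻ u, ‖u‖ₑ ^ 2 ∂ρ ≤ ∫⁻ _ : L2 d, ENNReal.ofReal M ^ 2 ∂ρ := by
    refine lintegral_mono_ae ?_
    filter_upwards [h] with u hu
    rw [← ofReal_norm]
    gcongr
  refine h1.trans_lt ?_
  simp [ENNReal.ofReal_lt_top]

/-- For bounded continuous `F`, the integral of `F` is even continuous in time. -/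
lemma isWeakStarMeasurable_flowMeasure (hT : 0 < T) (hρ : IsGenericMeasure T M ρ) :
    IsWeakStarMeasurable T (flowMeasure T ρ) := by
  intro F
  have h1 : ∀ t, ∫ u, F u ∂(flowMeasure T ρ t : Measure (L2 d)) =
      ∫ u, F (flow T t u) ∂(ρ : Measure (L2 d)) := fun t => by
    rw [coe_flowMeasure, integral_map (measurable_flow T t).aemeasurable
      F.continuous.aestronglyMeasurable]
  simp only [h1]
  refine ContinuousOn.aemeasurable ?_ measurableSet_Ico
  refine continuousOn_of_dominated (bound := fun _ => ‖F‖) (fun t _ => ?_)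
    (fun t _ => .of_forall fun u => F.norm_coe_le_norm _) (integrable_const _) ?_
  · exact (F.continuous.measurable.comp (measurable_flow T t)).aestronglyMeasurable
  · filter_upwards [hρ] with u hu
    exact F.continuous.comp_continuousOn (isWeakTrajectory_flow hT hu.1).1.continuousOn

lemma isL1P_flowMeasure (hT : 0 < T) (hρ : IsGenericMeasure T M ρ) :
    IsL1P T (flowMeasure T ρ) := by
  refine ⟨isWeakStarMeasurable_flowMeasure hT hρ, ?_⟩
  have h1 : ∫⁻ t in Set.Ico 0 T, ∫⁻ u, ‖u‖ₑ ∂(flowMeasure T ρ t : Measure (L2 d)) ≤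
      ∫⁻ _ in Set.Ico 0 T, ENNReal.ofReal M := by
    refine setLIntegral_mono measurable_const fun t ht => ?_
    have h2 : ∫⁻ u, ‖u‖ₑ ∂(flowMeasure T ρ t : Measure (L2 d)) ≤
        ∫⁻ _ : L2 d, ENNReal.ofReal M ∂(flowMeasure T ρ t : Measure (L2 d)) := by
      refine lintegral_mono_ae ?_
      filter_upwards [ae_norm_le_flowMeasure hT hρ ht] with u hu
      rw [← ofReal_norm]
      exact ENNReal.ofReal_le_ofReal hu
    simpa using h2
  refine h1.trans_lt ?_
  simp [ENNReal.mul_lt_top, ENNReal.ofReal_lt_top]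

lemma continuousOn_multiRate {k : ℕ} {φ : Fin k → ℝ → Torus d → Vec d}
    (h : ∀ i, IsTestField T (φ i)) :
    ContinuousOn (fun p : ℝ × L2 d => multiRate T φ p.1 p.2) (Set.Ico 0 T ×ˢ Set.univ) := by
  refine continuousOn_finsetSum _ fun i _ => (continuousOn_finsetProd _ fun j _ => ?_).mul
    (continuousOn_rate (h i).isCn_one)
  have h1 : ContinuousOn (fun p : ℝ × L2 d => contL2 (φ j p.1)) (Set.Ico 0 T ×ˢ Set.univ) :=
    (h j).smooth.continuousOn_contL2.comp continuousOn_fst fun p hp => hp.1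
  exact continuousOn_snd.inner h1

/-- The evolution of the moments of the image measure: Fubini's theorem and the fundamental theorem
of calculus along almost every trajectory. -/
lemma integral_multiRate_flowMeasure {k : ℕ} (hk : 1 ≤ k) (hT : 0 < T)
    (hρ : IsGenericMeasure T M ρ) {φ : Fin k → ℝ → Torus d → Vec d}
    (h : ∀ i, IsTestField T (φ i)) :
    ∫ t in Set.Ico 0 T, (∫ u, multiRate T φ t u ∂(flowMeasure T ρ t : Measure (L2 d))) =
      -∫ u : L2 d, ∏ j, inner ℝ u (contL2 (φ j 0)) ∂(ρ : Measure (L2 d)) := by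
  have h1 : ∀ t ∈ Set.Ico 0 T, ∫ u, multiRate T φ t u ∂(flowMeasure T ρ t : Measure (L2 d)) =
      ∫ u, multiRate T φ t (flow T t u) ∂(ρ : Measure (L2 d)) := fun t ht => by
    rw [coe_flowMeasure, integral_map (measurable_flow T t).aemeasurable]
    have : Continuous fun u => multiRate T φ t u := by
      rw [← continuousOn_univ]
      exact ContinuousOn.comp (g := fun p : ℝ × L2 d => multiRate T φ p.1 p.2)
        (f := fun w => (t, w)) (continuousOn_multiRate h) (by fun_prop) fun _ _ => ⟨ht, trivial⟩
    exact this.aestronglyMeasurable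
  rw [setIntegral_congr_fun measurableSet_Ico h1]
  obtain ⟨K, hK⟩ := exists_multiRate_bound hT h M
  have hcont : ContinuousOn (fun p : ℝ × L2 d => multiRate T φ p.1 (flow T p.1 p.2))
      (Set.Ico 0 T ×ˢ genericSet d T) :=
    ContinuousOn.comp (g := fun p : ℝ × L2 d => multiRate T φ p.1 p.2)
      (f := fun p : ℝ × L2 d => (p.1, flow T p.1 p.2)) (continuousOn_multiRate h)
      (continuousOn_fst.prodMk (continuousOn_flow d T)) fun p hp => ⟨hp.1, trivial⟩
  have hres : (ρ : Measure (L2 d)).restrict (genericSet d T) = ρ :=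
    Measure.restrict_eq_self_of_ae_mem (hρ.mono fun u hu => hu.1)
  have hmeas : AEStronglyMeasurable (fun p : ℝ × L2 d => multiRate T φ p.1 (flow T p.1 p.2))
      ((volume.restrict (Set.Ico 0 T)).prod (ρ : Measure (L2 d))) := by
    rw [← hres, Measure.prod_restrict]
    exact hcont.aestronglyMeasurable (measurableSet_Ico.prod (measurableSet_genericSet d T))
  have hint : Integrable (fun p : ℝ × L2 d => multiRate T φ p.1 (flow T p.1 p.2))
      ((volume.restrict (Set.Ico 0 T)).prod (ρ : Measure (L2 d))) := by
    refine .of_bound hmeas K ?_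
    have ha : ∀ᵐ p ∂((volume.restrict (Set.Ico 0 T)).prod (ρ : Measure (L2 d))),
        p.1 ∈ Set.Ico 0 T := Measure.quasiMeasurePreserving_fst.ae
          (ae_restrict_mem measurableSet_Ico)
    have hb : ∀ᵐ p ∂((volume.restrict (Set.Ico 0 T)).prod (ρ : Measure (L2 d))),
        p.2 ∈ genericSet d T ∧ ‖p.2‖ ≤ M := Measure.quasiMeasurePreserving_snd.ae hρ
    filter_upwards [ha, hb] with p hp1 hp2
    refine hK p.1 hp1 _ ?_
    rw [norm_flow hT hp1 hp2.1]
    exact hp2.2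
  rw [integral_integral_swap hint, ← integral_neg]
  refine integral_congr_ae ?_
  filter_upwards [hρ] with u hu
  obtain ⟨h3, h4⟩ := isWeakTrajectory_flow hT hu.1
  have := h3.integral_multiRate hk hT h
  rwa [h4] at this

/-- The image of `ρ` under the flow solves the first moment equation. -/
lemma weakEulerEquation_flowMeasure (hT : 0 < T) (hρ : IsGenericMeasure T M ρ) :
    WeakEulerEquation T ρ (flowMeasure T ρ) := by
  intro φ hφ
  have h1 := integral_multiRate_flowMeasure (k := 1) le_rfl hT hρ (φ := fun _ => φ) fun _ => hφ
  have h2 : Continuous (φ 0) := hφ.smooth.jointlyContinuous.slice ⟨le_rfl, hT⟩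
  simp only [← inner_contL2 _ h2]
  have h3 : ∀ t u, multiRate T (fun _ : Fin 1 => φ) t u = rate T φ t u := fun t u => by
    simp [multiRate]
  simp only [h3, Finset.univ_unique, Finset.prod_const, Finset.card_singleton, pow_one] at h1
  rw [← h1]
  refine setIntegral_congr_fun measurableSet_Ico fun t ht => ?_
  simp only [rate_eq_integral hφ.isCn_one ht]

end FlowMeasure

end

section

variable {d : ℕ}

/-! ### Moments of products of local observables -/

/-- A continuous local observable of at most quadratic growth in the state. -/
structure IsObservable (c : ℝ) (g : Torus d → Vec d → ℝ) : Prop where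
  continuous : Continuous (Function.uncurry g)
  bound : ∀ x ξ, |g x ξ| ≤ c * (1 + ‖ξ‖ ^ 2)

lemma integrable_norm_sq_apply (u : L2 d) : Integrable fun x => ‖u x‖ ^ 2 :=
  (memLp_two_iff_integrable_sq_norm (Lp.aestronglyMeasurable u)).1 (Lp.memLp u)

lemma integral_norm_sq_apply (u : L2 d) : ∫ x, ‖u x‖ ^ 2 = ‖u‖ ^ 2 := by
  rw [← real_inner_self_eq_norm_sq, L2.inner_def]
  simp only [real_inner_self_eq_norm_sq]

/-- The total mass of the torus. -/
def torusMass (d : ℕ) : ℝ := (volume : Measure (Torus d)).real Set.univ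

lemma integral_one_add_norm_sq (u : L2 d) : ∫ x, (1 + ‖u x‖ ^ 2) = torusMass d + ‖u‖ ^ 2 := by
  rw [integral_add (integrable_const _) (integrable_norm_sq_apply u), integral_norm_sq_apply]
  simp [torusMass]

section Observable

variable {c : ℝ}

lemma IsObservable.aestronglyMeasurable {g : Torus d → Vec d → ℝ} (hg : IsObservable c g)
    (u : L2 d) : AEStronglyMeasurable fun x => g x (u x) :=
  hg.continuous.comp_aestronglyMeasurable
    (aestronglyMeasurable_id.prodMk (Lp.aestronglyMeasurable u))

lemma IsObservable.integrable {g : Torus d → Vec d → ℝ} (hg : IsObservable c g) (u : L2 d) :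
    Integrable fun x => g x (u x) := by
  have h1 : Integrable fun x => c * (1 + ‖u x‖ ^ 2) :=
    ((integrable_const (1 : ℝ)).add (integrable_norm_sq_apply u)).const_mul c
  exact h1.mono' (hg.aestronglyMeasurable u) (.of_forall fun x => hg.bound x (u x))

lemma IsObservable.integral_abs_le {g : Torus d → Vec d → ℝ} (hg : IsObservable c g) (u : L2 d) :
    ∫ x, |g x (u x)| ≤ c * (torusMass d + ‖u‖ ^ 2) := by
  rw [← integral_one_add_norm_sq, ← integral_const_mul]
  exact integral_mono (hg.integrable u).abs
    (((integrable_const (1 : ℝ)).add (integrable_norm_sq_apply u)).const_mul c)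
    fun x => hg.bound x (u x)

variable {k : ℕ} {ι : Type*} {h : ι → Fin k → Torus d → Vec d → ℝ}

lemma integrable_prod_observable (hh : ∀ i j, IsObservable c (h i j)) (i : ι) (u : L2 d) :
    Integrable fun x : Fin k → Torus d => ∏ j, h i j (x j) (u (x j)) :=
  Integrable.fintype_prod (f := fun j x => h i j x (u x)) fun j => (hh i j).integrable u

variable [Fintype ι]

/-- Products over the points decouple for a fixed field `u`, so that each factor costs one power of
the energy bound. -/
lemma lintegral_sum_prod_le (hh : ∀ i j, IsObservable c (h i j)) {M : ℝ} {ρ : Measure (L2 d)}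
    [IsProbabilityMeasure ρ] (hρ : ∀ᵐ u ∂ρ, ‖u‖ ≤ M) :
    ∫⁻ u : L2 d, (∫⁻ x : Fin k → Torus d, ‖∑ i, ∏ j, h i j (x j) (u (x j))‖ₑ) ∂ρ ≤
      ENNReal.ofReal (Fintype.card ι * (|c| * (torusMass d + M ^ 2)) ^ k) := by
  have hV : 0 ≤ torusMass d := measureReal_nonneg
  have key : ∀ u : L2 d, ‖u‖ ≤ M → ∫⁻ x : Fin k → Torus d, ‖∑ i, ∏ j, h i j (x j) (u (x j))‖ₑ ≤
      ENNReal.ofReal (Fintype.card ι * (|c| * (torusMass d + M ^ 2)) ^ k) := by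
    intro u hu
    have hi : Integrable fun x : Fin k → Torus d => ∑ i, ∏ j, h i j (x j) (u (x j)) :=
      integrable_finsetSum _ fun i _ => integrable_prod_observable hh i u
    rw [← ofReal_integral_norm_eq_lintegral_enorm hi]
    refine ENNReal.ofReal_le_ofReal ?_
    have habs : ∀ i, Integrable fun x : Fin k → Torus d => ∏ j, |h i j (x j) (u (x j))| :=
      fun i => Integrable.fintype_prod (f := fun j x => |h i j x (u x)|)
        fun j => ((hh i j).integrable u).abs
    have h1 : ∫ x : Fin k → Torus d, ‖∑ i, ∏ j, h i j (x j) (u (x j))‖ ≤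
        ∫ x : Fin k → Torus d, ∑ i, ∏ j, |h i j (x j) (u (x j))| := by
      refine integral_mono hi.norm (integrable_finsetSum _ fun i _ => habs i) fun x => ?_
      refine (norm_sum_le _ _).trans (le_of_eq ?_)
      simp only [Real.norm_eq_abs, Finset.abs_prod]
    refine h1.trans ?_
    rw [integral_finsetSum _ fun i _ => habs i]
    have h2 : ∀ i, ∫ x : Fin k → Torus d, ∏ j, |h i j (x j) (u (x j))| ≤
        (|c| * (torusMass d + M ^ 2)) ^ k := by
      intro i
      rw [integral_fintype_prod_volume_eq_prod (𝕜 := ℝ) (fun j x => |h i j x (u x)|)]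
      have h3 : ∏ j : Fin k, ∫ x, |h i j x (u x)| ≤
          ∏ _j : Fin k, (|c| * (torusMass d + M ^ 2)) := by
        refine Finset.prod_le_prod (fun j _ => integral_nonneg fun x => abs_nonneg _) fun j _ => ?_
        refine ((hh i j).integral_abs_le u).trans ?_
        gcongr
        exact le_abs_self c
      simpa using h3
    refine (Finset.sum_le_sum fun i _ => h2 i).trans (le_of_eq ?_)
    simp
  calc _ ≤ ∫⁻ _ : L2 d, ENNReal.ofReal (Fintype.card ι * (|c| * (torusMass d + M ^ 2)) ^ k) ∂ρ :=
        lintegral_mono_ae (hρ.mono key)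
    _ = _ := by simp

lemma measurable_sum_prod (hh : ∀ i j, IsObservable c (h i j)) :
    Measurable (Function.uncurry fun (x : Fin k → Torus d) (ξ : Fin k → Vec d) =>
      ∑ i, ∏ j, h i j (x j) (ξ j)) := by
  refine Continuous.measurable ?_
  refine continuous_finsetSum _ fun i _ => continuous_finsetProd _ fun j _ => ?_
  exact (hh i j).continuous.comp (f := fun p : (Fin k → Torus d) × (Fin k → Vec d) =>
    (p.1 j, p.2 j)) (by fun_prop)

/-- Integrals of sums of products of local observables against correlation measures. -/
lemma integral_sum_prod (hh : ∀ i j, IsObservable c (h i j)) {M : ℝ} {ρ : Measure (L2 d)}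
    [IsProbabilityMeasure ρ] (hρ : ∀ᵐ u ∂ρ, ‖u‖ ≤ M) :
    ∫ x : Fin k → Torus d, (∫ ξ, ∑ i, ∏ j, h i j (x j) (ξ j) ∂(correlationMeasure ρ k x)) =
      ∫ u : L2 d, ∑ i, ∏ j, (∫ x, h i j x (u x)) ∂ρ := by
  rw [integral_correlationMeasure ρ (measurable_sum_prod hh)
    ((lintegral_sum_prod_le hh hρ).trans_lt ENNReal.ofReal_lt_top)]
  refine integral_congr_ae (.of_forall fun u => ?_)
  simp only
  rw [integral_finsetSum _ fun i _ => integrable_prod_observable hh i u]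
  refine Finset.sum_congr rfl fun i _ => ?_
  exact integral_fintype_prod_volume_eq_prod (𝕜 := ℝ) (fun j x => h i j x (u x))

lemma lintegral_correlationMeasure_sum_prod_le (hh : ∀ i j, IsObservable c (h i j)) {M : ℝ}
    {ρ : Measure (L2 d)} [IsProbabilityMeasure ρ] (hρ : ∀ᵐ u ∂ρ, ‖u‖ ≤ M) :
    ∫⁻ x : Fin k → Torus d, (∫⁻ ξ, ‖∑ i, ∏ j, h i j (x j) (ξ j)‖ₑ ∂(correlationMeasure ρ k x)) ≤
      ENNReal.ofReal (Fintype.card ι * (|c| * (torusMass d + M ^ 2)) ^ k) := by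
  rw [lintegral_correlationMeasure ρ
    (f := fun x ξ => ‖∑ i, ∏ j, h i j (x j) (ξ j)‖ₑ) (measurable_sum_prod hh).enorm]
  exact lintegral_sum_prod_le hh hρ

end Observable

/-! ### The evolution of the correlations -/

lemma prod_erase_mul {k : ℕ} (a b : Fin k → ℝ) (i : Fin k) :
    (∏ j ∈ Finset.univ.erase i, a j) * b i = ∏ j, if j = i then b j else a j := by
  rw [← Finset.mul_prod_erase Finset.univ _ (Finset.mem_univ i), if_pos rfl, mul_comm]
  congr 1
  refine Finset.prod_congr rfl fun j hj => ?_
  rw [if_neg (Finset.ne_of_mem_erase hj)]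

/-- Uniform bounds for a family of test fields and their first derivatives. -/
lemma exists_testField_bound {k : ℕ} {T : ℝ} (hT : 0 < T) {φ : Fin k → ℝ → Torus d → Vec d}
    (h : ∀ i, IsTestField T (φ i)) : ∃ c, 0 ≤ c ∧ ∀ i, ∀ t ∈ Set.Ico 0 T, ∀ x, ‖φ i t x‖ ≤ c ∧
      ‖timeDeriv T (fun s => φ i s x) t‖ ≤ c ∧ ‖spaceDeriv (φ i t) x‖ ≤ c := by
  obtain ⟨b, hb0, hbT, hb⟩ := exists_vanishing_family hT h
  have hsub : Set.Icc 0 b ×ˢ (Set.univ : Set (Torus d)) ⊆ Set.Ico 0 T ×ˢ Set.univ :=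
    Set.prod_mono (fun s hs => ⟨hs.1, hs.2.trans_lt hbT⟩) subset_rfl
  have hcpt : IsCompact (Set.Icc 0 b ×ˢ (Set.univ : Set (Torus d))) :=
    isCompact_Icc.prod isCompact_univ
  choose c₁ hc₁ using fun i => hcpt.exists_bound_of_continuousOn
    ((h i).isCn_one.jointlyContinuous.continuousOn.mono hsub)
  choose c₂ hc₂ using fun i => hcpt.exists_bound_of_continuousOn
    ((h i).isCn_one.jointlyContinuous_timeDeriv.continuousOn.mono hsub)
  choose c₃ hc₃ using fun i => hcpt.exists_bound_of_continuousOn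
    ((h i).isCn_one.jointlyContinuous_spaceDeriv.continuousOn.mono hsub)
  let c : ℝ := ∑ i, (|c₁ i| + |c₂ i| + |c₃ i|)
  have hc : ∀ i, |c₁ i| + |c₂ i| + |c₃ i| ≤ c := fun i =>
    Finset.single_le_sum (f := fun i => |c₁ i| + |c₂ i| + |c₃ i|) (fun i _ => by positivity)
      (Finset.mem_univ i)
  have hc0 : 0 ≤ c := Finset.sum_nonneg fun i _ => by positivity
  refine ⟨c, hc0, fun i t ht x => ?_⟩
  rcases le_or_gt t b with htb | htb
  · have hm : (t, x) ∈ Set.Icc 0 b ×ˢ (Set.univ : Set (Torus d)) := ⟨⟨ht.1, htb⟩, trivial⟩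
    have a₁ := abs_nonneg (c₁ i)
    have a₂ := abs_nonneg (c₂ i)
    have a₃ := abs_nonneg (c₃ i)
    have hci := hc i
    exact ⟨((hc₁ i _ hm).trans (le_abs_self _)).trans (by linarith),
      ((hc₂ i _ hm).trans (le_abs_self _)).trans (by linarith),
      ((hc₃ i _ hm).trans (le_abs_self _)).trans (by linarith)⟩
  · obtain ⟨h1, h2, h3⟩ := hb i t htb ht.2 x
    rw [h1, h2, h3]
    simpa using hc0

lemma isObservable_dot {c : ℝ} {g : Torus d → Vec d} (hg : Continuous g) (hc : ∀ x, ‖g x‖ ≤ c) :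
    IsObservable c fun x ξ => dot ξ (g x) := by
  constructor
  · unfold Function.uncurry dot
    fun_prop
  · intro x ξ
    have h1 : |dot ξ (g x)| ≤ ‖ξ‖ * ‖g x‖ := abs_real_inner_le_norm _ _
    have h2 := mul_le_mul_of_nonneg_left (hc x) (norm_nonneg ξ)
    have h3 : 0 ≤ c := (norm_nonneg _).trans (hc x)
    nlinarith [sq_nonneg (‖ξ‖ - 1), norm_nonneg ξ]

lemma isObservable_flux {c : ℝ} {A : Torus d → Vec d →L[ℝ] Vec d} (hA : Continuous A)
    (hc : ∀ x, ‖A x‖ ≤ c) : IsObservable c fun x ξ => dot (A x ξ) ξ := by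
  constructor
  · unfold Function.uncurry dot
    fun_prop
  · intro x ξ
    have h1 : |dot (A x ξ) ξ| ≤ ‖A x ξ‖ * ‖ξ‖ := abs_real_inner_le_norm _ _
    have h2 := (A x).le_of_opNorm_le (hc x) ξ
    have h3 : 0 ≤ c := (norm_nonneg _).trans (hc x)
    nlinarith [mul_le_mul_of_nonneg_right h2 (norm_nonneg ξ)]

lemma IsObservable.mono {c c' : ℝ} (hc : c ≤ c') {g : Torus d → Vec d → ℝ}
    (hg : IsObservable c g) : IsObservable c' g :=
  ⟨hg.continuous, fun x ξ => (hg.bound x ξ).trans (by gcongr)⟩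

lemma IsObservable.add {c c' : ℝ} {g g' : Torus d → Vec d → ℝ}
    (hg : IsObservable c g) (hg' : IsObservable c' g') :
    IsObservable (c + c') fun x ξ => g x ξ + g' x ξ :=
  ⟨hg.continuous.add hg'.continuous, fun x ξ => (abs_add_le _ _).trans
    ((add_le_add (hg.bound x ξ) (hg'.bound x ξ)).trans_eq (add_mul _ _ _).symm)⟩

section Evolution

variable {k : ℕ} {T : ℝ} {φ : Fin k → ℝ → Torus d → Vec d}

/-- The product rule for the test tensor in time; it has the same structure as `fluxPairing`. -/
lemma timeDeriv_tensorPairing (h : ∀ i, IsTestField T (φ i)) {t : ℝ} (ht : t ∈ Set.Ico 0 T)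
    (x : Fin k → Torus d) (ξ : Fin k → Vec d) :
    timeDeriv T (fun s => tensorPairing φ s x ξ) t =
      ∑ i, (∏ j ∈ Finset.univ.erase i, dot (ξ j) (φ j t (x j))) *
        dot (ξ i) (timeDeriv T (fun s => φ i s (x i)) t) := by
  have h1 : ∀ i, HasDerivWithinAt (fun s => dot (ξ i) (φ i s (x i)))
      (dot (ξ i) (timeDeriv T (fun s => φ i s (x i)) t)) (Set.Ico 0 T) t := fun i =>
    (innerSL ℝ (ξ i)).hasFDerivAt.comp_hasDerivWithinAt t ((h i).isCn_one.hasDerivWithinAt ht (x i))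
  have h2 := HasDerivWithinAt.fun_finsetProd (u := Finset.univ) (x := t) (s := Set.Ico 0 T)
    (f := fun i s => dot (ξ i) (φ i s (x i))) fun i _ => h1 i
  simp only [smul_eq_mul] at h2
  exact h2.derivWithin (uniqueDiffOn_Ico 0 T t ht)

/-- The factors of the `i`-th term of a derivative computed with the product rule. -/
def productRule (a b : Fin k → Torus d → Vec d → ℝ) (i j : Fin k) : Torus d → Vec d → ℝ :=
  if j = i then b j else a j

lemma prod_productRule (a b : Fin k → Torus d → Vec d → ℝ) (i : Fin k) (x : Fin k → Torus d)
    (ξ : Fin k → Vec d) : ∏ j, productRule a b i j (x j) (ξ j) =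
      (∏ j ∈ Finset.univ.erase i, a j (x j) (ξ j)) * b i (x i) (ξ i) := by
  rw [prod_erase_mul (fun j => a j (x j) (ξ j)) (fun j => b j (x j) (ξ j))]
  refine Finset.prod_congr rfl fun j _ => ?_
  rw [productRule]
  split_ifs <;> rfl

lemma isObservable_productRule {c : ℝ} {a b : Fin k → Torus d → Vec d → ℝ}
    (ha : ∀ j, IsObservable c (a j)) (hb : ∀ j, IsObservable c (b j)) (i j : Fin k) :
    IsObservable c (productRule a b i j) := by
  rw [productRule]
  split_ifs
  exacts [hb j, ha j]

/-- The moment equations for the correlation measures of the image of a generic measure under the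
flow. -/
lemma momentEquation_flowMeasure (hk : 1 ≤ k) (hT : 0 < T) {M : ℝ} {ρ : ProbabilityMeasure (L2 d)}
    (hρ : IsGenericMeasure T M ρ) (h : ∀ i, IsTestField T (φ i)) :
    MomentEquation T (fun t => correlationMeasure (flowMeasure T ρ t : Measure (L2 d)))
      (correlationMeasure (ρ : Measure (L2 d))) φ := by
  obtain ⟨c, hc0, hc⟩ := exists_testField_bound hT h
  have h0 : (0 : ℝ) ∈ Set.Ico 0 T := ⟨le_rfl, hT⟩
  let a : ℝ → Fin k → Torus d → Vec d → ℝ := fun t j x ξ => dot ξ (φ j t x)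
  let b₁ : ℝ → Fin k → Torus d → Vec d → ℝ := fun t j x ξ =>
    dot ξ (timeDeriv T (fun s => φ j s x) t)
  let b₂ : ℝ → Fin k → Torus d → Vec d → ℝ := fun t j x ξ => dot (spaceDeriv (φ j t) x ξ) ξ
  -- the integrand of the moment equation is again a sum of products: the two terms with the same
  -- special index are merged
  let b₃ : ℝ → Fin k → Torus d → Vec d → ℝ := fun t j x ξ => b₁ t j x ξ + b₂ t j x ξ
  have ha : ∀ t ∈ Set.Ico 0 T, ∀ j, IsObservable (c + c) (a t j) := fun t ht j =>
    (isObservable_dot ((h j).isCn_one.jointlyContinuous.slice ht)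
      fun x => (hc j t ht x).1).mono (by linarith)
  have hb₁' : ∀ t ∈ Set.Ico 0 T, ∀ j, IsObservable c (b₁ t j) := fun t ht j =>
    isObservable_dot ((h j).isCn_one.jointlyContinuous_timeDeriv.slice ht)
      fun x => (hc j t ht x).2.1
  have hb₂' : ∀ t ∈ Set.Ico 0 T, ∀ j, IsObservable c (b₂ t j) := fun t ht j =>
    isObservable_flux ((h j).isCn_one.jointlyContinuous_spaceDeriv.slice ht)
      fun x => (hc j t ht x).2.2
  have hb₃ : ∀ t ∈ Set.Ico 0 T, ∀ j, IsObservable (c + c) (b₃ t j) := fun t ht j =>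
    (hb₁' t ht j).add (hb₂' t ht j)
  have hb₁ : ∀ t ∈ Set.Ico 0 T, ∀ j, IsObservable (c + c) (b₁ t j) := fun t ht j =>
    (hb₁' t ht j).mono (by linarith)
  have hb₂ : ∀ t ∈ Set.Ico 0 T, ∀ j, IsObservable (c + c) (b₂ t j) := fun t ht j =>
    (hb₂' t ht j).mono (by linarith)
  have e₁ : ∀ t ∈ Set.Ico 0 T, ∀ x ξ, timeDeriv T (fun s => tensorPairing φ s x ξ) t =
      ∑ i, ∏ j, productRule (a t) (b₁ t) i j (x j) (ξ j) := fun t ht x ξ => by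
    rw [timeDeriv_tensorPairing h ht]
    exact Finset.sum_congr rfl fun i _ => (prod_productRule (a t) (b₁ t) i x ξ).symm
  have e₂ : ∀ t x ξ, fluxPairing φ t x ξ =
      ∑ i, ∏ j, productRule (a t) (b₂ t) i j (x j) (ξ j) := fun t x ξ =>
    Finset.sum_congr rfl fun i _ => (prod_productRule (a t) (b₂ t) i x ξ).symm
  have e₃ : ∀ t ∈ Set.Ico 0 T, ∀ x ξ,
      timeDeriv T (fun s => tensorPairing φ s x ξ) t + fluxPairing φ t x ξ =
      ∑ i, ∏ j, productRule (a t) (b₃ t) i j (x j) (ξ j) := fun t ht x ξ => by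
    rw [e₁ t ht, e₂, ← Finset.sum_add_distrib]
    refine Finset.sum_congr rfl fun i _ => ?_
    rw [prod_productRule, prod_productRule, prod_productRule, ← mul_add]
  have e₀ : ∀ x ξ, tensorPairing φ 0 x ξ = ∑ _i : Unit, ∏ j, a 0 j (x j) (ξ j) := fun x ξ => by
    simp [tensorPairing, a]
  have hρM : ∀ᵐ u ∂(ρ : Measure (L2 d)), ‖u‖ ≤ M := hρ.mono fun u hu => hu.2
  let K : ℝ := Fintype.card (Fin k) * (|c + c| * (torusMass d + M ^ 2)) ^ k
  refine ⟨?_, ?_, ?_⟩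
  · have hle : ∀ t ∈ Set.Ico 0 T, ∫⁻ x : Fin k → Torus d, (∫⁻ ξ,
        (‖timeDeriv T (fun s => tensorPairing φ s x ξ) t‖ₑ + ‖fluxPairing φ t x ξ‖ₑ)
        ∂(correlationMeasure (flowMeasure T ρ t : Measure (L2 d)) k x)) ≤
        ENNReal.ofReal K + ENNReal.ofReal K := by
      intro t ht
      simp only [e₁ t ht, e₂ t]
      have m₁ := measurable_sum_prod (isObservable_productRule (ha t ht) (hb₁ t ht))
      have m₂ := measurable_sum_prod (isObservable_productRule (ha t ht) (hb₂ t ht))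
      have hadd : ∀ x : Fin k → Torus d, (∫⁻ ξ,
          (‖∑ i, ∏ j, productRule (a t) (b₁ t) i j (x j) (ξ j)‖ₑ +
            ‖∑ i, ∏ j, productRule (a t) (b₂ t) i j (x j) (ξ j)‖ₑ)
          ∂(correlationMeasure (flowMeasure T ρ t : Measure (L2 d)) k x)) =
          ∫⁻ ξ, ‖∑ i, ∏ j, productRule (a t) (b₁ t) i j (x j) (ξ j)‖ₑ
            ∂(correlationMeasure (flowMeasure T ρ t : Measure (L2 d)) k x) +
          ∫⁻ ξ, ‖∑ i, ∏ j, productRule (a t) (b₂ t) i j (x j) (ξ j)‖ₑ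
            ∂(correlationMeasure (flowMeasure T ρ t : Measure (L2 d)) k x) := fun x =>
        lintegral_add_left (m₁.comp (measurable_prodMk_left (x := x))).enorm _
      simp only [hadd]
      rw [lintegral_add_left]
      · exact add_le_add
          (lintegral_correlationMeasure_sum_prod_le
            (isObservable_productRule (ha t ht) (hb₁ t ht)) (ae_norm_le_flowMeasure hT hρ ht))
          (lintegral_correlationMeasure_sum_prod_le
            (isObservable_productRule (ha t ht) (hb₂ t ht)) (ae_norm_le_flowMeasure hT hρ ht))
      · exact Measurable.lintegral_kernel_prod_right' m₁.enorm
    refine (setLIntegral_mono measurable_const hle).trans_lt ?_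
    rw [setLIntegral_const]
    exact ENNReal.mul_lt_top (by simp) (by simp)
  · simp only [e₀]
    exact (lintegral_correlationMeasure_sum_prod_le (fun _ j => ha 0 h0 j) hρM).trans_lt
      ENNReal.ofReal_lt_top
  · have i₀ : ∫ x : Fin k → Torus d, (∫ ξ, tensorPairing φ 0 x ξ
        ∂(correlationMeasure (ρ : Measure (L2 d)) k x)) =
        ∫ u : L2 d, ∏ j, inner ℝ u (contL2 (φ j 0)) ∂(ρ : Measure (L2 d)) := by
      simp only [e₀]
      rw [integral_sum_prod (fun _ j => ha 0 h0 j) hρM]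
      simp only [inner_contL2 _ ((h _).isCn_one.jointlyContinuous.slice h0)]
      simp [a]
    have i₃ : ∀ t ∈ Set.Ico 0 T, ∫ x : Fin k → Torus d, (∫ ξ,
        (timeDeriv T (fun s => tensorPairing φ s x ξ) t + fluxPairing φ t x ξ)
        ∂(correlationMeasure (flowMeasure T ρ t : Measure (L2 d)) k x)) =
        ∫ u, multiRate T φ t u ∂(flowMeasure T ρ t : Measure (L2 d)) := by
      intro t ht
      simp only [e₃ t ht]
      rw [integral_sum_prod (isObservable_productRule (ha t ht) (hb₃ t ht))
        (ae_norm_le_flowMeasure hT hρ ht)]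
      refine integral_congr_ae (.of_forall fun u => Finset.sum_congr rfl fun i _ => ?_)
      simp only [inner_contL2 _ ((h _).isCn_one.jointlyContinuous.slice ht),
        rate_eq_integral (h i).isCn_one ht]
      rw [prod_erase_mul (fun j => ∫ x, dot (u x) (φ j t x))
        (fun j => ∫ x, (dot (u x) (timeDeriv T (fun s => φ j s x) t) +
          dot (spaceDeriv (φ j t) x (u x)) (u x)))]
      refine Finset.prod_congr rfl fun j _ => ?_
      rw [productRule]
      split_ifs <;> rfl
    rw [i₀, setIntegral_congr_fun measurableSet_Ico i₃,
      integral_multiRate_flowMeasure hk hT hρ h]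
    exact neg_add_cancel _

end Evolution

end

section

variable {d : ℕ}

/-! ### Plane waves and Fourier coefficients of divergence-free fields -/

/-- The frequency `k ∈ ℤᵈ` as a vector of `ℝᵈ`. -/
def freq (k : Fin d → ℤ) : Vec d := WithLp.toLp 2 fun i => (k i : ℝ)

/-- The plane wave `cos (k · x + θ)` on the torus. -/
def wave (k : Fin d → ℤ) (θ : ℝ) (x : Torus d) : ℝ :=
  (Complex.exp (θ * Complex.I) * character k x).re

lemma inner_freq (k : Fin d → ℤ) (y : Vec d) : inner ℝ (freq k) y = ∑ i, (k i : ℝ) * y i := by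
  simp [freq, PiLp.inner_apply, mul_comm]

lemma norm_freq_sq (k : Fin d → ℤ) : ‖freq k‖ ^ 2 = ∑ i, (k i : ℝ) ^ 2 := by
  simp [freq, EuclideanSpace.norm_sq_eq]

lemma character_toTorus (k : Fin d → ℤ) (y : Vec d) :
    character k (toTorus y) = Complex.exp ((inner ℝ (freq k) y : ℝ) * Complex.I) := by
  rw [inner_freq, character]
  simp only [toTorus, fourier_coe_apply]
  rw [← Complex.exp_sum]
  congr 1
  push_cast
  rw [Finset.sum_mul]
  refine Finset.sum_congr rfl fun i _ => ?_
  have : (Real.pi : ℂ) ≠ 0 := by exact_mod_cast Real.pi_ne_zero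
  field_simp

lemma wave_toTorus (k : Fin d → ℤ) (θ : ℝ) (y : Vec d) :
    wave k θ (toTorus y) = Real.cos (inner ℝ (freq k) y + θ) := by
  rw [wave, character_toTorus, ← Complex.exp_add, ← add_mul, ← Complex.ofReal_add, add_comm θ,
    Complex.exp_ofReal_mul_I_re]

lemma contDiff_wave (k : Fin d → ℤ) (θ : ℝ) :
    ContDiff ℝ ∞ (fun y : Vec d => wave k θ (toTorus y)) := by
  simp only [wave_toTorus]
  exact Real.contDiff_cos.comp ((contDiff_const.inner ℝ contDiff_id).add contDiff_const)

lemma continuous_wave (k : Fin d → ℤ) (θ : ℝ) : Continuous (wave k θ) :=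
  continuous_of_lift (contDiff_wave k θ).continuous

lemma hasFDerivAt_wave (k : Fin d → ℤ) (θ : ℝ) (y : Vec d) :
    HasFDerivAt (fun h : Vec d => wave k θ (toTorus h))
      (-Real.sin (inner ℝ (freq k) y + θ) • innerSL ℝ (freq k)) y := by
  simp only [wave_toTorus]
  exact ((innerSL ℝ (freq k)).hasFDerivAt.add_const θ).cos

/-- The coefficient of a plane wave is a multiple of the gradient of the shifted plane wave. -/
lemma grad_wave (k : Fin d → ℤ) (θ c : ℝ) (x : Torus d) :
    grad (fun x => c * wave k (θ - Real.pi / 2) x) x = wave k θ x • c • freq k := by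
  obtain ⟨y, rfl⟩ := surjective_toTorus x
  refine ext_inner_right ℝ fun w => ?_
  have h := (hasFDerivAt_wave k (θ - Real.pi / 2) y).const_mul c
  rw [inner_grad, spaceDeriv_eq_of_hasFDerivAt (f := fun x => c * wave k (θ - Real.pi / 2) x) h,
    wave_toTorus, ← add_sub_assoc, Real.sin_sub_pi_div_two]
  simp [inner_smul_left]
  ring

/-- The component of the `j`-th unit vector orthogonal to the frequency `k`. -/
def transverse (k : Fin d → ℤ) (j : Fin d) : Vec d :=
  EuclideanSpace.single j 1 - ((k j : ℝ) / ‖freq k‖ ^ 2) • freq k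

lemma abs_le_norm_freq (k : Fin d → ℤ) (j : Fin d) : |(k j : ℝ)| ≤ ‖freq k‖ := by
  have := PiLp.norm_apply_le (freq k) j
  simpa [freq] using this

lemma inner_freq_transverse (k : Fin d → ℤ) (j : Fin d) :
    inner ℝ (freq k) (transverse k j) = (0 : ℝ) := by
  rw [transverse, inner_sub_right, inner_smul_right, real_inner_self_eq_norm_sq, inner_freq]
  by_cases h : ‖freq k‖ = 0
  · have := abs_le_norm_freq k j
    rw [h] at this
    have hk : (k j : ℝ) = 0 := abs_nonpos_iff.1 this
    simp [hk]
  · rw [div_mul_cancel₀ _ (pow_ne_zero 2 h)]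
    simp

lemma norm_transverse_le (k : Fin d → ℤ) (j : Fin d) : ‖transverse k j‖ ≤ 2 := by
  have h1 : ‖((k j : ℝ) / ‖freq k‖ ^ 2) • freq k‖ ≤ 1 := by
    rw [norm_smul, norm_div, norm_pow, norm_norm, Real.norm_eq_abs]
    by_cases h : ‖freq k‖ = 0
    · simp [h]
    · rw [div_mul_eq_mul_div, div_le_one (by positivity), sq]
      exact mul_le_mul_of_nonneg_right (abs_le_norm_freq k j) (norm_nonneg _)
  refine (norm_sub_le _ _).trans ?_
  have h2 : ‖EuclideanSpace.single j (1 : ℝ)‖ = 1 := by simp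
  linarith

lemma spaceDeriv_wave_smul (k : Fin d → ℤ) (θ : ℝ) (c y : Vec d) :
    spaceDeriv (fun x => wave k θ x • c) (toTorus y) =
      (-Real.sin (inner ℝ (freq k) y + θ) • innerSL ℝ (freq k)).smulRight c :=
  spaceDeriv_eq_of_hasFDerivAt (f := fun x => wave k θ x • c)
    ((hasFDerivAt_wave k θ y).smul_const c)

lemma divergence_wave_smul (k : Fin d → ℤ) (θ : ℝ) {c : Vec d}
    (hc : inner ℝ (freq k) c = (0 : ℝ)) (x : Torus d) :
    divergence (fun x => wave k θ x • c) x = 0 := by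
  obtain ⟨y, rfl⟩ := surjective_toTorus x
  rw [divergence_eq_traceCLM, spaceDeriv_wave_smul, traceCLM_smulRight]
  simp [hc]

lemma norm_spaceDeriv_wave_smul_le (k : Fin d → ℤ) (θ : ℝ) (c : Vec d) (x : Torus d) :
    ‖spaceDeriv (fun x => wave k θ x • c) x‖ ≤ ‖freq k‖ * ‖c‖ := by
  obtain ⟨y, rfl⟩ := surjective_toTorus x
  rw [spaceDeriv_wave_smul, ContinuousLinearMap.norm_smulRight_apply, norm_smul, innerSL_apply_norm,
    norm_neg, Real.norm_eq_abs]
  gcongr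
  exact mul_le_of_le_one_left (norm_nonneg _) (Real.abs_sin_le_one _)

lemma continuous_wave_smul (k : Fin d → ℤ) (θ : ℝ) (c : Vec d) :
    Continuous fun x => wave k θ x • c := (continuous_wave k θ).smul continuous_const

/-- Along a weak trajectory the transverse plane waves vary in a Lipschitz way. -/
lemma IsWeakTrajectory.abs_inner_wave_sub_le {T : ℝ} {u : ℝ → L2 d} (hu : IsWeakTrajectory T u)
    {M : ℝ} (hM : ‖u 0‖ ≤ M) (k : Fin d → ℤ) (θ : ℝ) {c : Vec d}
    (hc : inner ℝ (freq k) c = (0 : ℝ)) {s t : ℝ} (hs : s ∈ Set.Ico 0 T) (ht : t ∈ Set.Ico 0 T) :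
    |inner ℝ (u t - u s) (contL2 fun x => wave k θ x • c)| ≤
      ‖freq k‖ * ‖c‖ * M ^ 2 * |t - s| := by
  let φ : ℝ → Torus d → Vec d := fun _ x => wave k θ x • c
  have hφ : IsCn 1 T φ := by
    have h1 : ContDiff ℝ 1 (fun q : ℝ × Vec d => wave k θ (toTorus q.2) • c) :=
      (((contDiff_wave k θ).of_le (mod_cast le_top)).comp contDiff_snd).smul contDiff_const
    exact h1.contDiffOn
  have hw := hu.weak φ hφ fun _ _ x => divergence_wave_smul k θ hc x
  have hr : ContinuousOn (fun r => rate T φ r (u r)) (Set.Ico 0 T) :=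
    continuousOn_rate_curve hφ hu.continuousOn
  have hbd : ∀ r ∈ Set.Ico 0 T, ‖rate T φ r (u r)‖ ≤ ‖freq k‖ * ‖c‖ * M ^ 2 := by
    intro r hr
    have h0 : (fun x => timeDeriv T (fun s => φ s x) r) = fun _ => 0 := by
      funext x
      simp [φ, timeDeriv]
    have h1 : contL2 (fun _ : Torus d => (0 : Vec d)) = 0 := by
      have := contL2_smul (0 : ℝ) (f := fun _ : Torus d => (0 : Vec d)) continuous_const
      simpa using this
    rw [rate, h0, h1, inner_zero_right, zero_add, Real.norm_eq_abs]
    have hcs : Continuous (spaceDeriv (φ r)) := hφ.jointlyContinuous_spaceDeriv.slice hr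
    refine (abs_inner_opL2_le _ _ (c := ‖freq k‖ * ‖c‖) fun x => ?_).trans ?_
    · rw [toC_apply hcs]
      exact norm_spaceDeriv_wave_smul_le k θ c x
    · rw [hu.energy r hr]
      gcongr
  have e1 : inner ℝ (u t - u s) (contL2 fun x => wave k θ x • c) =
      ∫ r in s..t, rate T φ r (u r) := by
    rw [← intervalIntegral.integral_interval_sub_left
      (intervalIntegrable_of_continuousOn_Ico hr ht)
      (intervalIntegrable_of_continuousOn_Ico hr hs), ← hw t ht, ← hw s hs, inner_sub_left]
    simp only [φ]
    ring
  rw [e1, ← Real.norm_eq_abs]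
  refine intervalIntegral.norm_integral_le_of_norm_le_const fun r hr' => hbd r ?_
  have hr'' := Set.uIoc_subset_uIcc hr'
  rcases Set.mem_uIcc.1 hr'' with h | h
  · exact ⟨hs.1.trans h.1, h.2.trans_lt ht.2⟩
  · exact ⟨ht.1.trans h.1, h.2.trans_lt hs.2⟩

/-- A divergence-free field does not see the longitudinal part of a plane wave, which is a
gradient. -/
lemma inner_wave_single {w : L2 d} (hw : IsDivFree w) (k : Fin d → ℤ) (θ : ℝ) (j : Fin d) :
    inner ℝ w (contL2 fun x => wave k θ x • EuclideanSpace.single j (1 : ℝ)) =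
      inner ℝ w (contL2 fun x => wave k θ x • transverse k j) := by
  -- for `k = 0` the coefficient is `0`, as it should be
  let c : ℝ := (k j : ℝ) / ‖freq k‖ ^ 2
  have h1 : (fun x => wave k θ x • transverse k j) = fun x =>
      wave k θ x • EuclideanSpace.single j (1 : ℝ) - wave k θ x • c • freq k := by
    funext x
    rw [transverse, smul_sub]
  have h2 : (fun x => wave k θ x • c • freq k) =
      grad (fun x => c * wave k (θ - Real.pi / 2) x) := by
    funext x
    rw [grad_wave]
  rw [h1, contL2_sub (continuous_wave_smul k θ _) (continuous_wave_smul k θ _), inner_sub_right, h2,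
    hw _ (contDiff_const.mul (contDiff_wave k _)), sub_zero]

/-- A Fourier coefficient is, up to its phase, the inner product with a plane wave. -/
lemma exists_norm_fourierCoefficient_le (w : L2 d) (k : Fin d → ℤ) (j : Fin d) :
    ∃ θ, ‖fourierCoefficient w k j‖ ≤
      |inner ℝ w (contL2 fun x => wave (-k) θ x • EuclideanSpace.single j (1 : ℝ))| := by
  let z : ℂ := ∫ x : Torus d, ((w x j : ℝ) : ℂ) * character (-k) x
  have hcont : Continuous (character (-k) : Torus d → ℂ) := by
    unfold character
    exact continuous_finsetProd _ fun i _ => (fourier _).continuous.comp (continuous_apply i)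
  have hint : Integrable fun x : Torus d => ((w x j : ℝ) : ℂ) * character (-k) x := by
    have h1 : Integrable fun x : Torus d => w x j := by
      have h2 : Integrable (fun x : Torus d => w x) := (Lp.memLp w).integrable (by norm_num)
      exact (EuclideanSpace.proj (𝕜 := ℝ) j).integrable_comp h2
    refine h1.ofReal.mul_bdd (c := 1) hcont.aestronglyMeasurable (.of_forall fun x => ?_)
    rw [character, norm_prod]
    refine Finset.prod_le_one (fun _ _ => norm_nonneg _) fun i _ => ?_
    rw [fourier_apply, Circle.norm_coe]
  refine ⟨-z.arg, ?_⟩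
  have hz : ‖z‖ = inner ℝ w
      (contL2 fun x => wave (-k) (-z.arg) x • EuclideanSpace.single j (1 : ℝ)) := by
    -- rotate by the argument of `z`
    have h1 : ((‖z‖ : ℝ) : ℂ) = Complex.exp ((-z.arg : ℝ) * Complex.I) * z := by
      conv_rhs => rw [← Complex.norm_mul_exp_arg_mul_I z]
      rw [mul_left_comm, Complex.ofReal_neg, ← Complex.exp_add]
      simp
    have h2 : ‖z‖ = (Complex.exp ((-z.arg : ℝ) * Complex.I) * z).re := by
      rw [← h1, Complex.ofReal_re]
    rw [h2, inner_contL2 w (continuous_wave_smul _ _ _), ← integral_const_mul,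
      ← Complex.reCLM_apply, ← Complex.reCLM.integral_comp_comm (hint.const_mul _)]
    refine integral_congr_ae (.of_forall fun x => ?_)
    have hj : inner ℝ (w x) (EuclideanSpace.single j (1 : ℝ)) = w x j := by
      simp [EuclideanSpace.inner_single_right]
    simp only [Complex.reCLM_apply, dot, inner_smul_right, wave, hj]
    rw [mul_left_comm, Complex.re_ofReal_mul, mul_comm]
  rw [fourierCoefficient, norm_mul, ← hz, abs_norm]
  refine mul_le_of_le_one_left (norm_nonneg _) ?_
  rw [Complex.norm_real, Real.norm_of_nonneg (by positivity)]
  exact inv_le_one_of_one_le₀ (one_le_pow₀ (by linarith [Real.pi_gt_three]))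

/-! ### Time regularity -/

lemma summable_one_add_int_sq : Summable fun n : ℤ => (1 + (n : ℝ) ^ 2)⁻¹ := by
  have h1 : Summable fun n : ℤ => 1 / (n : ℝ) ^ 2 + if n = 0 then (1 : ℝ) else 0 :=
    (Real.summable_one_div_int_pow.2 (by norm_num)).add (hasSum_ite_eq 0 1).summable
  refine Summable.of_nonneg_of_le (fun n => by positivity) (fun n => ?_) h1
  by_cases hn : n = 0
  · simp [hn]
  · rw [if_neg hn, add_zero, one_div]
    have : (n : ℝ) ≠ 0 := by exact_mod_cast hn
    gcongr
    linarith

/-- A product of summable functions of one integer each is summable over the lattice. -/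
lemma summable_prod_int {g : ℤ → ℝ} (hg0 : ∀ n, 0 ≤ g n) (hg : Summable g) :
    Summable fun k : Fin d → ℤ => ∏ i, g (k i) := by
  classical
  refine summable_of_sum_le (c := ∏ _i : Fin d, ∑' n, g n)
    (fun k => Finset.prod_nonneg fun i _ => hg0 _) fun s => ?_
  let t : Fin d → Finset ℤ := fun i => s.image fun k => k i
  calc ∑ k ∈ s, ∏ i, g (k i) ≤ ∑ k ∈ Fintype.piFinset t, ∏ i, g (k i) := by
        refine Finset.sum_le_sum_of_subset_of_nonneg (fun k hk => ?_)
          fun k _ _ => Finset.prod_nonneg fun i _ => hg0 _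
        exact Fintype.mem_piFinset.2 fun i => Finset.mem_image_of_mem _ hk
    _ = ∏ i, ∑ n ∈ t i, g n := (Finset.prod_univ_sum t fun _ n => g n).symm
    _ ≤ ∏ _i : Fin d, ∑' n, g n := Finset.prod_le_prod
        (fun i _ => Finset.sum_nonneg fun n _ => hg0 n)
        fun i _ => hg.sum_le_tsum _ fun n _ => hg0 n

lemma summable_inv_one_add_sq_pow (d : ℕ) :
    Summable fun k : Fin d → ℤ => ((1 + ∑ i, (k i : ℝ) ^ 2) ^ d)⁻¹ := by
  refine Summable.of_nonneg_of_le (fun k => by positivity) (fun k => ?_)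
    (summable_prod_int (fun n => by positivity) summable_one_add_int_sq)
  rw [Finset.prod_inv_distrib]
  gcongr
  have : ∏ i, (1 + (k i : ℝ) ^ 2) ≤ ∏ _i : Fin d, (1 + ∑ i, (k i : ℝ) ^ 2) := by
    refine Finset.prod_le_prod (fun i _ => by positivity) fun i _ => ?_
    gcongr
    exact Finset.single_le_sum (f := fun i => (k i : ℝ) ^ 2) (fun i _ => by positivity)
      (Finset.mem_univ i)
  simpa using this

/-- Linear growth of the Fourier coefficients is compensated by the weight of `H^{-(d+1)}`. -/
lemma negSobolevNorm_le {w : L2 d} {B : ℝ} (hB : 0 ≤ B)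
    (hw : ∀ k j, ‖fourierCoefficient w k j‖ ≤ ‖freq k‖ * B) :
    negSobolevNorm ((d : ℝ) + 1) w ≤
      Real.sqrt (d * ∑' k : Fin d → ℤ, ((1 + ∑ i, (k i : ℝ) ^ 2) ^ d)⁻¹) * B := by
  let S : (Fin d → ℤ) → ℝ := fun k => 1 + ∑ i, (k i : ℝ) ^ 2
  have hS : ∀ k, 0 < S k := fun k => by
    have : 0 ≤ ∑ i, (k i : ℝ) ^ 2 := Finset.sum_nonneg fun i _ => sq_nonneg _
    simp only [S]
    linarith
  have hterm : ∀ k, S k ^ (-((d : ℝ) + 1)) * ∑ j, ‖fourierCoefficient w k j‖ ^ 2 ≤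
      (d * B ^ 2) * (S k ^ d)⁻¹ := by
    intro k
    have h1 : ∑ j, ‖fourierCoefficient w k j‖ ^ 2 ≤ d * B ^ 2 * S k := by
      have h2 : ∑ j, ‖fourierCoefficient w k j‖ ^ 2 ≤ ∑ _j : Fin d, S k * B ^ 2 := by
        refine Finset.sum_le_sum fun j _ => ?_
        have h3 := pow_le_pow_left₀ (norm_nonneg _) (hw k j) 2
        rw [mul_pow, norm_freq_sq] at h3
        refine h3.trans ?_
        gcongr
        simp only [S]
        linarith
      refine h2.trans (le_of_eq ?_)
      rw [Finset.sum_const, Finset.card_univ, Fintype.card_fin, nsmul_eq_mul]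
      ring
    have h4 : S k ^ (-((d : ℝ) + 1)) = (S k ^ d)⁻¹ * (S k)⁻¹ := by
      rw [Real.rpow_neg (hS k).le, Real.rpow_add (hS k), Real.rpow_natCast, Real.rpow_one, mul_inv]
    rw [h4]
    have := hS k
    calc (S k ^ d)⁻¹ * (S k)⁻¹ * ∑ j, ‖fourierCoefficient w k j‖ ^ 2
        ≤ (S k ^ d)⁻¹ * (S k)⁻¹ * (d * B ^ 2 * S k) := by gcongr
      _ = _ := by field_simp
  have hsum : Summable fun k => (d * B ^ 2) * (S k ^ d)⁻¹ :=
    (summable_inv_one_add_sq_pow d).mul_left _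
  have hsum' : Summable fun k => S k ^ (-((d : ℝ) + 1)) * ∑ j, ‖fourierCoefficient w k j‖ ^ 2 :=
    Summable.of_nonneg_of_le (fun k => mul_nonneg (Real.rpow_nonneg (hS k).le _)
      (Finset.sum_nonneg fun j _ => sq_nonneg _)) hterm hsum
  have h5 := hsum'.tsum_le_tsum hterm hsum
  rw [tsum_mul_left] at h5
  rw [negSobolevNorm]
  refine (Real.sqrt_le_sqrt h5).trans (le_of_eq ?_)
  rw [mul_right_comm, Real.sqrt_mul' _ (sq_nonneg B), Real.sqrt_sq hB]

/-- The Fourier coefficients of a weak trajectory are Lipschitz in time, with a constant that grows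
linearly in the frequency. -/
lemma IsWeakTrajectory.norm_fourierCoefficient_sub_le {T : ℝ} {u : ℝ → L2 d}
    (hu : IsWeakTrajectory T u) {M : ℝ} (hM : ‖u 0‖ ≤ M) {s t : ℝ} (hs : s ∈ Set.Ico 0 T)
    (ht : t ∈ Set.Ico 0 T)
    (k : Fin d → ℤ) (j : Fin d) :
    ‖fourierCoefficient (u s - u t) k j‖ ≤ ‖freq k‖ * (2 * M ^ 2 * |t - s|) := by
  obtain ⟨θ, hθ⟩ := exists_norm_fourierCoefficient_le (u s - u t) k j
  rw [inner_wave_single ((hu.isDivFree s hs).sub (hu.isDivFree t ht))] at hθ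
  refine hθ.trans
    ((hu.abs_inner_wave_sub_le hM (-k) θ (inner_freq_transverse (-k) j) ht hs).trans ?_)
  have h1 : ‖freq (-k)‖ = ‖freq k‖ := by
    have : freq (-k) = -freq k := by
      ext i; simp [freq]
    rw [this, norm_neg]
  rw [h1, abs_sub_comm s t]
  have h2 := norm_transverse_le (-k) j
  have h3 : ‖freq k‖ * ‖transverse (-k) j‖ ≤ ‖freq k‖ * 2 := by gcongr
  calc ‖freq k‖ * ‖transverse (-k) j‖ * M ^ 2 * |t - s| ≤ ‖freq k‖ * 2 * M ^ 2 * |t - s| := by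
        gcongr
    _ = _ := by ring

/-- The transport plan is the joint law of the flow at the times `s` and `t`. -/
lemma isTimeRegular_flowMeasure {T M : ℝ} (hT : 0 < T) {ρ : ProbabilityMeasure (L2 d)}
    (hρ : IsGenericMeasure T M ρ) : IsTimeRegular T (flowMeasure T ρ) := by
  let c : ℝ := Real.sqrt (d * ∑' k : Fin d → ℤ, ((1 + ∑ i, (k i : ℝ) ^ 2) ^ d)⁻¹) * (2 * M ^ 2)
  have hc : 0 ≤ c := by positivity
  have hm : ∀ s t, Measurable fun u : L2 d => (flow T s u, flow T t u) := fun s t =>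
    (measurable_flow T s).prodMk (measurable_flow T t)
  -- the constant has to be positive, while `c` may vanish
  refine ⟨(d : ℝ) + 1, by positivity, c + 1, by positivity,
    fun s t => ρ.map (hm s t).aemeasurable, ?_⟩
  have h1 : ∀ᵐ q ∂((volume.restrict (Set.Ico 0 T)).prod (volume.restrict (Set.Ico 0 T)) :
      Measure (ℝ × ℝ)), q.1 ∈ Set.Ico 0 T :=
    Measure.quasiMeasurePreserving_fst.ae (ae_restrict_mem measurableSet_Ico)
  have h2 : ∀ᵐ q ∂((volume.restrict (Set.Ico 0 T)).prod (volume.restrict (Set.Ico 0 T)) :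
      Measure (ℝ × ℝ)), q.2 ∈ Set.Ico 0 T :=
    Measure.quasiMeasurePreserving_snd.ae (ae_restrict_mem measurableSet_Ico)
  filter_upwards [h1, h2] with ⟨s, t⟩ hs ht
  simp only [ProbabilityMeasure.toMeasure_map, coe_flowMeasure]
  refine ⟨?_, ?_, ?_⟩
  · rw [Measure.map_map measurable_fst (hm s t)]; rfl
  · rw [Measure.map_map measurable_snd (hm s t)]; rfl
  · refine (lintegral_map_le _ _).trans ?_
    have h3 : ∀ᵐ u ∂(ρ : Measure (L2 d)),
        ENNReal.ofReal (negSobolevNorm ((d : ℝ) + 1) (flow T s u - flow T t u)) ≤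
          ENNReal.ofReal ((c + 1) * |t - s|) := by
      filter_upwards [hρ] with u hu
      obtain ⟨htraj, h0⟩ := isWeakTrajectory_flow hT hu.1
      refine ENNReal.ofReal_le_ofReal ?_
      refine (negSobolevNorm_le (B := 2 * M ^ 2 * |t - s|) (by positivity) fun k j =>
        htraj.norm_fourierCoefficient_sub_le (M := M) (by rw [h0]; exact hu.2) hs ht k j).trans ?_
      rw [← mul_assoc]
      exact mul_le_mul_of_nonneg_right (by simp only [c]; linarith) (abs_nonneg _)
    refine (lintegral_mono_ae h3).trans ?_
    simp

/-! ### Existence -/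

lemma isStatisticalSolution_flowMeasure {T M : ℝ} (hT : 0 < T) {ρ : ProbabilityMeasure (L2 d)}
    (hρ : IsGenericMeasure T M ρ) : IsStatisticalSolution T ρ (flowMeasure T ρ) where
  mem_L1P := isL1P_flowMeasure hT hρ
  timeRegular := isTimeRegular_flowMeasure hT hρ
  equations := by
    have hassoc : ∀ t ∈ Set.Ico 0 T,
        IsAssociated (correlationMeasure (flowMeasure T ρ t : Measure (L2 d)))
          (flowMeasure T ρ t) :=
      fun t ht => isAssociated_correlationMeasure _
        (lintegral_sq_lt_top_of_ae_le (ae_norm_le_flowMeasure hT hρ ht))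
    refine ⟨fun t => correlationMeasure (flowMeasure T ρ t : Measure (L2 d)),
      correlationMeasure (ρ : Measure (L2 d)), ?_, ?_, ?_, ?_⟩
    · filter_upwards [ae_restrict_mem measurableSet_Ico] with t ht
      exact hassoc t ht
    · exact isAssociated_correlationMeasure _
        (lintegral_sq_lt_top_of_ae_le (hρ.mono fun u hu => hu.2))
    · exact fun k hk φ hφ => momentEquation_flowMeasure hk hT hρ hφ
    · intro ψ hψ
      filter_upwards [ae_restrict_mem measurableSet_Ico] with t ht
      rw [(hassoc t ht).integral_two_point
        (lintegral_sq_lt_top_of_ae_le (ae_norm_le_flowMeasure hT hρ ht))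
        (continuous_grad (hψ.of_le (mod_cast le_top)))]
      rw [integral_eq_zero_of_ae]
      filter_upwards [ae_isDivFree_flowMeasure hT hρ ht] with u hu
      simp [hu ψ hψ]

/-- The image of a bounded generic measure under the flow is a dissipative statistical solution:
its decompositions are transported by the flow. -/
lemma isDissipativeSolution_flowMeasure {T M : ℝ} (hT : 0 < T) {ρ : ProbabilityMeasure (L2 d)}
    (hρ : IsGenericMeasure T M ρ) : IsDissipativeSolution T ρ (flowMeasure T ρ) where
  statistical := isStatisticalSolution_flowMeasure hT hρ
  dissipative := by
    intro N α hα _ ρs hdec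
    have hgen : ∀ i, IsGenericMeasure T M (ρs i) := fun i =>
      (hdec.absolutelyContinuous (hα i)).ae_le hρ
    refine ⟨fun i => flowMeasure T (ρs i), fun t _ => ?_, fun i => ⟨?_, ?_, ?_, ?_⟩⟩
    · rw [IsDecomposition]
      ext s hs
      have h1 := congrArg (fun m : Measure (L2 d) => m (flow T t ⁻¹' s)) hdec
      simp only [Measure.finsetSum_apply, Measure.smul_apply] at h1
      simp only [coe_flowMeasure, Measure.finsetSum_apply, Measure.smul_apply,
        Measure.map_apply (measurable_flow T t) hs, h1]
    · exact isWeakStarMeasurable_flowMeasure hT (hgen i)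
    · exact flowMeasure_zero hT (hgen i)
    · exact weakEulerEquation_flowMeasure hT (hgen i)
    · filter_upwards [ae_restrict_mem measurableSet_Ico] with t ht
      exact (lintegral_flowMeasure_sq hT (hgen i) ht).le

end

end EulerStat

end

theorem mainTheorem1 (d : ℕ) (hd : d = 2 ∨ d = 3) (T : ℝ) (hT : 0 < T)
    (μbar : ProbabilityMeasure (EulerStat.L2 d))
    (hG : (μbar : Measure (EulerStat.L2 d)) (EulerStat.genericSet d T) = 1)
    (hM : ∃ M : ℝ, 0 < M ∧
      (μbar : Measure (EulerStat.L2 d)) (Metric.ball (0 : EulerStat.L2 d) M) = 1) :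
    ∃ μ : ℝ → ProbabilityMeasure (EulerStat.L2 d),
      EulerStat.IsDissipativeSolution T μbar μ ∧
      ∀ μ' : ℝ → ProbabilityMeasure (EulerStat.L2 d),
        EulerStat.IsDissipativeSolution T μbar μ' →
        ∀ᵐ t ∂(volume.restrict (Set.Ico 0 T)), μ' t = μ t := by
  obtain ⟨M, -, hMball⟩ := hM
  have hgen : EulerStat.IsGenericMeasure T M μbar := by
    have h1 := (mem_ae_iff_prob_eq_one (EulerStat.measurableSet_genericSet d T)).2 hG
    have h2 := (mem_ae_iff_prob_eq_one Metric.isOpen_ball.measurableSet).2 hMball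
    rw [EulerStat.IsGenericMeasure]
    filter_upwards [h1, h2] with u hu1 hu2
    exact ⟨hu1, by simpa using (Metric.mem_ball.1 hu2).le⟩
  have hsq := EulerStat.lintegral_sq_lt_top_of_ae_le (hgen.mono fun u hu => hu.2)
  have hsol := EulerStat.isDissipativeSolution_flowMeasure hT hgen
  exact ⟨EulerStat.flowMeasure T μbar, hsol, fun μ' hμ' => hsol.ae_eq hT hG hsq hμ'⟩
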